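/- Let $G$ be a group with a finite symmetric presentation $\mathcal P=\langle A\mid R\rangle$: $A$ is a finite set closed under a formal inversion, no letter of $A$ represents the identity of $G$, and $R$ is a finite set of nonempty words over $A$, closed under inversion, cyclic conjugation and nonempty free reduction. Let $X$ be its Cayley 2-complex, with basepoint the identity vertex $\epsilon$ and 1-skeleton $X^{(1)}$ (relator loops differing only in starting point and direction bound the same 2-cell). The coarse distance $\tilde d(p)$ from $\epsilon$ to a point $p\in X$ is the path distance in $X^{(1)}$ if $p$ is a vertex; it is $\frac12$ plus the smaller distance of an endpoint of $e$ if $p$ is in the interior of an edge $e$; it is the maximum of the coarse distances of points in the interiors of boundary edges of $\sigma$, minus $\frac14$, if $p$ is in the interior of a 2-cell $\sigma$. Let $\mathbb N[\frac14]=\{0,\frac14,\frac12,\dots\}$ and let $f:\mathbb N[\frac14]\to\mathbb N[\frac14]$ be nondecreasing. A map $\psi:Z\times[0,1]\to X$ is $f$-tame if $\tilde d(\psi(p,s))\le f(\tilde d(\psi(p,t)))$ for all $p\in Z$ and $0\le s<t\le1$. A 1-combing of $(Y,Z)$ at a vertex $y_0$, for a 2-complex $Y$ and a subcomplex $Z$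 of $Y^{(1)}$, is a continuous $\Psi:Z\times[0,1]\to Y$ with $\Psi(p,0)=y_0$ and $\Psi(p,1)=p$ for all $p\in Z$, with $\Psi(y_0,t)=y_0$ for all $t$ if $y_0\in Z$, and with $\Psi(p,t)\in Y^{(1)}$ for all $t$ if $p$ is a vertex of $Z$. For a van Kampen diagram $\Delta$ with basepoint $*$, $\pi_\Delta:\Delta\to X$ is the cellular map that takes $*$ to $\epsilon$ and maps $n$-cells to $n$-cells preserving labels and orientations (unique up to symmetries of 2-cells). * $f$ is an extrinsic tame filling function for $(G,\mathcal P)$ if every word $w$ over $A$ representing the identity of $G$ has a van Kampen diagram $\Delta$ over $\mathcal P$ and a 1-combing $\Psi$ of $(\Delta,\partial\Delta)$ at $*$ such that $\pi_\Delta\circ\Psi$ is $f$-tame. * A 1-combing $\Upsilon$ of $(X,X^{(1)})$ at $\epsilon$ is diagrammatic if (i) for each vertex $v$ the path $\Upsilon(v,\cdot)$ follows, up to monotone reparametrization, a simple edge path labelled by a word $w_v$, and (ii) for each directed edge $e$ from $u$ to $v$ labelled $a$ there are a van Kampen diagram $\Delta$ for $w_uaw_v^{-1}$ and a 1-combing $\Theta$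 of $(\Delta,\hat e)$ at $*$, where $\hat e$ is the closed boundary edge corresponding to the letter $a$, whose paths to the initial and terminal endpoints of $\hat e$ follow the boundary paths from $*$ labelled $w_u$ and $w_v$, such that $\Upsilon(\pi_\Delta(p),t)=\pi_\Delta(\Theta(p,t))$ for all $p\in\hat e$ and $t\in[0,1]$. The function $f$ is a tame combing function for $(G,\mathcal P)$ if some diagrammatic 1-combing of $X$ is $f$-tame. * $f,g:\mathbb N[\frac14]\to\mathbb N[\frac14]$ are Lipschitz equivalent if for some constant $C\in\mathbb N$ we have $f(n)\le Cg(Cn+C)+C$ and $g(n)\le Cf(Cn+C)+C$ for all $n$. Then for every nondecreasing $f:\mathbb N[\frac14]\to\mathbb N[\frac14]$: $f$ is Lipschitz equivalent to some (nondecreasing) extrinsic tame filling function for $(G,\mathcal P)$ if and only if $f$ is Lipschitz equivalent to some (nondecreasing) tame combing function for $(G,\mathcal P)$. -/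

import Mathlib

noncomputable section

/-! ### Combinatorial 2-complexes and their geometric realizations -/

/-- A graph given by directed edges: `rev` exchanges the two orientations of an undirected edge. -/
structure DartGraph.{u, v} where
  V : Type u
  D : Type v
  rev : D → D
  rev_rev : ∀ d, rev (rev d) = d
  rev_ne : ∀ d, rev d ≠ d
  init : D → V

namespace DartGraph

/-- The terminal vertex of a directed edge. -/
def term (K : DartGraph) (d : K.D) : K.V := K.init (K.rev d)

/-- `K.IsWalk l u v`: the list `l` of directed edges is an edge path from `u` to `v`. -/
def IsWalk (K : DartGraph) : List K.D → K.V → K.V → Prop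
  | [], u, v => u = v
  | d :: l, u, v => K.init d = u ∧ IsWalk K l (K.term d) v

/-- The edge path `l` traversed backwards. -/
def revWalk (K : DartGraph) (l : List K.D) : List K.D := l.reverse.map K.rev

/-- The path metric on vertices. -/
def dist (K : DartGraph) (u v : K.V) : ℕ := sInf {n | ∃ l, K.IsWalk l u v ∧ l.length = n}

end DartGraph

/-- A combinatorial 2-complex: each 2-cell is a polygon attached along a closed edge path of
positive length. -/
structure CombComplex.{u, v, w} extends DartGraph.{u, v} where
  F : Type w
  bdry : F → List D
  bdry_ne_nil : ∀ f, bdry f ≠ []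
  bdry_closed : ∀ f, ∃ v, toDartGraph.IsWalk (bdry f) v v

/-- The closed unit disk. -/
abbrev Disk : Type := Metric.closedBall (0 : ℂ) 1

/-- The boundary circle of the disk is divided into `n` arcs of equal length;
this is the point at parameter `t` of the `k`-th arc. -/
def circlePt (n k : ℕ) (t : ℝ) : Disk :=
  ⟨Complex.exp (((2 * Real.pi * ((k + t) / n) : ℝ) : ℂ) * Complex.I), by
    rw [mem_closedBall_zero_iff, Complex.norm_exp_ofReal_mul_I]⟩

/-- A rotation or reflection, acting on the closed unit disk. -/
def diskMap (ρ : ℂ ≃ₗᵢ[ℝ] ℂ) (z : Disk) : Disk :=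
  ⟨ρ z, by
    have h := z.2
    rw [mem_closedBall_zero_iff] at h ⊢
    rwa [ρ.norm_map]⟩

namespace CombComplex

/-- The disjoint union of a point for each vertex, an interval for each directed edge and a disk
for each 2-cell (the index sets are discrete). -/
abbrev Pre (K : CombComplex) : Type _ :=
  (Σ _ : K.V, Unit) ⊕ (Σ _ : K.D, unitInterval) ⊕ (Σ _ : K.F, Disk)

/-- The gluing relation of the cell complex. -/
inductive Glue (K : CombComplex) : K.Pre → K.Pre → Prop
  | rev (d : K.D) (t : unitInterval) :
      Glue K (.inr (.inl ⟨K.rev d, unitInterval.symm t⟩)) (.inr (.inl ⟨d, t⟩))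
  | init (d : K.D) : Glue K (.inr (.inl ⟨d, 0⟩)) (.inl ⟨K.init d, ()⟩)
  | face (f : K.F) (k : Fin (K.bdry f).length) (t : unitInterval) :
      Glue K (.inr (.inr ⟨f, circlePt (K.bdry f).length k t⟩))
        (.inr (.inl ⟨(K.bdry f).get k, t⟩))

/-- The geometric realization, with the quotient (CW) topology. -/
def Space (K : CombComplex) : Type _ := Quot K.Glue

instance (K : CombComplex) : TopologicalSpace K.Space :=
  inferInstanceAs (TopologicalSpace (Quot K.Glue))

/-- A vertex as a point. -/
def vert (K : CombComplex) (v : K.V) : K.Space := Quot.mk _ (.inl ⟨v, ()⟩)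

/-- The point at parameter `t` of a directed edge. -/
def edgePt (K : CombComplex) (d : K.D) (t : unitInterval) : K.Space :=
  Quot.mk _ (.inr (.inl ⟨d, t⟩))

/-- The point of a closed 2-cell corresponding to `z` in the closed disk. -/
def facePt (K : CombComplex) (f : K.F) (z : Disk) : K.Space :=
  Quot.mk _ (.inr (.inr ⟨f, z⟩))

/-- The set of vertices. -/
def vertexSet (K : CombComplex) : Set K.Space := Set.range K.vert

/-- The closed 1-cell underlying a directed edge. -/
def closedEdge (K : CombComplex) (d : K.D) : Set K.Space := Set.range (K.edgePt d)

/-- The 1-skeleton. -/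
def oneSkeleton (K : CombComplex) : Set K.Space := K.vertexSet ∪ ⋃ d, K.closedEdge d

/-- The coarse distance to the interior points of an edge. -/
def edgeDist (K : CombComplex) (y : K.V) (d : K.D) : ℚ :=
  (min (K.dist y (K.init d)) (K.dist y (K.term d)) : ℕ) + 1 / 2

/-- The coarse distance to the interior points of a 2-cell. -/
def faceDist (K : CombComplex) (y : K.V) (f : K.F) : ℚ :=
  ((K.bdry f).map (K.edgeDist y)).foldr max 0 - 1 / 4

open Classical in
/-- The coarse distance from the vertex `y` to a point `p`. The cell chosen in each case is the
unique cell whose interior contains `p`. -/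
def coarseDistRat (K : CombComplex) (y : K.V) (p : K.Space) : ℚ :=
  if h : ∃ v, p = K.vert v then K.dist y h.choose
  else if h : ∃ d, p ∈ K.closedEdge d then K.edgeDist y h.choose
  else if h : ∃ f, ∃ z, p = K.facePt f z then K.faceDist y h.choose
  else 0

end CombComplex

/-! ### Functions on the quarter-integers, and tameness -/

/-- The set `{0, 1/4, 1/2, 3/4, 1, ...}`. -/
abbrev QuarterNat : Type := {q : ℚ // ∃ k : ℕ, q = k / 4}

/-- `n ↦ C n + C`. -/
def QuarterNat.affine (C : ℕ) (n : QuarterNat) : QuarterNat :=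
  ⟨C * n.1 + C, by
    obtain ⟨k, hk⟩ := n.2
    exact ⟨C * k + 4 * C, by rw [hk]; push_cast; ring⟩⟩

/-- Lipschitz equivalence. -/
def LipschitzEquivalent (f g : QuarterNat → QuarterNat) : Prop :=
  ∃ C : ℕ, ∀ n : QuarterNat,
    (f n : ℚ) ≤ C * (g (n.affine C) : ℚ) + C ∧ (g n : ℚ) ≤ C * (f (n.affine C) : ℚ) + C

namespace CombComplex

theorem exists_foldr_max_edgeDist (K : CombComplex) (y : K.V) (l : List K.D) (hl : l ≠ []) :
    ∃ k : ℕ, (l.map (K.edgeDist y)).foldr max 0 = k + 1 / 2 := by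
  induction l with
  | nil => exact absurd rfl hl
  | cons d l ih =>
    by_cases h : l = []
    · subst h
      refine ⟨min (K.dist y (K.init d)) (K.dist y (K.term d)), ?_⟩
      simp only [List.map_cons, List.map_nil, List.foldr_cons, List.foldr_nil]
      exact max_eq_left (by unfold edgeDist; positivity)
    · obtain ⟨k, hk⟩ := ih h
      simp only [List.map_cons, List.foldr_cons, hk]
      rcases max_choice (K.edgeDist y d) ((k : ℚ) + 1 / 2) with h' | h'
      · exact ⟨_, h'⟩
      · exact ⟨_, h'⟩

theorem coarseDistRat_mem (K : CombComplex) (y : K.V) (p : K.Space) :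
    ∃ k : ℕ, K.coarseDistRat y p = k / 4 := by
  unfold coarseDistRat
  split_ifs with h1 h2 h3
  · exact ⟨4 * K.dist y h1.choose, by push_cast; ring⟩
  · exact ⟨4 * min (K.dist y (K.init h2.choose)) (K.dist y (K.term h2.choose)) + 2, by
      unfold edgeDist; push_cast; ring⟩
  · obtain ⟨k, hk⟩ := K.exists_foldr_max_edgeDist y _ (K.bdry_ne_nil h3.choose)
    exact ⟨4 * k + 1, by unfold faceDist; rw [hk]; push_cast; ring⟩
  · exact ⟨0, by simp⟩

/-- The coarse distance, as an element of `{0, 1/4, 1/2, ...}`. -/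
def coarseDist (K : CombComplex) (y : K.V) (p : K.Space) : QuarterNat :=
  ⟨K.coarseDistRat y p, K.coarseDistRat_mem y p⟩

/-- `f`-tameness of a family of paths in `K`, with respect to the base vertex `y`. -/
def IsTame (K : CombComplex) (y : K.V) (f : QuarterNat → QuarterNat) {Z : Type*}
    (ψ : Z → unitInterval → K.Space) : Prop :=
  ∀ (p : Z) (s t : unitInterval), s < t → K.coarseDist y (ψ p s) ≤ f (K.coarseDist y (ψ p t))

/-- A 1-combing of the pair `(K, Z)` at the vertex `y`, where `Z` is a subcomplex of the
1-skeleton. -/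
structure IsOneCombing (K : CombComplex) (Z : Set K.Space) (y : K.V)
    (ψ : Z → unitInterval → K.Space) : Prop where
  continuous : Continuous (fun q : Z × unitInterval => ψ q.1 q.2)
  start : ∀ p, ψ p 0 = K.vert y
  finish : ∀ p, ψ p 1 = p
  base : ∀ p : Z, (p : K.Space) = K.vert y → ∀ t, ψ p t = K.vert y
  vertex : ∀ p : Z, (p : K.Space) ∈ K.vertexSet → ∀ t, ψ p t ∈ K.oneSkeleton

/-- The path `γ` follows the edge path `l` starting at `u`, up to a monotone reparametrization:
`h` is the length travelled along `l`. -/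
def Follows (K : CombComplex) (u : K.V) (l : List K.D) (γ : unitInterval → K.Space) : Prop :=
  ∃ h : unitInterval → ℝ, Continuous h ∧ Monotone h ∧ h 0 = 0 ∧ h 1 = l.length ∧
    (l = [] → ∀ t, γ t = K.vert u) ∧
    ∀ (k : Fin l.length) (x t : unitInterval), h t = k + x → γ t = K.edgePt (l.get k) x

end CombComplex

/-! ### Finite symmetric presentations and Cayley complexes -/

/-- One free reduction step, with respect to a formal inversion `inv` of letters. -/
inductive FreeStep {A : Type*} (inv : A → A) : List A → List A → Prop
  | cancel (u : List A) (a : A) (v : List A) : FreeStep inv (u ++ a :: inv a :: v) (u ++ v)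

/-- The formal inverse of a word. -/
def invWord {A : Type*} (inv : A → A) (w : List A) : List A := w.reverse.map inv

/-- A finite symmetric presentation of `G`: finitely many letters, closed under a formal inversion
and none of them trivial in `G`, and a finite set of nonempty relators, closed under inversion,
cyclic conjugation and (nonempty) free reduction. -/
structure SymmPresentation (G : Type*) [Group G] where
  A : Type
  finite_A : Finite A
  inv : A → A
  inv_inv : ∀ a, inv (inv a) = a
  rep : A → G
  rep_inv : ∀ a, rep (inv a) = (rep a)⁻¹
  rep_ne_one : ∀ a, rep a ≠ 1
  R : Set (List A)
  finite_R : R.Finite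
  nil_notMem : [] ∉ R
  invWord_mem : ∀ r ∈ R, invWord inv r ∈ R
  rotate_mem : ∀ r ∈ R, ∀ n, r.rotate n ∈ R
  reduced_mem : ∀ r ∈ R, ∀ r', Relation.ReflTransGen (FreeStep inv) r r' →
    (∀ r'', ¬ FreeStep inv r' r'') → r' ≠ [] → r' ∈ R
  surjective : Function.Surjective (FreeGroup.lift rep)
  ker_eq : (FreeGroup.lift rep).ker = Subgroup.normalClosure
    ({x | ∃ r ∈ R, x = (r.map FreeGroup.of).prod} ∪
      {x | ∃ a, x = FreeGroup.of a * FreeGroup.of (inv a)})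

namespace SymmPresentation

variable {G : Type*} [Group G]

/-- The element of `G` represented by a word. -/
def eval (P : SymmPresentation G) (w : List P.A) : G := (w.map P.rep).prod

theorem eval_relator (P : SymmPresentation G) {r : List P.A} (hr : r ∈ P.R) : P.eval r = 1 := by
  have h : (r.map FreeGroup.of).prod ∈ (FreeGroup.lift P.rep).ker := by
    rw [P.ker_eq]
    exact Subgroup.subset_normalClosure (Or.inl ⟨r, hr, rfl⟩)
  rw [MonoidHom.mem_ker, map_list_prod, List.map_map] at h
  rw [← h, eval]
  congr 2
  ext a
  simp

/-- The Cayley graph; `(g, a)` is the edge from `g` to `g a` labelled `a`, and `(g a, a⁻¹)` is the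
same undirected edge. -/
@[simps] def cayleyGraph (P : SymmPresentation G) : DartGraph where
  V := G
  D := G × P.A
  rev d := (d.1 * P.rep d.2, P.inv d.2)
  rev_rev d := by simp [P.rep_inv, P.inv_inv]
  rev_ne d h := P.rep_ne_one d.2 (by simpa using congrArg Prod.fst h)
  init d := d.1

/-- The edge path of the Cayley graph that starts at `g` and is labelled by the word `w`. -/
def path (P : SymmPresentation G) : G → List P.A → List (G × P.A)
  | _, [] => []
  | g, a :: w => (g, a) :: path P (g * P.rep a) w

theorem isWalk_path (P : SymmPresentation G) (g : G) (w : List P.A) :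
    P.cayleyGraph.IsWalk (P.path g w) g (g * P.eval w) := by
  induction w generalizing g with
  | nil => exact (mul_one g).symm
  | cons a w ih =>
    refine ⟨rfl, ?_⟩
    have h := ih (g * P.rep a)
    simpa [eval, mul_assoc, DartGraph.term] using h

/-- Relator loops in the Cayley graph: `(g, r)` is the loop at `g` labelled by the relator `r`. -/
abbrev Loop (P : SymmPresentation G) : Type _ := {p : G × List P.A // p.2 ∈ P.R}

/-- Two relator loops are related if they differ by moving the starting point by one edge, or by
reversing the direction. -/
inductive LoopStep (P : SymmPresentation G) : P.Loop → P.Loop → Prop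
  | shift (p q : P.Loop) (g : G) (a : P.A) (s : List P.A) (hp : p.1 = (g, a :: s))
      (hq : q.1 = (g * P.rep a, s ++ [a])) : LoopStep P p q
  | invert (p q : P.Loop) (g : G) (r : List P.A) (hp : p.1 = (g, r))
      (hq : q.1 = (g, invWord P.inv r)) : LoopStep P p q

/-- The Cayley 2-complex: one 2-cell is attached along each relator loop, where loops that differ
only in their starting point and direction give the same 2-cell. -/
def cayleyComplex (P : SymmPresentation G) : CombComplex where
  toDartGraph := P.cayleyGraph
  F := Quot P.LoopStep
  bdry f := P.path f.out.1.1 f.out.1.2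
  bdry_ne_nil f h := by
    obtain ⟨⟨⟨g, r⟩, hr⟩, -⟩ : ∃ p, p = f.out := ⟨_, rfl⟩
    have hmem := f.out.2
    rcases hw : f.out.1.2 with _ | ⟨a, s⟩
    · rw [hw] at hmem
      exact P.nil_notMem hmem
    · rw [hw] at h
      simp [path] at h
  bdry_closed f := by
    refine ⟨f.out.1.1, ?_⟩
    have h := P.isWalk_path f.out.1.1 f.out.1.2
    rwa [P.eval_relator f.out.2, mul_one] at h

/-- The vertex of the Cayley complex labelled by the identity. -/
def origin (P : SymmPresentation G) : P.cayleyComplex.V := (1 : G)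

/-- A word that labels a path in the Cayley graph without repeated vertices. -/
def IsSimpleWord (P : SymmPresentation G) (w : List P.A) : Prop :=
  ∀ i j : ℕ, i < j → j ≤ w.length → P.eval (w.take i) ≠ P.eval (w.take j)

end SymmPresentation

/-! ### Van Kampen diagrams -/

/-- A van Kampen diagram for the word `w`. Planarity is expressed combinatorially: all 2-cells are
traversed counterclockwise, and the complex together with one exterior face, traversed along the
reverse of the boundary path, is a cell decomposition of the 2-sphere. Removing the open exterior
face from the sphere leaves a planar contractible 2-complex with the given counterclockwise
boundary path, and every planar contractible 2-complex arises in this way. -/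
structure VanKampenDiagram {G : Type*} [Group G] (P : SymmPresentation G) (w : List P.A)
    extends CombComplex.{0, 0, 0} where
  finite_V : Finite V
  finite_D : Finite D
  finite_F : Finite F
  base : V
  label : D → P.A
  label_rev : ∀ d, label (rev d) = P.inv (label d)
  boundary : List D
  boundary_walk : toDartGraph.IsWalk boundary base base
  boundary_label : boundary.map label = w
  bdry_label : ∀ f, (bdry f).map label ∈ P.R
  connected : ∀ v, ∃ l, toDartGraph.IsWalk l base v
  /-- the boundary walks of all faces, the exterior face being `none` -/
  faceWalk : Option F → List D
  faceWalk_none : faceWalk none = toDartGraph.revWalk boundary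
  faceWalk_some : ∀ f, faceWalk (some f) = bdry f
  /-- every directed edge has exactly one face to its left, and occurs once in its boundary -/
  left_face : Function.Bijective
    (fun c : Σ o : Option F, Fin (faceWalk o).length => (faceWalk c.1).get c.2)
  /-- the faces around a vertex form a single cycle: any two edges starting at the same vertex are
  related by repeatedly passing from an edge `d` to the successor of `rev d` in the boundary walk
  of the face to the left of `rev d` -/
  vertex_link : ∀ d d', init d = init d' → Relation.ReflTransGen
    (fun e e' => ∃ (o : Option F) (k : ℕ),
      ((faceWalk o).rotate k).head? = some (rev e) ∧
      ((faceWalk o).rotate (k + 1)).head? = some e') d d'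
  /-- the Euler characteristic of the sphere: `V - E + (F + 1) = 2`, where `E` is half the number
  of directed edges -/
  euler : 2 * Nat.card V + 2 * Nat.card F = Nat.card D + 2

namespace VanKampenDiagram

variable {G : Type*} [Group G] {P : SymmPresentation G} {w : List P.A}

/-- The boundary of the diagram. -/
def boundarySet (Δ : VanKampenDiagram P w) : Set Δ.Space :=
  {Δ.vert Δ.base} ∪ ⋃ d ∈ Δ.boundary, Δ.closedEdge d

/-- The cellular map from the diagram to the Cayley complex that takes the basepoint to the identity
vertex, and `n`-cells homeomorphically to `n`-cells preserving labels and orientations of edges.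
On a 2-cell it is a rotation or reflection of the disk, which necessarily matches the boundary
labels. It is unique up to symmetries of 2-cells whose boundary loop is periodic or
self-inverse. -/
def IsProjection (Δ : VanKampenDiagram P w) (π : Δ.Space → P.cayleyComplex.Space) : Prop :=
  ∃ φ : Δ.V → G, φ Δ.base = 1 ∧
    (∀ v, π (Δ.vert v) = P.cayleyComplex.vert (φ v)) ∧
    (∀ d t, π (Δ.edgePt d t) = P.cayleyComplex.edgePt (φ (Δ.init d), Δ.label d) t) ∧
    (∀ f, ∃ (f' : P.cayleyComplex.F) (ρ : ℂ ≃ₗᵢ[ℝ] ℂ),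
      ∀ z, π (Δ.facePt f z) = P.cayleyComplex.facePt f' (diskMap ρ z))

/-- An edge 1-combing: a 1-combing of the closed edge underlying `d`, where the boundary path is
`l₁`, then `d`, then `l₂`, whose paths to the endpoints of `d` follow `l₁` and the reverse of
`l₂`. -/
structure IsEdgeOneCombing (Δ : VanKampenDiagram P w) (l₁ : List Δ.D) (d : Δ.D) (l₂ : List Δ.D)
    (θ : Δ.closedEdge d → unitInterval → Δ.Space) : Prop where
  boundary_eq : Δ.boundary = l₁ ++ d :: l₂
  combing : Δ.IsOneCombing (Δ.closedEdge d) Δ.base θ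
  follows_init : ∀ p : Δ.closedEdge d, (p : Δ.Space) = Δ.vert (Δ.init d) →
    Δ.Follows Δ.base l₁ (θ p)
  follows_term : ∀ p : Δ.closedEdge d, (p : Δ.Space) = Δ.vert (Δ.term d) →
    Δ.Follows Δ.base (Δ.revWalk l₂) (θ p)

end VanKampenDiagram

namespace SymmPresentation

variable {G : Type*} [Group G]

/-- Extrinsic tame filling functions. -/
def IsExtrinsicTameFilling (P : SymmPresentation G) (f : QuarterNat → QuarterNat) : Prop :=
  Monotone f ∧ ∀ w : List P.A, P.eval w = 1 →
    ∃ (Δ : VanKampenDiagram P w) (ψ : Δ.boundarySet → unitInterval → Δ.Space)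
      (π : Δ.Space → P.cayleyComplex.Space),
      Δ.IsOneCombing Δ.boundarySet Δ.base ψ ∧ Δ.IsProjection π ∧
      P.cayleyComplex.IsTame P.origin f (fun p t => π (ψ p t))

/-- Diagrammatic 1-combings of the Cayley complex. -/
def IsDiagrammatic (P : SymmPresentation G)
    (Υ : P.cayleyComplex.oneSkeleton → unitInterval → P.cayleyComplex.Space) : Prop :=
  P.cayleyComplex.IsOneCombing P.cayleyComplex.oneSkeleton P.origin Υ ∧
  ∃ word : G → List P.A,
    (∀ v : G, P.IsSimpleWord (word v) ∧
      ∀ p : P.cayleyComplex.oneSkeleton,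
        (p : P.cayleyComplex.Space) = P.cayleyComplex.vert v →
          P.cayleyComplex.Follows P.origin (P.path 1 (word v)) (Υ p)) ∧
    ∀ (u : G) (a : P.A),
      ∃ (Δ : VanKampenDiagram P (word u ++ a :: invWord P.inv (word (u * P.rep a))))
        (l₁ : List Δ.D) (d : Δ.D) (l₂ : List Δ.D)
        (θ : Δ.closedEdge d → unitInterval → Δ.Space) (π : Δ.Space → P.cayleyComplex.Space),
        l₁.length = (word u).length ∧ Δ.IsEdgeOneCombing l₁ d l₂ θ ∧ Δ.IsProjection π ∧
        ∀ (p : Δ.closedEdge d) (q : P.cayleyComplex.oneSkeleton) (t : unitInterval),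
          (q : P.cayleyComplex.Space) = π p → Υ q t = π (θ p t)

/-- Tame combing functions. -/
def IsTameCombing (P : SymmPresentation G) (f : QuarterNat → QuarterNat) : Prop :=
  Monotone f ∧
    ∃ Υ : P.cayleyComplex.oneSkeleton → unitInterval → P.cayleyComplex.Space,
      P.IsDiagrammatic Υ ∧ P.cayleyComplex.IsTame P.origin f Υ

end SymmPresentation

end

noncomputable section

/-! ### Edge paths -/

namespace DartGraph

variable {K : DartGraph}

/-! Each kind of function is converted into the other by passing from `f` to n ↦ f(n+3)+3, that is
`QuarterNat.widen 3 f`, which stays in the same Lipschitz class (`LipschitzEquivalent.widen`). The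
constant 3 absorbs two facts. Tameness of the paths ending at vertices forces f(n) ≥ n - 2 at every
coarse distance n that occurs (`Dominates`), and coarse distance varies by at most 1 on a closed
edge. So a tame path may be prolonged along a route on which coarse distance is nondecreasing up to
an error of 1 (`tamePath_travel`).

From fillings to combings: choose a geodesic word for every group element, so that an edge of the
Cayley graph gives a word "geodesic, letter, inverse geodesic". Take a tame filling of it. A combing
of its boundary circle is constant over the basepoint, hence over both ends of the boundary
parameter interval [0,N]. For the point τ of the edge, first follow the combing path to the boundary
point τN, then slide along the boundary to the point τ of the edge (`exists_edgeFamily`). For τ = 0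
and τ = 1 this is exactly the walk along one of the two geodesics, and sliding along a geodesic
triangle towards the edge is nearly monotone in coarse distance (`coarseDistRat_triangle`). The
families over the edges then agree at vertices and fit together to a combing of the 1-skeleton
(`exists_edgewise`); if the other orientation of an edge was used, the mirror image of its diagram
serves.

From combings to fillings: read a null-homotopic word w letter by letter and glue the diagrams given
by the diagrammatic combing along their common sides, which are simple paths (`Gluing.diagram`,
`exists_fan`). The first and last sides are empty, so the result is a van Kampen diagram for w with
a path to each point of the boundary walk, and these paths project to paths of the combing.

The difficulty is that the boundary walk may visit a vertex or an edge several times, while a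
combing assigns one path to each point. Suppose that the walk visits x at times i and k. The
boundary loop between these times cuts off a part of the diagram that meets the rest only in x, and
collapsing this part to x is a retraction (`exists_cutOff`). A path from the basepoint enters the
part only through x, so the retraction preserves tameness, and it fixes the paths given at times i
and k because these stay at x once they reach it. Applying it to the paths at times between i and k
gives a homotopy between the two paths through tame paths ending at x (`exists_cap`). Attaching such
caps at both ends of an edge makes the paths to a vertex independent of the visit
(`IsBoundaryFamily.exists_combing`).

That the loop separates the diagram at x is planarity. It is obtained by linear algebra:
coboundaries of vertex functions and boundaries of face functions are orthogonal, and Euler's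
formula makes the dimensions match, so every 1-cycle bounds (`exists_boundary_eq`). The face
coefficients act as winding numbers of the loop, which are locally constant away from x
(`exists_separation`). -/

@[simp] theorem term_rev (d : K.D) : K.term (K.rev d) = K.init d := by simp [term, K.rev_rev]

@[simp] theorem init_rev (d : K.D) : K.init (K.rev d) = K.term d := rfl

theorem rev_injective : Function.Injective K.rev := fun a b h => by
  rw [← K.rev_rev a, h, K.rev_rev]

theorem isWalk_append {l m : List K.D} {u v : K.V} :
    K.IsWalk (l ++ m) u v ↔ ∃ x, K.IsWalk l u x ∧ K.IsWalk m x v := by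
  induction l generalizing u with
  | nil => simp [IsWalk]
  | cons d l ih => simp only [List.cons_append, IsWalk, ih]; grind

theorem IsWalk.append {l m : List K.D} {u v x : K.V} (h : K.IsWalk l u x) (h' : K.IsWalk m x v) :
    K.IsWalk (l ++ m) u v := isWalk_append.2 ⟨x, h, h'⟩

theorem IsWalk.unique {l : List K.D} {u v v' : K.V} (h : K.IsWalk l u v) (h' : K.IsWalk l u v') :
    v = v' := by
  induction l generalizing u with
  | nil => exact h.symm.trans h'
  | cons d l ih => exact ih h.2 h'.2

@[simp] theorem revWalk_nil : K.revWalk [] = [] := rfl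

@[simp] theorem revWalk_append (l m : List K.D) :
    K.revWalk (l ++ m) = K.revWalk m ++ K.revWalk l := by simp [revWalk]

@[simp] theorem revWalk_cons (d : K.D) (l : List K.D) :
    K.revWalk (d :: l) = K.revWalk l ++ [K.rev d] := by simp [revWalk]

@[simp] theorem revWalk_revWalk (l : List K.D) : K.revWalk (K.revWalk l) = l := by
  induction l with
  | nil => rfl
  | cons d l ih => simp [ih, K.rev_rev]

@[simp] theorem length_revWalk (l : List K.D) : (K.revWalk l).length = l.length := by
  simp [revWalk]

theorem getElem_revWalk (l : List K.D) (k : ℕ) (hk : k < (K.revWalk l).length) :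
    (K.revWalk l)[k] = K.rev (l[l.length - 1 - k]'(by rw [length_revWalk] at hk; omega)) := by
  simp [revWalk]

theorem mem_revWalk {l : List K.D} {d : K.D} : d ∈ K.revWalk l ↔ K.rev d ∈ l := by
  simp only [revWalk, List.mem_map, List.mem_reverse]
  constructor
  · rintro ⟨e, he, rfl⟩; rwa [K.rev_rev]
  · intro h; exact ⟨_, h, K.rev_rev d⟩

theorem IsWalk.revWalk {l : List K.D} {u v : K.V} (h : K.IsWalk l u v) :
    K.IsWalk (K.revWalk l) v u := by
  induction l generalizing u with
  | nil => exact Eq.symm h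
  | cons d l ih =>
    rw [revWalk_cons]
    refine (ih h.2).append ⟨rfl, ?_⟩
    rw [term_rev]; exact h.1

theorem dist_le {l : List K.D} {u v : K.V} (h : K.IsWalk l u v) : K.dist u v ≤ l.length :=
  Nat.sInf_le ⟨l, h, rfl⟩

theorem exists_walk_dist {l : List K.D} {u v : K.V} (h : K.IsWalk l u v) :
    ∃ m, K.IsWalk m u v ∧ m.length = K.dist u v :=
  Nat.sInf_mem (s := {n | ∃ l, K.IsWalk l u v ∧ l.length = n}) ⟨_, l, h, rfl⟩

theorem IsWalk.term_getElem {l : List K.D} {u v : K.V} (h : K.IsWalk l u v) (k : ℕ)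
    (hk : k + 1 < l.length) : K.term l[k] = K.init l[k + 1] := by
  induction l generalizing u k with
  | nil => simp at hk
  | cons d l ih =>
    cases k with
    | zero =>
      cases l with
      | nil => simp at hk
      | cons e l => exact h.2.1.symm
    | succ k =>
      simp only [List.getElem_cons_succ]
      exact ih h.2 k (by simpa using hk)

theorem IsWalk.init_getElem_zero {l : List K.D} {u v : K.V} (h : K.IsWalk l u v)
    (hk : 0 < l.length) : K.init l[0] = u := by
  cases l with
  | nil => simp at hk
  | cons e l => exact h.1

theorem IsWalk.term_getElem_last {l : List K.D} {u v : K.V} (h : K.IsWalk l u v) (k : ℕ)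
    (hk : k + 1 = l.length) : K.term l[k] = v := by
  induction l generalizing u k with
  | nil => simp at hk
  | cons d l ih =>
    cases k with
    | zero =>
      cases l with
      | nil => exact h.2
      | cons e l => simp at hk
    | succ k =>
      simp only [List.getElem_cons_succ]
      exact ih h.2 k (by simpa using hk)

/-- The vertex reached after the first `k` edges of an edge path from `u`. -/
def walkVert (K : DartGraph) : K.V → List K.D → ℕ → K.V
  | u, [], _ => u
  | u, _ :: _, 0 => u
  | _, d :: l, k + 1 => walkVert K (K.term d) l k

@[simp] theorem walkVert_zero (u : K.V) (l : List K.D) : K.walkVert u l 0 = u := by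
  cases l <;> rfl

@[simp] theorem walkVert_cons_succ (u : K.V) (d : K.D) (l : List K.D) (k : ℕ) :
    K.walkVert u (d :: l) (k + 1) = K.walkVert (K.term d) l k := rfl

theorem IsWalk.init_getElem {l : List K.D} {u v : K.V} (h : K.IsWalk l u v) (k : ℕ)
    (hk : k < l.length) : K.init l[k] = K.walkVert u l k := by
  induction l generalizing u k with
  | nil => simp at hk
  | cons d l ih =>
    cases k with
    | zero => exact h.1
    | succ k => exact ih h.2 k (by simpa using hk)

theorem IsWalk.term_getElem' {l : List K.D} {u v : K.V} (h : K.IsWalk l u v) (k : ℕ)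
    (hk : k < l.length) : K.term l[k] = K.walkVert u l (k + 1) := by
  induction l generalizing u k with
  | nil => simp at hk
  | cons d l ih =>
    cases k with
    | zero => simp
    | succ k => exact ih h.2 k (by simpa using hk)

theorem IsWalk.walkVert_length {l : List K.D} {u v : K.V} (h : K.IsWalk l u v) :
    K.walkVert u l l.length = v := by
  induction l generalizing u with
  | nil => exact h
  | cons d l ih => exact ih h.2

theorem walkVert_append_left (l m : List K.D) (u : K.V) (k : ℕ) (hk : k ≤ l.length) :
    K.walkVert u (l ++ m) k = K.walkVert u l k := by
  induction l generalizing u k with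
  | nil => simp at hk; subst hk; simp
  | cons d l ih =>
    cases k with
    | zero => simp
    | succ k => exact ih _ k (by simpa using hk)

end DartGraph

/-! ### Cyclic successors in lists -/

/-- `b` follows `a` in the cyclic list `l`. -/
def CyclicSucc {α : Type*} (l : List α) (a b : α) : Prop :=
  ∃ k : ℕ, (l.rotate k).head? = some a ∧ (l.rotate (k + 1)).head? = some b

/-- The rotation index is traded for a splitting of the list at `a`. The entry after `a` is the head
of `q ++ p ++ [a]`, which covers the wrap-around and also the one-element list, where `a` follows
itself. -/
theorem cyclicSucc_iff {α : Type*} {l : List α} {a b : α} :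
    CyclicSucc l a b ↔ ∃ p q, l = p ++ a :: q ∧ (q ++ p ++ [a]).head? = some b := by
  constructor
  · rintro ⟨k, h1, h2⟩
    have hl : l ≠ [] := by rintro rfl; simp at h1
    have hlen : 0 < l.length := List.length_pos_iff.2 hl
    rw [← List.rotate_rotate] at h2
    rw [← List.rotate_mod l k] at h1 h2
    have hk : k % l.length < l.length := Nat.mod_lt _ hlen
    rw [List.rotate_eq_drop_append_take hk.le] at h1 h2
    have hd : l.drop (k % l.length) = l[k % l.length] :: l.drop (k % l.length + 1) := by
      rw [List.getElem_cons_drop]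
    rw [hd] at h1 h2
    simp only [List.cons_append, List.head?_cons, Option.some.injEq] at h1
    refine ⟨l.take (k % l.length), l.drop (k % l.length + 1), ?_, ?_⟩
    · rw [← h1, ← hd, List.take_append_drop]
    · rw [h1] at h2
      simpa using h2
  · rintro ⟨p, q, rfl, h⟩
    refine ⟨p.length, ?_, ?_⟩
    · rw [List.rotate_append_length_eq]; rfl
    · rw [← List.rotate_rotate, List.rotate_append_length_eq]
      simpa using h

theorem CyclicSucc.mem_left {α : Type*} {l : List α} {a b : α} (h : CyclicSucc l a b) : a ∈ l := by
  obtain ⟨p, q, rfl, -⟩ := cyclicSucc_iff.1 h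
  simp

theorem CyclicSucc.mem_right {α : Type*} {l : List α} {a b : α} (h : CyclicSucc l a b) : b ∈ l := by
  obtain ⟨p, q, rfl, hb⟩ := cyclicSucc_iff.1 h
  have := List.mem_of_mem_head? hb
  simp at this ⊢
  tauto

theorem CyclicSucc.map {α β : Type*} (f : α → β) {l : List α} {a b : α} (h : CyclicSucc l a b) :
    CyclicSucc (l.map f) (f a) (f b) := by
  obtain ⟨p, q, rfl, hb⟩ := cyclicSucc_iff.1 h
  refine cyclicSucc_iff.2 ⟨p.map f, q.map f, by simp, ?_⟩
  have : ((q ++ p ++ [a]).map f).head? = some (f b) := by rw [List.head?_map, hb]; rfl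
  simpa using this

theorem cyclicSucc_reverse {α : Type*} {l : List α} {a b : α} (h : CyclicSucc l a b) :
    CyclicSucc l.reverse b a := by
  obtain ⟨p, q, rfl, hb⟩ := cyclicSucc_iff.1 h
  rw [cyclicSucc_iff]
  rcases q with _ | ⟨c, q⟩
  · rcases p with _ | ⟨c, p⟩
    · simp at hb; subst hb; exact ⟨[], [], by simp, by simp⟩
    · simp at hb; subst hb
      exact ⟨a :: p.reverse, [], by simp, by simp⟩
  · simp at hb; subst hb
    exact ⟨q.reverse, a :: p.reverse, by simp, by simp⟩

theorem cyclicSucc_adjacent {α : Type*} (p q : List α) (a b : α) :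
    CyclicSucc (p ++ a :: b :: q) a b := cyclicSucc_iff.2 ⟨p, b :: q, rfl, by simp⟩

/-! ### Points of the boundary circle -/

theorem continuous_circlePt (n k : ℕ) : Continuous (circlePt n k) := by
  unfold circlePt
  fun_prop

theorem norm_circlePt (n k : ℕ) (t : ℝ) : ‖(circlePt n k t : ℂ)‖ = 1 :=
  Complex.norm_exp_ofReal_mul_I _

theorem exists_circlePt {n : ℕ} (hn : 0 < n) {z : Disk} (hz : ‖(z : ℂ)‖ = 1) :
    ∃ (k : Fin n) (t : unitInterval), z = circlePt n k t := by
  have hpi := Real.pi_pos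
  have hn' : (0 : ℝ) < n := by exact_mod_cast hn
  -- `Int.fract a` is the fraction of a full turn at which `z` lies, so `x` is its position measured
  -- in arcs; the integer and fractional parts of `x` give `k` and `t`.
  set a := (Complex.arg z) / (2 * Real.pi) with ha
  set x := Int.fract a * n with hx
  have hx0 : 0 ≤ x := mul_nonneg (Int.fract_nonneg _) hn'.le
  have hxn : x < n := by
    have := Int.fract_lt_one a
    nlinarith
  refine ⟨⟨⌊x⌋₊, (Nat.floor_lt hx0).2 hxn⟩, ⟨x - ⌊x⌋₊, ?_, ?_⟩, ?_⟩
  · linarith [Nat.floor_le hx0]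
  · linarith [Nat.lt_floor_add_one x]
  · apply Subtype.ext
    simp only [circlePt]
    have h1 : (2 * Real.pi * ((⌊x⌋₊ + (x - ⌊x⌋₊)) / n) : ℝ) = Complex.arg z - ⌊a⌋ * (2 * Real.pi) := by
      have : (⌊x⌋₊ + (x - ⌊x⌋₊) : ℝ) / n = a - ⌊a⌋ := by
        rw [add_sub_cancel, hx, Int.fract]; field_simp
      rw [this, ha]; field_simp
    rw [h1]
    have h2 : ((Complex.arg z - ⌊a⌋ * (2 * Real.pi) : ℝ) : ℂ) * Complex.I =
        Complex.arg z * Complex.I - ⌊a⌋ * (2 * Real.pi * Complex.I) := by push_cast; ring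
    rw [h2, Complex.exp_sub, Complex.exp_int_mul_two_pi_mul_I, div_one]
    have := Complex.norm_mul_exp_arg_mul_I z
    rw [hz] at this
    simpa using this.symm

/-- Equal exponentials have angles that differ by m full turns. Both positions lie in [0, n], so m
is -1, 0 or 1, and two distinct parameters can only name the common endpoint of consecutive arcs. -/
theorem circlePt_eq {n : ℕ} {k k' : Fin n} {t t' : unitInterval}
    (h : circlePt n k t = circlePt n k' t') :
    (k = k' ∧ t = t') ∨ (t = 1 ∧ t' = 0 ∧ (k' : ℕ) = (k + 1) % n) ∨
      (t' = 1 ∧ t = 0 ∧ (k : ℕ) = (k' + 1) % n) := by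
  have hn : 0 < n := k.pos
  have hn' : (0 : ℝ) < n := by exact_mod_cast hn
  have hpi := Real.pi_pos
  have h' := congrArg Subtype.val h
  simp only [circlePt] at h'
  rw [Complex.exp_eq_exp_iff_exists_int] at h'
  obtain ⟨m, hm⟩ := h'
  have e1 : ((k : ℝ) + t) = (k' + t') + m * n := by
    have h2 : ((2 * Real.pi * (((k : ℝ) + t) / n) : ℝ) : ℂ) =
        ((2 * Real.pi * (((k' : ℝ) + t') / n) + m * (2 * Real.pi) : ℝ) : ℂ) := by
      apply mul_right_cancel₀ Complex.I_ne_zero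
      rw [hm]; push_cast; ring
    have h3 := Complex.ofReal_injective h2
    have h4 : ((k : ℝ) + t) / n = ((k' : ℝ) + t') / n + m := by
      have : (2 * Real.pi) * (((k : ℝ) + t) / n) = (2 * Real.pi) * (((k' : ℝ) + t') / n + m) := by
        rw [h3]; ring
      exact mul_left_cancel₀ (by positivity) this
    field_simp at h4
    linarith
  have hk : ((k : ℕ) : ℝ) + 1 ≤ n := by exact_mod_cast k.2
  have hk' : ((k' : ℕ) : ℝ) + 1 ≤ n := by exact_mod_cast k'.2
  have hk0 : (0 : ℝ) ≤ (k : ℕ) := by positivity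
  have hk0' : (0 : ℝ) ≤ (k' : ℕ) := by positivity
  have ht := t.2.1
  have ht1 := t.2.2
  have ht' := t'.2.1
  have ht1' := t'.2.2
  have hm1 : -1 ≤ m := by
    by_contra hc
    have : (m : ℝ) ≤ -2 := by exact_mod_cast (by omega : m ≤ -2)
    nlinarith
  have hm2 : m ≤ 1 := by
    by_contra hc
    have : (2 : ℝ) ≤ m := by exact_mod_cast (by omega : 2 ≤ m)
    nlinarith
  have hcase : m = 0 ∨ m = 1 ∨ m = -1 := by omega
  rcases hcase with rfl | rfl | rfl
  · simp only [Int.cast_zero, zero_mul, add_zero] at e1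
    rcases lt_trichotomy (k : ℕ) k' with hlt | heq | hgt
    · have : ((k : ℕ) : ℝ) + 1 ≤ (k' : ℕ) := by exact_mod_cast hlt
      have e2 : (t : ℝ) = 1 := by linarith
      have e3 : (t' : ℝ) = 0 := by linarith
      have e4 : ((k : ℕ) : ℝ) + 1 = (k' : ℕ) := by linarith
      refine Or.inr (Or.inl ⟨Subtype.ext e2, Subtype.ext e3, ?_⟩)
      have e5 : (k : ℕ) + 1 = k' := by exact_mod_cast e4
      rw [e5, Nat.mod_eq_of_lt k'.2]
    · refine Or.inl ⟨Fin.ext heq, Subtype.ext ?_⟩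
      rw [heq] at e1
      linarith
    · have : ((k' : ℕ) : ℝ) + 1 ≤ (k : ℕ) := by exact_mod_cast hgt
      have e2 : (t' : ℝ) = 1 := by linarith
      have e3 : (t : ℝ) = 0 := by linarith
      have e4 : ((k' : ℕ) : ℝ) + 1 = (k : ℕ) := by linarith
      refine Or.inr (Or.inr ⟨Subtype.ext e2, Subtype.ext e3, ?_⟩)
      have e5 : (k' : ℕ) + 1 = k := by exact_mod_cast e4
      rw [e5, Nat.mod_eq_of_lt k.2]
  · simp only [Int.cast_one, one_mul] at e1
    have e2 : (t : ℝ) = 1 := by linarith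
    have e3 : (t' : ℝ) = 0 := by linarith
    have e4 : ((k : ℕ) : ℝ) + 1 = n := by linarith
    have e4' : ((k' : ℕ) : ℝ) = 0 := by linarith
    refine Or.inr (Or.inl ⟨Subtype.ext e2, Subtype.ext e3, ?_⟩)
    have e5 : (k : ℕ) + 1 = n := by exact_mod_cast e4
    have e6 : (k' : ℕ) = 0 := by exact_mod_cast e4'
    rw [e5, e6, Nat.mod_self]
  · simp only [Int.cast_neg, Int.cast_one, neg_mul, one_mul] at e1
    have e2 : (t' : ℝ) = 1 := by linarith
    have e3 : (t : ℝ) = 0 := by linarith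
    have e4 : ((k' : ℕ) : ℝ) + 1 = n := by linarith
    have e4' : ((k : ℕ) : ℝ) = 0 := by linarith
    refine Or.inr (Or.inr ⟨Subtype.ext e2, Subtype.ext e3, ?_⟩)
    have e5 : (k' : ℕ) + 1 = n := by exact_mod_cast e4
    have e6 : (k : ℕ) = 0 := by exact_mod_cast e4'
    rw [e5, e6, Nat.mod_self]

/-! ### The cell structure of the realization -/

namespace CombComplex

variable {K : CombComplex}

theorem continuous_edgePt (d : K.D) : Continuous (K.edgePt d) :=
  continuous_quot_mk.comp (continuous_inr.comp (continuous_inl.comp continuous_sigmaMk))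

theorem continuous_facePt (f : K.F) : Continuous (K.facePt f) :=
  continuous_quot_mk.comp (continuous_inr.comp (continuous_inr.comp continuous_sigmaMk))

theorem edgePt_rev (d : K.D) (t : unitInterval) :
    K.edgePt (K.rev d) (unitInterval.symm t) = K.edgePt d t := Quot.sound (Glue.rev d t)

theorem edgePt_rev' (d : K.D) (t : unitInterval) :
    K.edgePt (K.rev d) t = K.edgePt d (unitInterval.symm t) := by
  rw [← edgePt_rev d, unitInterval.symm_symm]

@[simp] theorem edgePt_zero (d : K.D) : K.edgePt d 0 = K.vert (K.init d) :=
  Quot.sound (Glue.init d)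

@[simp] theorem edgePt_one (d : K.D) : K.edgePt d 1 = K.vert (K.term d) := by
  rw [← edgePt_rev d, unitInterval.symm_one, edgePt_zero]; rfl

theorem facePt_circlePt (f : K.F) (k : ℕ) (hk : k < (K.bdry f).length) (t : unitInterval) :
    K.facePt f (circlePt (K.bdry f).length k t) = K.edgePt (K.bdry f)[k] t :=
  Quot.sound (Glue.face f ⟨k, hk⟩ t)

theorem space_cases {motive : K.Space → Prop} (p : K.Space) (hv : ∀ v, motive (K.vert v))
    (he : ∀ d t, motive (K.edgePt d t)) (hf : ∀ f z, motive (K.facePt f z)) : motive p := by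
  induction p using Quot.ind with
  | _ a =>
    rcases a with ⟨v, ⟨⟩⟩ | ⟨d, t⟩ | ⟨f, z⟩
    · exact hv v
    · exact he d t
    · exact hf f z

theorem continuous_iff_cells {Y : Type*} [TopologicalSpace Y] {g : K.Space → Y} :
    Continuous g ↔ (∀ d, Continuous fun t => g (K.edgePt d t)) ∧
      ∀ f, Continuous fun z => g (K.facePt f z) := by
  constructor
  · intro h
    exact ⟨fun d => h.comp (continuous_edgePt d), fun f => h.comp (continuous_facePt f)⟩
  · rintro ⟨h1, h2⟩
    have hg : Continuous (g ∘ (Quot.mk _ : K.Pre → K.Space)) := by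
      refine continuous_sum_dom.2 ⟨?_, continuous_sum_dom.2 ⟨?_, ?_⟩⟩
      · exact continuous_sigma fun v => continuous_of_discreteTopology
      · exact continuous_sigma fun d => h1 d
      · exact continuous_sigma fun f => h2 f
    exact isQuotientMap_quot_mk.continuous_iff.2 hg

theorem isClosed_iff_cells {A : Set K.Space} :
    IsClosed A ↔ (∀ d, IsClosed (K.edgePt d ⁻¹' A)) ∧ ∀ f, IsClosed (K.facePt f ⁻¹' A) := by
  constructor
  · intro h
    exact ⟨fun d => h.preimage (continuous_edgePt d), fun f => h.preimage (continuous_facePt f)⟩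
  · rintro ⟨h1, h2⟩
    have hq : Topology.IsQuotientMap (Quot.mk _ : K.Pre → K.Space) := isQuotientMap_quot_mk
    refine hq.isClosed_preimage.1 ?_
    refine isClosed_sum_iff.2 ⟨?_, isClosed_sum_iff.2 ⟨?_, ?_⟩⟩
    · exact isClosed_sigma_iff.2 fun v => isClosed_discrete _
    · exact isClosed_sigma_iff.2 fun d => h1 d
    · exact isClosed_sigma_iff.2 fun f => h2 f

/-- Maps out of the realization. -/
theorem exists_lift {Y : Type*} (gv : K.V → Y) (ge : K.D → unitInterval → Y) (gf : K.F → Disk → Y)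
    (h1 : ∀ d t, ge (K.rev d) (unitInterval.symm t) = ge d t) (h2 : ∀ d, ge d 0 = gv (K.init d))
    (h3 : ∀ f (k : ℕ) (hk : k < (K.bdry f).length) (t : unitInterval),
      gf f (circlePt (K.bdry f).length k t) = ge (K.bdry f)[k] t) :
    ∃ g : K.Space → Y, (∀ v, g (K.vert v) = gv v) ∧ (∀ d t, g (K.edgePt d t) = ge d t) ∧
      ∀ f z, g (K.facePt f z) = gf f z := by
  refine ⟨Quot.lift (fun x : K.Pre => match x with
    | .inl ⟨v, _⟩ => gv v
    | .inr (.inl ⟨d, t⟩) => ge d t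
    | .inr (.inr ⟨f, z⟩) => gf f z) ?_, fun v => rfl, fun d t => rfl, fun f z => rfl⟩
  intro a b hab
  cases hab with
  | rev d t => exact h1 d t
  | init d => exact h2 d
  | face f k t => exact h3 f k k.2 t

open Classical in
/-- The normal forms of the point at parameter `t` of the edge `d`. -/
def edgeForm (K : CombComplex) (d : K.D) (t : unitInterval) : Set K.Pre :=
  if t = 0 then {.inl ⟨K.init d, ()⟩} else if t = 1 then {.inl ⟨K.term d, ()⟩}
  else {.inr (.inl ⟨d, t⟩), .inr (.inl ⟨K.rev d, unitInterval.symm t⟩)}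

theorem edgeForm_rev (d : K.D) (t : unitInterval) :
    K.edgeForm (K.rev d) (unitInterval.symm t) = K.edgeForm d t := by
  unfold edgeForm
  by_cases h0 : t = 0
  · subst h0; simp
  · by_cases h1 : t = 1
    · subst h1; simp
    · have h2 : unitInterval.symm t ≠ 0 := fun h => h1 (by simpa using congrArg unitInterval.symm h)
      have h3 : unitInterval.symm t ≠ 1 := fun h => h0 (by simpa using congrArg unitInterval.symm h)
      simp only [h0, h1, h2, h3, if_false, K.rev_rev, unitInterval.symm_symm]
      rw [Set.pair_comm]

theorem bdry_term_eq_init (f : K.F) (k : ℕ) (hk : k < (K.bdry f).length) :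
    K.term (K.bdry f)[k] = K.init ((K.bdry f)[(k + 1) % (K.bdry f).length]'(
      Nat.mod_lt _ (by omega))) := by
  obtain ⟨v, hv⟩ := K.bdry_closed f
  by_cases h : k + 1 < (K.bdry f).length
  · simp only [Nat.mod_eq_of_lt h]
    exact hv.term_getElem k h
  · have h' : k + 1 = (K.bdry f).length := by omega
    simp only [h', Nat.mod_self]
    rw [hv.init_getElem_zero (by omega), hv.term_getElem_last k h']

/-- An invariant that tells apart the points of the quotient: each point is sent to the set of its
representatives in the lowest-dimensional cell that contains it. All later injectivity statements
about vertices, edges and faces are read off from it. -/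
theorem exists_form (K : CombComplex) : ∃ g : K.Space → Set K.Pre,
    (∀ v, g (K.vert v) = {.inl ⟨v, ()⟩}) ∧ (∀ d t, g (K.edgePt d t) = K.edgeForm d t) ∧
    ∀ f (z : Disk), ‖(z : ℂ)‖ < 1 → g (K.facePt f z) = {.inr (.inr ⟨f, z⟩)} := by
  obtain ⟨g, h1, h2, h3⟩ := exists_lift (K := K) (fun v => ({.inl ⟨v, ()⟩} : Set K.Pre)) K.edgeForm
    (fun f z => {x | (‖(z : ℂ)‖ < 1 ∧ x = .inr (.inr ⟨f, z⟩)) ∨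
      ∃ (k : Fin (K.bdry f).length) (t : unitInterval), z = circlePt (K.bdry f).length k t ∧
        x ∈ K.edgeForm ((K.bdry f).get k) t})
    edgeForm_rev (fun d => by simp [edgeForm]) (by
      intro f k hk t
      ext x
      simp only [norm_circlePt, lt_irrefl, false_and, false_or, Set.mem_ofPred_eq]
      constructor
      · rintro ⟨k', t', he, hx⟩
        have := circlePt_eq (k := ⟨k, hk⟩) (k' := k') he
        -- Where two arcs of the circle meet, the form is well defined because consecutive edges of
        -- a closed boundary walk share a vertex.
        rcases this with ⟨rfl, rfl⟩ | ⟨rfl, rfl, hkk⟩ | ⟨rfl, rfl, hkk⟩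
        · exact hx
        · have hb := bdry_term_eq_init f k hk
          simp only [← hkk] at hb
          simp [edgeForm] at hx ⊢
          rw [hx, hb]
        · have hb := bdry_term_eq_init f k' k'.2
          simp only at hkk
          simp only [← hkk] at hb
          simp [edgeForm] at hx ⊢
          rw [hx, hb]
      · intro hx
        exact ⟨⟨k, hk⟩, t, rfl, hx⟩)
  refine ⟨g, h1, h2, fun f z hz => ?_⟩
  rw [h3]
  ext x
  simp only [hz, true_and, Set.mem_ofPred_eq, Set.mem_singleton_iff, or_iff_left_iff_imp]
  rintro ⟨k, t, rfl, -⟩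
  exact absurd (norm_circlePt _ _ _) hz.ne

theorem vert_injective : Function.Injective K.vert := by
  obtain ⟨g, h1, h2, h3⟩ := K.exists_form
  intro v w h
  have := congrArg g h
  rw [h1, h1] at this
  simpa using this

theorem edgePt_ne_vert (d : K.D) {t : unitInterval} (h0 : t ≠ 0) (h1 : t ≠ 1) (v : K.V) :
    K.edgePt d t ≠ K.vert v := by
  obtain ⟨g, g1, g2, g3⟩ := K.exists_form
  intro h
  have h' := congrArg g h
  rw [g1, g2, edgeForm, if_neg h0, if_neg h1] at h'
  have : (.inr (.inl ⟨d, t⟩) : K.Pre) ∈ ({.inl ⟨v, ()⟩} : Set K.Pre) := by rw [← h']; simp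
  simp at this

theorem edgePt_eq_edgePt {d d' : K.D} {t t' : unitInterval} (h0 : t ≠ 0) (h1 : t ≠ 1)
    (h : K.edgePt d t = K.edgePt d' t') :
    (d' = d ∧ t' = t) ∨ (d' = K.rev d ∧ t' = unitInterval.symm t) := by
  obtain ⟨g, g1, g2, g3⟩ := K.exists_form
  have h0' : t' ≠ 0 := by
    rintro rfl; rw [edgePt_zero] at h; exact edgePt_ne_vert d h0 h1 _ h
  have h1' : t' ≠ 1 := by
    rintro rfl; rw [edgePt_one] at h; exact edgePt_ne_vert d h0 h1 _ h
  have h' := congrArg g h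
  rw [g2, g2, edgeForm, edgeForm, if_neg h0, if_neg h1, if_neg h0', if_neg h1'] at h'
  have : (.inr (.inl ⟨d', t'⟩) : K.Pre) ∈
    ({.inr (.inl ⟨d, t⟩), .inr (.inl ⟨K.rev d, unitInterval.symm t⟩)} : Set K.Pre) := by
    rw [h']; simp
  simpa using this

theorem vert_mem_oneSkeleton (v : K.V) : K.vert v ∈ K.oneSkeleton := Or.inl ⟨v, rfl⟩

theorem edgePt_mem_closedEdge (d : K.D) (t : unitInterval) : K.edgePt d t ∈ K.closedEdge d :=
  ⟨t, rfl⟩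

theorem edgePt_mem_oneSkeleton (d : K.D) (t : unitInterval) : K.edgePt d t ∈ K.oneSkeleton :=
  Or.inr (Set.mem_iUnion.2 ⟨d, t, rfl⟩)

theorem closedEdge_rev (d : K.D) : K.closedEdge (K.rev d) = K.closedEdge d := by
  ext p
  constructor
  · rintro ⟨t, rfl⟩; exact ⟨_, (edgePt_rev' d t).symm⟩
  · rintro ⟨t, rfl⟩; exact ⟨_, edgePt_rev d t⟩

theorem facePt_notMem_oneSkeleton (f : K.F) {z : Disk} (hz : ‖(z : ℂ)‖ < 1) :
    K.facePt f z ∉ K.oneSkeleton := by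
  obtain ⟨g, g1, g2, g3⟩ := K.exists_form
  rintro (⟨v, hv⟩ | h)
  · have h' := congrArg g hv
    rw [g1, g3 f z hz] at h'
    simp at h'
  · obtain ⟨d, t, h⟩ := Set.mem_iUnion.1 h
    have h' := congrArg g h
    rw [g2, g3 f z hz] at h'
    have : (.inr (.inr ⟨f, z⟩) : K.Pre) ∈ K.edgeForm d t := by rw [h']; simp
    unfold edgeForm at this
    split_ifs at this <;> simp at this

theorem facePt_cases (f : K.F) (z : Disk) : ‖(z : ℂ)‖ < 1 ∨
    ∃ (k : ℕ) (hk : k < (K.bdry f).length) (t : unitInterval),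
      z = circlePt (K.bdry f).length k t ∧ K.facePt f z = K.edgePt (K.bdry f)[k] t := by
  have hz := z.2
  rw [mem_closedBall_zero_iff] at hz
  rcases hz.lt_or_eq with h | h
  · exact Or.inl h
  · obtain ⟨k, t, rfl⟩ := exists_circlePt (List.length_pos_iff.2 (K.bdry_ne_nil f)) h
    exact Or.inr ⟨k, k.2, t, rfl, facePt_circlePt f k k.2 t⟩

/-- A face meets such a set only in its boundary circle, where the preimage is a finite union of
images of compact subsets of the arcs. So only edges need to be checked. -/
theorem isClosed_of_subset_oneSkeleton {A : Set K.Space} (hA : A ⊆ K.oneSkeleton)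
    (h : ∀ d, IsClosed (K.edgePt d ⁻¹' A)) : IsClosed A := by
  refine isClosed_iff_cells.2 ⟨h, fun f => ?_⟩
  have : K.facePt f ⁻¹' A = ⋃ k : Fin (K.bdry f).length,
      (fun t : unitInterval => circlePt (K.bdry f).length k t) '' (K.edgePt ((K.bdry f).get k) ⁻¹' A) := by
    ext z
    simp only [Set.mem_preimage, Set.mem_iUnion, Set.mem_image]
    constructor
    · intro hz
      rcases facePt_cases f z with h | ⟨k, hk, t, rfl, he⟩
      · exact absurd (hA hz) (facePt_notMem_oneSkeleton f h)
      · exact ⟨⟨k, hk⟩, t, by rw [he] at hz; exact hz, rfl⟩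
    · rintro ⟨k, t, ht, rfl⟩
      rw [facePt_circlePt f k k.2]
      exact ht
  rw [this]
  refine isClosed_iUnion_of_finite fun k => IsCompact.isClosed ?_
  exact (h _).isCompact.image ((continuous_circlePt _ _).comp continuous_subtype_val)

/-- The two endpoints form a finite set, so they cannot spoil closedness; this avoids treating
vertices shared with other cells. -/
theorem isClosed_preimage_of_ends {A : Set K.Space} {d : K.D} {C : Set unitInterval}
    (hC : IsClosed C) (h : ∀ t, t ≠ 0 → t ≠ 1 → (K.edgePt d t ∈ A ↔ t ∈ C))
    (h' : ∀ t, t ∈ C → K.edgePt d t ∈ A) : IsClosed (K.edgePt d ⁻¹' A) := by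
  have : K.edgePt d ⁻¹' A = C ∪ (K.edgePt d ⁻¹' A ∩ {0, 1}) := by
    ext t
    constructor
    · intro ht
      by_cases h0 : t = 0
      · exact Or.inr ⟨ht, by simp [h0]⟩
      · by_cases h1 : t = 1
        · exact Or.inr ⟨ht, by simp [h1]⟩
        · exact Or.inl ((h t h0 h1).1 ht)
    · rintro (ht | ht)
      · exact h' t ht
      · exact ht.1
  rw [this]
  exact hC.union ((Set.toFinite _).subset Set.inter_subset_right).isClosed

/-- A union of vertices and closed edges is closed. -/
theorem isClosed_subcomplex (W : Set K.V) (S : Set K.D) :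
    IsClosed (K.vert '' W ∪ ⋃ d ∈ S, K.closedEdge d) := by
  refine isClosed_of_subset_oneSkeleton ?_ fun d => ?_
  · rintro p (⟨v, -, rfl⟩ | h)
    · exact vert_mem_oneSkeleton v
    · obtain ⟨d, -, t, rfl⟩ := Set.mem_iUnion₂.1 h
      exact edgePt_mem_oneSkeleton d t
  · by_cases hd : d ∈ S ∨ K.rev d ∈ S
    · have : K.closedEdge d ⊆ ⋃ d ∈ S, K.closedEdge d := by
        rcases hd with hd | hd
        · exact Set.subset_biUnion_of_mem (u := fun d => K.closedEdge d) hd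
        · rw [← closedEdge_rev]
          exact Set.subset_biUnion_of_mem (u := fun d => K.closedEdge d) hd
      have : K.edgePt d ⁻¹' (K.vert '' W ∪ ⋃ d ∈ S, K.closedEdge d) = Set.univ :=
        Set.eq_univ_of_forall fun t => Or.inr (this (edgePt_mem_closedEdge d t))
      rw [this]
      exact isClosed_univ
    · push Not at hd
      refine isClosed_preimage_of_ends (C := ∅) isClosed_empty (fun t h0 h1 => ?_) (by simp)
      simp only [Set.mem_empty_iff_false, iff_false]
      rintro (⟨v, -, hv⟩ | h)
      · exact edgePt_ne_vert d h0 h1 v hv.symm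
      · obtain ⟨e, he, t', ht'⟩ := Set.mem_iUnion₂.1 h
        rcases edgePt_eq_edgePt h0 h1 ht'.symm with ⟨rfl, -⟩ | ⟨rfl, -⟩
        · exact hd.1 he
        · exact hd.2 he

theorem isClosedMap_edgePt (d : K.D) : IsClosedMap (K.edgePt d) := by
  intro C hC
  refine isClosed_of_subset_oneSkeleton ?_ fun e => ?_
  · rintro _ ⟨t, -, rfl⟩
    exact edgePt_mem_oneSkeleton d t
  · have hc' : IsClosed (unitInterval.symm ⁻¹' C) := hC.preimage unitInterval.continuous_symm
    have hC2 : IsClosed ({t | d = e ∧ t ∈ C} ∪ {t | d = K.rev e ∧ unitInterval.symm t ∈ C}) := by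
      refine IsClosed.union ?_ ?_
      · by_cases h : d = e <;> simp [h, hC]
      · by_cases h : d = K.rev e
        · simp only [h, true_and]; exact hc'
        · simp [h]
    refine isClosed_preimage_of_ends hC2 (fun t h0 h1 => ⟨?_, ?_⟩) ?_
    · rintro ⟨t', ht', h⟩
      rcases edgePt_eq_edgePt h0 h1 h.symm with ⟨rfl, rfl⟩ | ⟨rfl, rfl⟩
      · exact Or.inl ⟨rfl, ht'⟩
      · exact Or.inr ⟨rfl, ht'⟩
    · rintro (⟨rfl, h⟩ | ⟨rfl, h⟩)
      · exact ⟨t, h, rfl⟩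
      · exact ⟨_, h, edgePt_rev e t⟩
    · rintro t (⟨rfl, h⟩ | ⟨rfl, h⟩)
      · exact ⟨t, h, rfl⟩
      · exact ⟨_, h, edgePt_rev e t⟩

theorem edgePt_injective {d : K.D} (hd : K.init d ≠ K.term d) :
    Function.Injective (K.edgePt d) := by
  have key : ∀ t t', t ≠ 0 → t ≠ 1 → K.edgePt d t = K.edgePt d t' → t = t' := by
    intro t t' h0 h1 h
    rcases edgePt_eq_edgePt h0 h1 h with ⟨-, rfl⟩ | ⟨h2, -⟩
    · rfl
    · exact absurd h2.symm (K.rev_ne d)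
  intro t t' h
  by_cases h0 : t = 0
  · by_cases h0' : t' = 0
    · rw [h0, h0']
    · by_cases h1' : t' = 1
      · rw [h0, h1', edgePt_zero, edgePt_one] at h
        exact absurd (vert_injective h) hd
      · exact (key t' t h0' h1' h.symm).symm
  · by_cases h1 : t = 1
    · by_cases h0' : t' = 0
      · rw [h1, h0', edgePt_zero, edgePt_one] at h
        exact absurd (vert_injective h).symm hd
      · by_cases h1' : t' = 1
        · rw [h1, h1']
        · exact (key t' t h0' h1' h.symm).symm
    · exact key t t' h0 h1 h

theorem isClosedEmbedding_edgePt {d : K.D} (hd : K.init d ≠ K.term d) :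
    Topology.IsClosedEmbedding (K.edgePt d) :=
  .of_continuous_injective_isClosedMap (continuous_edgePt d) (edgePt_injective hd)
    (isClosedMap_edgePt d)

theorem edgePt_eq_vert_iff {d : K.D} {t : unitInterval} {v : K.V} :
    K.edgePt d t = K.vert v ↔ (t = 0 ∧ K.init d = v) ∨ (t = 1 ∧ K.term d = v) := by
  constructor
  · intro h
    by_cases h0 : t = 0
    · subst h0; rw [edgePt_zero] at h; exact Or.inl ⟨rfl, vert_injective h⟩
    · by_cases h1 : t = 1
      · subst h1; rw [edgePt_one] at h; exact Or.inr ⟨rfl, vert_injective h⟩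
      · exact absurd h (edgePt_ne_vert d h0 h1 v)
  · rintro (⟨rfl, rfl⟩ | ⟨rfl, rfl⟩) <;> simp

theorem mem_closedEdge_vert {d : K.D} {v : K.V} :
    K.vert v ∈ K.closedEdge d ↔ K.init d = v ∨ K.term d = v := by
  constructor
  · rintro ⟨t, ht⟩
    rcases edgePt_eq_vert_iff.1 ht with h | h
    · exact Or.inl h.2
    · exact Or.inr h.2
  · rintro (rfl | rfl)
    · exact ⟨0, edgePt_zero d⟩
    · exact ⟨1, edgePt_one d⟩

theorem isClosed_singleton_vert (v : K.V) : IsClosed {K.vert v} := by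
  have := isClosed_subcomplex (K := K) {v} ∅
  simpa using this

end CombComplex

namespace CombComplex

variable {K : CombComplex}

/-! ### Assembling maps from edges -/

/-- The vertices other than `p` and the edges of `S` that miss `p` form a closed subcomplex; its
complement is a neighbourhood of `p` that meets only finitely many of the cells in question. -/
theorem locallyFinite_subcomplex (S : Set K.D)
    (hS : ∀ p : K.Space, {d | d ∈ S ∧ p ∈ K.closedEdge d}.Finite) :
    LocallyFinite (fun i : K.V ⊕ S => Sum.elim (fun v => {K.vert v}) (fun d : S => K.closedEdge d.1) i) := by
  intro p
  refine ⟨(K.vert '' {v | p ≠ K.vert v} ∪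
    ⋃ d ∈ {d | d ∈ S ∧ p ∉ K.closedEdge d}, K.closedEdge d)ᶜ,
    (isClosed_subcomplex _ _).isOpen_compl.mem_nhds ?_, ?_⟩
  · rintro (⟨v, hv, h⟩ | h)
    · exact hv h.symm
    · obtain ⟨d, hd, h⟩ := Set.mem_iUnion₂.1 h
      exact hd.2 h
  · have hfin : ({i : K.V ⊕ S | ∃ v, i = .inl v ∧ p = K.vert v} ∪
        {i | ∃ d : S, i = .inr d ∧ p ∈ K.closedEdge d}).Finite := by
      refine Set.Finite.union ?_ ?_
      · refine Set.Subsingleton.finite ?_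
        rintro _ ⟨v, rfl, h⟩ _ ⟨w, rfl, h'⟩
        rw [vert_injective (h.symm.trans h')]
      · have h1 : {d : S | p ∈ K.closedEdge d}.Finite := by
          refine Set.Finite.of_finite_image ((hS p).subset ?_) Subtype.val_injective.injOn
          rintro _ ⟨d, hd, rfl⟩
          exact ⟨d.2, hd⟩
        refine (h1.image Sum.inr).subset ?_
        rintro _ ⟨d, rfl, h⟩
        exact ⟨d, h, rfl⟩
    refine hfin.subset ?_
    rintro (v | d) ⟨q, hq, hq'⟩
    · refine Or.inl ⟨v, rfl, ?_⟩
      by_contra hne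
      exact hq' (Or.inl ⟨v, hne, hq.symm⟩)
    · refine Or.inr ⟨d, rfl, ?_⟩
      by_contra hne
      exact hq' (Or.inr (Set.mem_iUnion₂.2 ⟨d, ⟨d.2, hne⟩, hq⟩))

/-- An edge that is not a loop is a closed embedded interval, so continuity may be tested in the
edge parameter. -/
theorem continuousOn_closedEdge {Y Z : Type*} [TopologicalSpace Y] [TopologicalSpace Z] {d : K.D}
    (hd : K.init d ≠ K.term d) {g : K.Space × Z → Y}
    (hg : Continuous fun q : unitInterval × Z => g (K.edgePt d q.1, q.2)) :
    ContinuousOn g (K.closedEdge d ×ˢ Set.univ) := by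
  have he := isClosedEmbedding_edgePt hd
  let e := he.isEmbedding.toHomeomorph
  rw [continuousOn_iff_continuous_domRestrict]
  have hp : ∀ q : (K.closedEdge d ×ˢ (Set.univ : Set Z) : Set (K.Space × Z)),
      q.1.1 ∈ Set.range (K.edgePt d) := fun q => q.2.1
  have hc : Continuous fun q : (K.closedEdge d ×ˢ (Set.univ : Set Z) : Set (K.Space × Z)) =>
      g (K.edgePt d (e.symm ⟨q.1.1, hp q⟩), q.1.2) := by
    refine hg.comp (Continuous.prodMk (e.symm.continuous.comp ?_) (by fun_prop))
    exact Continuous.subtype_mk (by fun_prop) _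
  convert hc using 2 with q
  have : K.edgePt d (e.symm ⟨q.1.1, hp q⟩) = q.1.1 :=
    congrArg Subtype.val (e.apply_symm_apply ⟨q.1.1, hp q⟩)
  rw [this]; rfl

/-- A family of paths on a locally finite subcomplex of the 1-skeleton can be given edge by edge. -/
theorem exists_edgewise {Y : Type*} [TopologicalSpace Y] [Nonempty Y]
    (hloop : ∀ d, K.init d ≠ K.term d) (S : Set K.D)
    (hS : ∀ p : K.Space, {d | d ∈ S ∧ p ∈ K.closedEdge d}.Finite)
    (c : K.V → unitInterval → Y) (hc : ∀ v, Continuous (c v))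
    (Θ : K.D → unitInterval → unitInterval → Y)
    (hΘ : ∀ d ∈ S, Continuous fun q : unitInterval × unitInterval => Θ d q.1 q.2)
    (h0 : ∀ d ∈ S, ∀ t, Θ d 0 t = c (K.init d) t) (h1 : ∀ d ∈ S, ∀ t, Θ d 1 t = c (K.term d) t) :
    ∃ Υ : K.Space → unitInterval → Y, (∀ v, Υ (K.vert v) = c v) ∧
      (∀ d ∈ S, ∃ d' ∈ S, (d' = d ∨ d' = K.rev d) ∧ ∀ τ, Υ (K.edgePt d' τ) = Θ d' τ) ∧
      ContinuousOn (fun q : K.Space × unitInterval => Υ q.1 q.2)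
        ((Set.range K.vert ∪ ⋃ d ∈ S, K.closedEdge d) ×ˢ Set.univ) := by
  classical
  -- The families over `d` and `K.rev d` need not agree, so one orientation in `S` is selected for
  -- every undirected edge that has one; only that family is used.
  obtain ⟨o, ho1, ho2, ho3⟩ : ∃ o : K.D → K.D, (∀ d ∈ S, o d ∈ S) ∧
      (∀ d ∈ S, o d = d ∨ o d = K.rev d) ∧
      ∀ d ∈ S, ∀ e ∈ S, (e = d ∨ e = K.rev d) → o e = o d := by
    let r : Setoid K.D := ⟨fun a b => b = a ∨ b = K.rev a, fun a => Or.inl rfl, by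
      rintro a b (rfl | rfl) <;> simp [K.rev_rev], by
      rintro a b c (rfl | rfl) (rfl | rfl) <;> simp [K.rev_rev]⟩
    let o' : Quotient r → K.D → K.D := fun q d =>
      if h : ∃ e ∈ S, Quotient.mk r e = q then h.choose else d
    have hex : ∀ d ∈ S, ∃ e ∈ S, Quotient.mk r e = Quotient.mk r d := fun d hd => ⟨d, hd, rfl⟩
    refine ⟨fun d => o' (Quotient.mk r d) d, fun d hd => ?_, fun d hd => ?_, fun d hd e he hde => ?_⟩
    · simp only [o', dif_pos (hex d hd)]
      exact (hex d hd).choose_spec.1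
    · simp only [o', dif_pos (hex d hd)]
      have := Quotient.exact (hex d hd).choose_spec.2.symm
      exact this
    · have hq : Quotient.mk r e = Quotient.mk r d := (Quotient.sound (s := r) hde).symm
      simp only [hq, o', dif_pos (hex d hd)]
  have hoo : ∀ d ∈ S, o (o d) = o d := fun d hd => ho3 d hd (o d) (ho1 d hd) (ho2 d hd)
  -- Vertices are tested first, so endpoints need no compatibility in the definition. Off the
  -- subcomplex the value is arbitrary.
  let Υ : K.Space → unitInterval → Y := fun p =>
    if h : ∃ v, p = K.vert v then c h.choose
    else if h : ∃ x : K.D × unitInterval, x.1 ∈ S ∧ o x.1 = x.1 ∧ p = K.edgePt x.1 x.2 then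
      Θ h.choose.1 h.choose.2
    else fun _ => Classical.arbitrary Y
  have hv : ∀ v, Υ (K.vert v) = c v := by
    intro v
    have h : ∃ w, K.vert v = K.vert w := ⟨v, rfl⟩
    simp only [Υ, dif_pos h]
    rw [← vert_injective h.choose_spec]
  have he : ∀ d ∈ S, o d = d → ∀ τ, Υ (K.edgePt d τ) = Θ d τ := by
    intro d hd hod τ
    by_cases hτ0 : τ = 0
    · subst hτ0; rw [edgePt_zero, hv]; exact (funext (h0 d hd)).symm
    by_cases hτ1 : τ = 1
    · subst hτ1; rw [edgePt_one, hv]; exact (funext (h1 d hd)).symm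
    have hn : ¬ ∃ v, K.edgePt d τ = K.vert v := fun ⟨v, h⟩ => edgePt_ne_vert d hτ0 hτ1 v h
    have h : ∃ x : K.D × unitInterval, x.1 ∈ S ∧ o x.1 = x.1 ∧ K.edgePt d τ = K.edgePt x.1 x.2 :=
      ⟨(d, τ), hd, hod, rfl⟩
    simp only [Υ, dif_neg hn, dif_pos h]
    obtain ⟨q1, q2, q3⟩ := h.choose_spec
    rcases edgePt_eq_edgePt hτ0 hτ1 q3 with ⟨e1, e2⟩ | ⟨e1, e2⟩
    · rw [e1, e2]
    · exfalso
      have := ho3 d hd _ q1 (Or.inr e1)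
      rw [q2, hod, e1] at this
      exact K.rev_ne d this
  refine ⟨Υ, hv, fun d hd => ⟨o d, ho1 d hd, ho2 d hd, he _ (ho1 d hd) (hoo d hd)⟩, ?_⟩
  have hsub : ((Set.range K.vert ∪ ⋃ d ∈ S, K.closedEdge d) ×ˢ (Set.univ : Set unitInterval)) ⊆
      ⋃ i : K.V ⊕ S, Prod.fst ⁻¹' (Sum.elim (fun v => {K.vert v}) (fun d : S => K.closedEdge d.1) i) := by
    rintro ⟨p, t⟩ ⟨⟨v, rfl⟩ | h, -⟩
    · exact Set.mem_iUnion.2 ⟨.inl v, rfl⟩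
    · obtain ⟨d, hd, h⟩ := Set.mem_iUnion₂.1 h
      exact Set.mem_iUnion.2 ⟨.inr ⟨d, hd⟩, h⟩
  refine ContinuousOn.mono ?_ hsub
  refine ((locallyFinite_subcomplex S hS).preimage_continuous continuous_fst).continuousOn_iUnion
    ?_ ?_
  · rintro (v | d)
    · exact (isClosed_singleton_vert v).preimage continuous_fst
    · have := isClosed_subcomplex (K := K) ∅ {d.1}
      simp only [Set.image_empty, Set.mem_singleton_iff, Set.iUnion_iUnion_eq_left,
        Set.empty_union] at this
      exact this.preimage continuous_fst
  · rintro (v | ⟨d, hd⟩)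
    · refine ContinuousOn.congr (f := fun q => c v q.2) ((hc v).comp continuous_snd).continuousOn ?_
      rintro ⟨p, t⟩ hp
      simp only [Sum.elim_inl, Set.mem_preimage, Set.mem_singleton_iff] at hp
      simp only [hp, hv]
    · have hcl : K.closedEdge d = K.closedEdge (o d) := by
        rcases ho2 d hd with h | h <;> rw [h]
        rw [closedEdge_rev]
      have : (Prod.fst ⁻¹' (Sum.elim (fun v => {K.vert v}) (fun d : S => K.closedEdge d.1)
          (.inr ⟨d, hd⟩ : K.V ⊕ S)) : Set (K.Space × unitInterval)) =
          K.closedEdge (o d) ×ˢ Set.univ := by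
        ext ⟨p, t⟩; simp [hcl]
      rw [this]
      refine continuousOn_closedEdge (hloop _) ?_
      simp only [he _ (ho1 d hd) (hoo d hd)]
      exact hΘ _ (ho1 d hd)

/-! ### Parametrized edge paths -/

/-- The point at distance `x` along the edge path `l` that starts at `u`. -/
def walkPt (K : CombComplex) : K.V → List K.D → ℝ → K.Space
  | u, [], _ => K.vert u
  | _, d :: l, x =>
    if x ≤ 1 then K.edgePt d (Set.projIcc 0 1 zero_le_one x) else walkPt K (K.term d) l (x - 1)

theorem walkPt_of_nonpos {l : List K.D} {u v : K.V} (h : K.IsWalk l u v) {x : ℝ} (hx : x ≤ 0) :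
    K.walkPt u l x = K.vert u := by
  cases l with
  | nil => rfl
  | cons d l =>
    rw [walkPt, if_pos (by linarith), Set.projIcc_of_le_left _ hx]
    have := edgePt_zero (K := K) d
    rw [h.1] at this
    exact this

theorem walkPt_cons_of_ge {d : K.D} {l : List K.D} {u v : K.V} (h : K.IsWalk (d :: l) u v) {x : ℝ}
    (hx : 1 ≤ x) : K.walkPt u (d :: l) x = K.walkPt (K.term d) l (x - 1) := by
  rcases hx.lt_or_eq with hx | rfl
  · rw [walkPt, if_neg (by linarith)]
  · rw [walkPt, if_pos le_rfl, sub_self, walkPt_of_nonpos h.2 le_rfl, Set.projIcc_of_right_le _ le_rfl]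
    exact edgePt_one d

theorem continuous_walkPt {l : List K.D} {u v : K.V} (h : K.IsWalk l u v) :
    Continuous (K.walkPt u l) := by
  induction l generalizing u with
  | nil => exact continuous_const
  | cons d l ih =>
    have : K.walkPt u (d :: l) = fun x : ℝ =>
        if x ≤ 1 then K.edgePt d (Set.projIcc 0 1 zero_le_one x) else K.walkPt (K.term d) l (x - 1) := by
      funext x; rw [walkPt]
    rw [this]
    refine Continuous.if_le ((continuous_edgePt d).comp continuous_projIcc)
      ((ih h.2).comp (continuous_id.sub continuous_const)) continuous_id continuous_const ?_
    rintro x rfl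
    have := walkPt_cons_of_ge h le_rfl
    rwa [walkPt, if_pos le_rfl] at this

theorem walkPt_of_ge {l : List K.D} {u v : K.V} (h : K.IsWalk l u v) {x : ℝ} (hx : l.length ≤ x) :
    K.walkPt u l x = K.vert v := by
  induction l generalizing u x with
  | nil => exact congrArg _ h
  | cons d l ih =>
    rw [List.length_cons] at hx
    push_cast at hx
    rw [walkPt_cons_of_ge h (by have : (0 : ℝ) ≤ l.length := by positivity
                                linarith)]
    exact ih h.2 (by linarith)

theorem walkPt_edge {l : List K.D} {u v : K.V} (h : K.IsWalk l u v) (k : ℕ) (hk : k < l.length)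
    (t : unitInterval) : K.walkPt u l (k + t) = K.edgePt l[k] t := by
  induction l generalizing u k with
  | nil => simp at hk
  | cons d l ih =>
    cases k with
    | zero => simp [walkPt, t.2.2]
    | succ k =>
      rw [walkPt_cons_of_ge h (by push_cast; have := t.2.1; have : (0 : ℝ) ≤ k := by positivity
                                  linarith)]
      have := ih h.2 k (by simpa using hk)
      rw [List.getElem_cons_succ, ← this]
      push_cast; ring_nf

theorem exists_nat_add_unit {n : ℕ} (hn : 0 < n) {x : ℝ} (h0 : 0 ≤ x) (h1 : x ≤ n) :
    ∃ (k : ℕ) (t : unitInterval), k < n ∧ x = k + t := by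
  rcases h1.lt_or_eq with h1 | rfl
  · refine ⟨⌊x⌋₊, ⟨x - ⌊x⌋₊, ?_, ?_⟩, (Nat.floor_lt h0).2 h1, by simp⟩
    · linarith [Nat.floor_le h0]
    · linarith [Nat.lt_floor_add_one x]
  -- The right end is the terminal point of the last edge, since there is no edge number `n`.
  · refine ⟨n - 1, 1, by omega, ?_⟩
    have : ((n - 1 : ℕ) : ℝ) = n - 1 := by rw [Nat.cast_sub hn]; simp
    rw [this]; simp

theorem walkPt_append_left {l m : List K.D} {u v : K.V} (h : K.IsWalk (l ++ m) u v) {x : ℝ}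
    (hx : x ≤ l.length) : K.walkPt u (l ++ m) x = K.walkPt u l x := by
  induction l generalizing u x with
  | nil => exact walkPt_of_nonpos h (by simpa using hx)
  | cons d l ih =>
    rw [List.cons_append, walkPt, walkPt]
    split_ifs with h1
    · rfl
    · refine ih h.2 ?_
      rw [List.length_cons] at hx; push_cast at hx; linarith

theorem walkPt_clamp {l : List K.D} {u v : K.V} (h : K.IsWalk l u v) (x : ℝ) :
    K.walkPt u l x = K.walkPt u l (max 0 (min x l.length)) := by
  rcases le_total x 0 with hx | hx
  · rw [walkPt_of_nonpos h hx, walkPt_of_nonpos h]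
    rw [max_eq_left]; exact (min_le_left _ _).trans hx
  · rcases le_total x l.length with hx' | hx'
    · rw [min_eq_left hx', max_eq_right hx]
    · rw [walkPt_of_ge h hx', min_eq_right hx', walkPt_of_ge h (le_max_right _ _)]

theorem walkPt_revWalk {l : List K.D} {u v : K.V} (h : K.IsWalk l u v) (x : ℝ) :
    K.walkPt v (K.revWalk l) x = K.walkPt u l (l.length - x) := by
  have hlen : ((K.revWalk l).length : ℝ) = l.length := by simp
  rcases le_or_gt x 0 with hx | hx
  · rw [walkPt_of_nonpos h.revWalk hx, walkPt_of_ge h (by linarith)]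
  rcases le_or_gt (l.length : ℝ) x with hx' | hx'
  · rw [walkPt_of_ge h.revWalk (by rw [hlen]; exact hx'), walkPt_of_nonpos h (by linarith)]
  have hl : 0 < l.length := by
    by_contra hc
    have : l.length = 0 := by omega
    rw [this] at hx'; push_cast at hx'; linarith
  obtain ⟨k, t, hk, rfl⟩ := exists_nat_add_unit hl hx.le hx'.le
  rw [walkPt_edge h.revWalk k (by simpa using hk)]
  have e : (l.length : ℝ) - (k + t) = ((l.length - 1 - k : ℕ) : ℝ) + (unitInterval.symm t : ℝ) := by
    rw [Nat.cast_sub (by omega), Nat.cast_sub (by omega), unitInterval.coe_symm_eq]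
    push_cast; ring
  rw [e, walkPt_edge h _ (by omega)]
  have e2 : (K.revWalk l)[k]'(by simpa using hk) = K.rev (l[l.length - 1 - k]'(by omega)) := by
    simp [DartGraph.revWalk]
  rw [e2, edgePt_rev']

theorem walkPt_mem_oneSkeleton (u : K.V) (l : List K.D) (x : ℝ) :
    K.walkPt u l x ∈ K.oneSkeleton := by
  induction l generalizing u x with
  | nil => exact vert_mem_oneSkeleton u
  | cons d l ih =>
    rw [walkPt]
    split_ifs
    · exact edgePt_mem_oneSkeleton _ _
    · exact ih _ _

theorem walkPt_nat {l : List K.D} {u v : K.V} (h : K.IsWalk l u v) (k : ℕ) (hk : k ≤ l.length) :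
    K.walkPt u l k = K.vert (K.walkVert u l k) := by
  induction l generalizing u k with
  | nil => cases k <;> rfl
  | cons d l ih =>
    cases k with
    | zero => simpa using walkPt_of_nonpos h le_rfl
    | succ k =>
      rw [walkPt_cons_of_ge h (by push_cast; linarith [(Nat.cast_nonneg k : (0 : ℝ) ≤ k)])]
      have := ih h.2 k (by simpa using hk)
      rw [DartGraph.walkVert_cons_succ, ← this]
      push_cast; ring_nf

theorem follows_walkPt {l : List K.D} {u v : K.V} (h : K.IsWalk l u v) {γ : unitInterval → K.Space}
    {s : unitInterval → ℝ} (hs : Continuous s) (hm : Monotone s) (h0 : s 0 = 0)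
    (h1 : s 1 = l.length) (hγ : ∀ t, γ t = K.walkPt u l (s t)) : K.Follows u l γ := by
  refine ⟨s, hs, hm, h0, h1, ?_, ?_⟩
  · rintro rfl t; rw [hγ]; rfl
  · intro k x t ht
    rw [hγ, ht, walkPt_edge h k k.2]; rfl

theorem Follows.exists_walkPt {l : List K.D} {u v : K.V} (h : K.IsWalk l u v)
    {γ : unitInterval → K.Space} (hf : K.Follows u l γ) :
    ∃ s : unitInterval → ℝ, Continuous s ∧ Monotone s ∧ s 0 = 0 ∧ s 1 = l.length ∧
      ∀ t, γ t = K.walkPt u l (s t) := by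
  obtain ⟨s, hs, hm, h0, h1, h2, h3⟩ := hf
  refine ⟨s, hs, hm, h0, h1, fun t => ?_⟩
  rcases Nat.eq_zero_or_pos l.length with hl | hl
  · have := List.length_eq_zero_iff.1 hl
    subst this
    exact h2 rfl t
  · have b0 : 0 ≤ s t := h0 ▸ hm t.2.1
    have b1 : s t ≤ l.length := h1 ▸ hm t.2.2
    obtain ⟨k, x, hk, hx⟩ := exists_nat_add_unit hl b0 b1
    rw [h3 ⟨k, hk⟩ x t hx, hx, walkPt_edge h k hk]; rfl

/-! ### Maps between complexes -/

theorem term_map {K' : CombComplex} {m : K.Space → K'.Space} {jv : K.V → K'.V} {jd : K.D → K'.D}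
    (hv : ∀ v, m (K.vert v) = K'.vert (jv v)) (he : ∀ d t, m (K.edgePt d t) = K'.edgePt (jd d) t)
    (d : K.D) : jv (K.term d) = K'.term (jd d) := by
  have := he d 1
  rw [edgePt_one, edgePt_one, hv] at this
  exact vert_injective this

theorem init_map {K' : CombComplex} {m : K.Space → K'.Space} {jv : K.V → K'.V} {jd : K.D → K'.D}
    (hv : ∀ v, m (K.vert v) = K'.vert (jv v)) (he : ∀ d t, m (K.edgePt d t) = K'.edgePt (jd d) t)
    (d : K.D) : jv (K.init d) = K'.init (jd d) := by
  have := he d 0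
  rw [edgePt_zero, edgePt_zero, hv] at this
  exact vert_injective this

theorem map_walkPt {K' : CombComplex} {m : K.Space → K'.Space} {jv : K.V → K'.V} {jd : K.D → K'.D}
    (hv : ∀ v, m (K.vert v) = K'.vert (jv v)) (he : ∀ d t, m (K.edgePt d t) = K'.edgePt (jd d) t)
    (u : K.V) (l : List K.D) (x : ℝ) :
    m (K.walkPt u l x) = K'.walkPt (jv u) (l.map jd) x := by
  induction l generalizing u x with
  | nil => exact hv u
  | cons d l ih =>
    rw [List.map_cons, walkPt, walkPt]
    split_ifs
    · exact he _ _
    · rw [ih, term_map hv he]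

theorem isWalk_map {K' : CombComplex} {m : K.Space → K'.Space} {jv : K.V → K'.V} {jd : K.D → K'.D}
    (hv : ∀ v, m (K.vert v) = K'.vert (jv v)) (he : ∀ d t, m (K.edgePt d t) = K'.edgePt (jd d) t)
    {l : List K.D} {u v : K.V} (h : K.IsWalk l u v) : K'.IsWalk (l.map jd) (jv u) (jv v) := by
  induction l generalizing u with
  | nil => exact congrArg jv h
  | cons d l ih =>
    refine ⟨by rw [← init_map hv he, h.1], ?_⟩
    rw [← term_map hv he]
    exact ih h.2

theorem exists_cellMap {K' : CombComplex} (jv : K.V → K'.V) (jd : K.D → K'.D) (jf : K.F → K'.F)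
    (hrev : ∀ d, jd (K.rev d) = K'.rev (jd d)) (hinit : ∀ d, K'.init (jd d) = jv (K.init d))
    (hb : ∀ f, K'.bdry (jf f) = (K.bdry f).map jd) :
    ∃ m : K.Space → K'.Space, Continuous m ∧ (∀ v, m (K.vert v) = K'.vert (jv v)) ∧
      (∀ d t, m (K.edgePt d t) = K'.edgePt (jd d) t) ∧
      ∀ f z, m (K.facePt f z) = K'.facePt (jf f) z := by
  obtain ⟨m, h1, h2, h3⟩ := exists_lift (K := K) (fun v => K'.vert (jv v))
    (fun d t => K'.edgePt (jd d) t) (fun f z => K'.facePt (jf f) z)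
    (fun d t => by rw [hrev, edgePt_rev]) (fun d => by rw [edgePt_zero, hinit])
    (fun f k hk t => by
      have hlen : (K.bdry f).length = (K'.bdry (jf f)).length := by rw [hb, List.length_map]
      rw [hlen, facePt_circlePt (jf f) k (hlen ▸ hk)]
      congr 1
      simp [hb])
  refine ⟨m, continuous_iff_cells.2 ⟨fun d => ?_, fun f => ?_⟩, h1, h2, h3⟩
  · simp only [h2]; exact continuous_edgePt _
  · simp only [h3]; exact continuous_facePt _

end CombComplex

namespace CombComplex

variable {K : CombComplex}

theorem finite_closedEdge_mem (hK : ∀ v, {d | K.init d = v}.Finite) (p : K.Space) :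
    {d | p ∈ K.closedEdge d}.Finite := by
  by_cases hp : ∃ v, p = K.vert v
  · obtain ⟨v, rfl⟩ := hp
    refine ((hK v).union ((hK v).image K.rev)).subset ?_
    intro d hd
    rcases mem_closedEdge_vert.1 hd with h | h
    · exact Or.inl h
    · exact Or.inr ⟨K.rev d, h, K.rev_rev d⟩
  · by_cases hd : ∃ d, p ∈ K.closedEdge d
    · obtain ⟨d, t, rfl⟩ := hd
      refine (Set.toFinite {d, K.rev d}).subset ?_
      rintro e ⟨t', ht'⟩
      have h0 : t ≠ 0 := by rintro rfl; exact hp ⟨_, edgePt_zero d⟩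
      have h1 : t ≠ 1 := by rintro rfl; exact hp ⟨_, edgePt_one d⟩
      rcases edgePt_eq_edgePt h0 h1 ht'.symm with ⟨rfl, -⟩ | ⟨rfl, -⟩ <;> simp
    · push Not at hd
      have : {d | p ∈ K.closedEdge d} = ∅ := by ext d; simp [hd d]
      rw [this]; exact Set.finite_empty

/-! ### Coarse distance -/

/-- Every vertex is joined to `y` by an edge path. -/
def ConnectedFrom (K : CombComplex) (y : K.V) : Prop := ∀ v, ∃ l, K.IsWalk l y v

theorem dist_self (y : K.V) : K.dist y y = 0 :=
  Nat.le_zero.1 (DartGraph.dist_le (K := K.toDartGraph) (l := []) rfl)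

theorem dist_term_le {y : K.V} (hy : K.ConnectedFrom y) (d : K.D) :
    K.dist y (K.term d) ≤ K.dist y (K.init d) + 1 := by
  obtain ⟨l, hl⟩ := hy (K.init d)
  obtain ⟨m, hm, hlen⟩ := DartGraph.exists_walk_dist hl
  have : K.IsWalk (m ++ [d]) y (K.term d) := DartGraph.IsWalk.append hm ⟨rfl, rfl⟩
  simpa [hlen] using DartGraph.dist_le this

theorem dist_init_le {y : K.V} (hy : K.ConnectedFrom y) (d : K.D) :
    K.dist y (K.init d) ≤ K.dist y (K.term d) + 1 := by
  simpa using dist_term_le hy (K.rev d)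

@[simp] theorem coarseDistRat_vert (y v : K.V) :
    K.coarseDistRat y (K.vert v) = K.dist y v := by
  have h : ∃ w, K.vert v = K.vert w := ⟨v, rfl⟩
  rw [coarseDistRat, dif_pos h, ← vert_injective h.choose_spec]

theorem edgeDist_rev (y : K.V) (d : K.D) : K.edgeDist y (K.rev d) = K.edgeDist y d := by
  simp only [edgeDist, DartGraph.init_rev, DartGraph.term_rev]
  rw [min_comm]

theorem coarseDistRat_edgePt (y : K.V) (d : K.D) {t : unitInterval} (h0 : t ≠ 0) (h1 : t ≠ 1) :
    K.coarseDistRat y (K.edgePt d t) = K.edgeDist y d := by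
  have hn : ¬ ∃ v, K.edgePt d t = K.vert v := fun ⟨v, h⟩ => edgePt_ne_vert d h0 h1 v h
  have h : ∃ e, K.edgePt d t ∈ K.closedEdge e := ⟨d, edgePt_mem_closedEdge d t⟩
  rw [coarseDistRat, dif_neg hn, dif_pos h]
  obtain ⟨t', ht'⟩ := h.choose_spec
  rcases edgePt_eq_edgePt h0 h1 ht'.symm with ⟨e, -⟩ | ⟨e, -⟩
  · rw [e]
  · rw [e, edgeDist_rev]

theorem coarseDistRat_closedEdge {y : K.V} (hy : K.ConnectedFrom y) {d : K.D} {p : K.Space}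
    (hp : p ∈ K.closedEdge d) :
    (min (K.dist y (K.init d)) (K.dist y (K.term d)) : ℕ) ≤ K.coarseDistRat y p ∧
      K.coarseDistRat y p ≤ (min (K.dist y (K.init d)) (K.dist y (K.term d)) : ℕ) + 1 := by
  have h1 := dist_term_le hy d
  have h2 := dist_init_le hy d
  obtain ⟨t, rfl⟩ := hp
  by_cases h0 : t = 0
  · subst h0
    rw [edgePt_zero, coarseDistRat_vert]
    constructor
    · exact_mod_cast min_le_left _ _
    · have : K.dist y (K.init d) ≤ min (K.dist y (K.init d)) (K.dist y (K.term d)) + 1 := by omega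
      exact_mod_cast this
  by_cases h1 : t = 1
  · subst h1
    rw [edgePt_one, coarseDistRat_vert]
    constructor
    · exact_mod_cast min_le_right _ _
    · have : K.dist y (K.term d) ≤ min (K.dist y (K.init d)) (K.dist y (K.term d)) + 1 := by omega
      exact_mod_cast this
  rw [coarseDistRat_edgePt y d h0 h1, edgeDist]
  constructor <;> linarith

theorem coarseDistRat_edge_le {y : K.V} (hy : K.ConnectedFrom y) {d : K.D} {p q : K.Space}
    (hp : p ∈ K.closedEdge d) (hq : q ∈ K.closedEdge d) :
    K.coarseDistRat y p ≤ K.coarseDistRat y q + 1 := by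
  linarith [(coarseDistRat_closedEdge hy hp).2, (coarseDistRat_closedEdge hy hq).1]

theorem exists_edgeDist_eq_max (y : K.V) (l : List K.D) (hl : l ≠ []) :
    ∃ d ∈ l, (l.map (K.edgeDist y)).foldr max 0 = K.edgeDist y d := by
  induction l with
  | nil => exact absurd rfl hl
  | cons d l ih =>
    by_cases h : l = []
    · subst h
      refine ⟨d, by simp, ?_⟩
      simp only [List.map_cons, List.map_nil, List.foldr_cons, List.foldr_nil]
      exact max_eq_left (by unfold edgeDist; positivity)
    · obtain ⟨e, he, hk⟩ := ih h
      simp only [List.map_cons, List.foldr_cons, hk]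
      rcases max_choice (K.edgeDist y d) (K.edgeDist y e) with h' | h'
      · exact ⟨d, by simp, h'⟩
      · exact ⟨e, by simp [he], h'⟩

/-- The coarse distance of an edge is attained from an endpoint by adding 1/2, and that of a face
from one of its edges by subtracting 1/4. Thus a bound at vertices passes to all points for a
monotone function. -/
theorem exists_vertex_below (y : K.V) (p : K.Space) :
    ∃ v, (K.dist y v : ℚ) ≤ K.coarseDistRat y p ∧ K.coarseDistRat y p ≤ K.dist y v + 1 := by
  have hedge : ∀ d, ∃ v, K.edgeDist y d = K.dist y v + 1 / 2 := by
    intro d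
    rcases min_choice (K.dist y (K.init d)) (K.dist y (K.term d)) with h | h
    · exact ⟨K.init d, by rw [edgeDist, h]⟩
    · exact ⟨K.term d, by rw [edgeDist, h]⟩
  by_cases h1 : ∃ v, p = K.vert v
  · obtain ⟨v, rfl⟩ := h1
    exact ⟨v, by simp, by simp⟩
  by_cases h2 : ∃ d, p ∈ K.closedEdge d
  · rw [coarseDistRat, dif_neg h1, dif_pos h2]
    obtain ⟨v, hv⟩ := hedge h2.choose
    exact ⟨v, by rw [hv]; linarith, by rw [hv]; linarith⟩
  have h3 : ∃ f z, p = K.facePt f z := by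
    refine space_cases (motive := fun p => (¬ ∃ v, p = K.vert v) → (¬ ∃ d, p ∈ K.closedEdge d) →
      ∃ f z, p = K.facePt f z) p ?_ ?_ ?_ h1 h2
    · intro v h; exact absurd ⟨v, rfl⟩ h
    · intro d t _ h; exact absurd ⟨d, edgePt_mem_closedEdge d t⟩ h
    · intro f z _ _; exact ⟨f, z, rfl⟩
  rw [coarseDistRat, dif_neg h1, dif_neg h2, dif_pos h3, faceDist]
  obtain ⟨d, -, hd⟩ := exists_edgeDist_eq_max y _ (K.bdry_ne_nil h3.choose)
  obtain ⟨v, hv⟩ := hedge d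
  exact ⟨v, by rw [hd, hv]; linarith, by rw [hd, hv]; linarith⟩

end CombComplex

/-! ### Tame paths -/

namespace QuarterNat

/-- `n ↦ n + c`. -/
def shift (c : ℕ) (n : QuarterNat) : QuarterNat :=
  ⟨n.1 + c, by
    obtain ⟨k, hk⟩ := n.2
    exact ⟨k + 4 * c, by rw [hk]; push_cast; ring⟩⟩

theorem nonneg (n : QuarterNat) : (0 : ℚ) ≤ n.1 := by
  obtain ⟨k, hk⟩ := n.2; rw [hk]; positivity

/-- `f` with argument and value increased by `c`. -/
def widen (c : ℕ) (f : QuarterNat → QuarterNat) (n : QuarterNat) : QuarterNat :=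
  (f (n.shift c)).shift c

theorem widen_monotone {f : QuarterNat → QuarterNat} (hf : Monotone f) (c : ℕ) :
    Monotone (widen c f) := by
  intro m n h
  have h' : m.1 ≤ n.1 := h
  have : f (m.shift c) ≤ f (n.shift c) := hf (by
    change m.1 + c ≤ n.1 + c; linarith)
  have this' : (f (m.shift c)).1 ≤ (f (n.shift c)).1 := this
  change (f (m.shift c)).1 + c ≤ (f (n.shift c)).1 + c
  linarith

end QuarterNat

/-- A bounded shift of argument and value is absorbed by a larger multiplicative constant. -/
theorem LipschitzEquivalent.widen {f g : QuarterNat → QuarterNat} (hf : Monotone f)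
    (hg : Monotone g) (h : LipschitzEquivalent f g) (c : ℕ) :
    LipschitzEquivalent f (QuarterNat.widen c g) := by
  obtain ⟨C, hC⟩ := h
  have hc0 : (0 : ℚ) ≤ c := by positivity
  have hC0 : (0 : ℚ) ≤ C := by positivity
  -- This dominates both `C * c + C`, the shift in the argument after composing with n ↦ C n + C,
  -- and `C + c`, the shift in the value.
  refine ⟨(C + 1) * (c + 1), fun n => ⟨?_, ?_⟩⟩
  · have h1 := (hC n).1
    have hn := n.nonneg
    have h2 : (g (n.affine C)).1 ≤ (g ((n.affine ((C + 1) * (c + 1))).shift c)).1 := hg (by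
      change (C * n.1 + C : ℚ) ≤ ((C + 1) * (c + 1) : ℕ) * n.1 + ((C + 1) * (c + 1) : ℕ) + c
      push_cast
      nlinarith [mul_nonneg hC0 hc0, mul_nonneg (mul_nonneg hC0 hc0) hn, mul_nonneg hc0 hn])
    have h3 := (g (n.affine C)).nonneg
    change (f n).1 ≤ ((C + 1) * (c + 1) : ℕ) * ((g ((n.affine ((C + 1) * (c + 1))).shift c)).1 + c) + ((C + 1) * (c + 1) : ℕ)
    have h4 : (C : ℚ) * (g (n.affine C)).1 ≤ ((C + 1) * (c + 1) : ℕ) * ((g ((n.affine ((C + 1) * (c + 1))).shift c)).1 + c) := by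
      refine mul_le_mul ?_ (by linarith) h3 (by positivity)
      push_cast; nlinarith
    have h5 : (C : ℚ) ≤ ((C + 1) * (c + 1) : ℕ) := by push_cast; nlinarith
    linarith
  · have h1 := (hC (n.shift c)).2
    have hn := n.nonneg
    have h2 : (f ((n.shift c).affine C)).1 ≤ (f (n.affine ((C + 1) * (c + 1)))).1 := hf (by
      change (C * (n.1 + c) + C : ℚ) ≤ ((C + 1) * (c + 1) : ℕ) * n.1 + ((C + 1) * (c + 1) : ℕ)
      push_cast
      nlinarith [mul_nonneg hC0 hc0, mul_nonneg (mul_nonneg hC0 hc0) hn, mul_nonneg hc0 hn])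
    have h3 := (f ((n.shift c).affine C)).nonneg
    change (g (n.shift c)).1 + c ≤ ((C + 1) * (c + 1) : ℕ) * (f (n.affine ((C + 1) * (c + 1)))).1 + ((C + 1) * (c + 1) : ℕ)
    have h4 : (C : ℚ) * (f ((n.shift c).affine C)).1 ≤ ((C + 1) * (c + 1) : ℕ) * (f (n.affine ((C + 1) * (c + 1)))).1 := by
      refine mul_le_mul ?_ h2 h3 (by positivity)
      push_cast; nlinarith
    have h5 : (C : ℚ) + c ≤ ((C + 1) * (c + 1) : ℕ) := by push_cast; nlinarith
    linarith

namespace CombComplex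

variable {K : CombComplex}

/-- Tameness of a single path, with the non-strict inequality between the parameters. -/
def TamePath (K : CombComplex) (y : K.V) (f : QuarterNat → QuarterNat)
    (γ : unitInterval → K.Space) : Prop :=
  ∀ s t, s ≤ t → K.coarseDist y (γ s) ≤ f (K.coarseDist y (γ t))

/-- The form in which errors are collected: an error of at most `c` in the reference distance and
one of at most `c` in the bound. -/
theorem le_widen {f : QuarterNat → QuarterNat} (hf : Monotone f) {c : ℕ} {a b b' : QuarterNat}
    (hb : b.1 ≤ b'.1 + c) (h : a.1 ≤ (f b).1 + c) : a ≤ QuarterNat.widen c f b' := by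
  have : (f b).1 ≤ (f (b'.shift c)).1 := hf (by change b.1 ≤ b'.1 + c; exact hb)
  change a.1 ≤ (f (b'.shift c)).1 + c
  linarith

/-- Lets estimates with smaller errors be put under the final constant 3. -/
theorem widen_mono {f : QuarterNat → QuarterNat} (hf : Monotone f) {c c' : ℕ} (h : c ≤ c')
    (n : QuarterNat) : QuarterNat.widen c f n ≤ QuarterNat.widen c' f n := by
  have hc : (c : ℚ) ≤ c' := by exact_mod_cast h
  have : (f (n.shift c)).1 ≤ (f (n.shift c')).1 := hf (by
    change n.1 + c ≤ n.1 + c'; linarith)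
  change (f (n.shift c)).1 + c ≤ (f (n.shift c')).1 + c'
  linarith

/-- `f` bounds each coarse distance by itself, up to a constant. -/
def Dominates (K : CombComplex) (y : K.V) (f : QuarterNat → QuarterNat) : Prop :=
  ∀ p, K.coarseDistRat y p ≤ (f (K.coarseDist y p)).1 + 2

/-- A tame path into a vertex that stays in the 1-skeleton near its end. -/
theorem dist_le_of_tame {y v : K.V} (hy : K.ConnectedFrom y) {f : QuarterNat → QuarterNat}
    {γ : unitInterval → K.Space} (hγ : Continuous γ) (h1 : γ 1 = K.vert v)
    (hs : ∀ t, γ t ∈ K.oneSkeleton)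
    (hf : ∀ s t, s < t → K.coarseDist y (γ s) ≤ f (K.coarseDist y (γ t))) :
    (K.dist y v : ℚ) ≤ (f (K.coarseDist y (K.vert v))).1 + 1 := by
  -- The complement of `C` meets the 1-skeleton in the open star of `v`, where the coarse distance
  -- is at least that of `v` minus 1. Shortly before its end the path is in this star, and tameness
  -- compares such a point with `v`.
  let C : Set K.Space := K.vert '' {w | w ≠ v} ∪
    ⋃ d ∈ {d | K.vert v ∉ K.closedEdge d}, K.closedEdge d
  have hC : IsClosed C := isClosed_subcomplex _ _
  have hv : K.vert v ∉ C := by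
    rintro (⟨w, hw, h⟩ | h)
    · exact hw (vert_injective h)
    · obtain ⟨d, hd, h⟩ := Set.mem_iUnion₂.1 h
      exact hd h
  have hmem : γ ⁻¹' Cᶜ ∈ nhds (1 : unitInterval) :=
    (hC.isOpen_compl.preimage hγ).mem_nhds (by rw [Set.mem_preimage, h1]; exact hv)
  obtain ⟨t, ht, ht1⟩ : ∃ t : unitInterval, γ t ∉ C ∧ t < 1 := by
    have hne : (nhdsWithin (1 : unitInterval) (Set.Iio 1)).NeBot :=
      nhdsWithin_Iio_neBot' ⟨0, by simp⟩ le_rfl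
    obtain ⟨t, h, h'⟩ := (hne.nonempty_of_mem (Filter.inter_mem
      (mem_nhdsWithin_of_mem_nhds hmem) self_mem_nhdsWithin))
    exact ⟨t, h, h'⟩
  have hlow : (K.dist y v : ℚ) - 1 ≤ K.coarseDistRat y (γ t) := by
    rcases hs t with ⟨w, hw⟩ | h
    · have : w = v := by
        by_contra hne
        exact ht (Or.inl ⟨w, hne, hw⟩)
      rw [← hw, this, coarseDistRat_vert]; linarith
    · obtain ⟨d, hd⟩ := Set.mem_iUnion.1 h
      have hvd : K.vert v ∈ K.closedEdge d := by
        by_contra hne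
        exact ht (Or.inr (Set.mem_iUnion₂.2 ⟨d, hne, hd⟩))
      have := coarseDistRat_edge_le hy hvd hd
      rw [coarseDistRat_vert] at this; linarith
  have h := hf t 1 ht1
  rw [h1] at h
  have h' : K.coarseDistRat y (γ t) ≤ (f (K.coarseDist y (K.vert v))).1 := h
  linarith

theorem dominates_of_vertices {y : K.V} {f : QuarterNat → QuarterNat} (hf : Monotone f)
    (h : ∀ v, (K.dist y v : ℚ) ≤ (f (K.coarseDist y (K.vert v))).1 + 1) : K.Dominates y f := by
  intro p
  obtain ⟨v, h1, h2⟩ := exists_vertex_below y p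
  have : (f (K.coarseDist y (K.vert v))).1 ≤ (f (K.coarseDist y p)).1 := hf (by
    change K.coarseDistRat y (K.vert v) ≤ K.coarseDistRat y p
    rw [coarseDistRat_vert]; exact h1)
  linarith [h v]

/-- Tameness is assumed only for s < t. The case s = t is needed when paths are slowed down or made
constant, and domination supplies it at the cost of widening by 2. -/
theorem Dominates.tamePath {y : K.V} {f : QuarterNat → QuarterNat} (hf : Monotone f)
    (hd : K.Dominates y f) {γ : unitInterval → K.Space}
    (h : ∀ s t, s < t → K.coarseDist y (γ s) ≤ f (K.coarseDist y (γ t))) :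
    K.TamePath y (QuarterNat.widen 2 f) γ := by
  intro s t hst
  rcases hst.lt_or_eq with hlt | rfl
  · refine le_widen hf (b := K.coarseDist y (γ t)) (by push_cast; linarith) ?_
    have : (K.coarseDist y (γ s)).1 ≤ (f (K.coarseDist y (γ t))).1 := h s t hlt
    push_cast; linarith
  · exact le_widen hf (b := K.coarseDist y (γ s)) (by push_cast; linarith) (hd _)

end CombComplex

/-! ### The Cayley complex -/

namespace SymmPresentation

variable {G : Type*} [Group G] (P : SymmPresentation G)

@[simp] theorem eval_nil : P.eval [] = 1 := rfl

@[simp] theorem eval_cons (a : P.A) (w : List P.A) : P.eval (a :: w) = P.rep a * P.eval w := by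
  simp [eval]

@[simp] theorem eval_append (v w : List P.A) : P.eval (v ++ w) = P.eval v * P.eval w := by
  simp [eval]

@[simp] theorem invWord_cons (a : P.A) (w : List P.A) :
    invWord P.inv (a :: w) = invWord P.inv w ++ [P.inv a] := by simp [invWord]

@[simp] theorem invWord_nil : invWord P.inv [] = [] := rfl

@[simp] theorem invWord_append (v w : List P.A) :
    invWord P.inv (v ++ w) = invWord P.inv w ++ invWord P.inv v := by simp [invWord]

@[simp] theorem invWord_invWord (w : List P.A) : invWord P.inv (invWord P.inv w) = w := by
  induction w with
  | nil => rfl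
  | cons a w ih => simp [ih, P.inv_inv]

@[simp] theorem length_invWord (w : List P.A) : (invWord P.inv w).length = w.length := by
  simp [invWord]

@[simp] theorem eval_invWord (w : List P.A) : P.eval (invWord P.inv w) = (P.eval w)⁻¹ := by
  induction w with
  | nil => simp
  | cons a w ih => simp [ih, P.rep_inv]

@[simp] theorem length_path (g : G) (w : List P.A) : (P.path g w).length = w.length := by
  induction w generalizing g with
  | nil => rfl
  | cons a w ih => simp [path, ih]

theorem path_append (g : G) (v w : List P.A) :
    P.path g (v ++ w) = P.path g v ++ P.path (g * P.eval v) w := by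
  induction v generalizing g with
  | nil => simp [path]
  | cons a v ih => simp [path, ih, mul_assoc]

/-- A group element as a vertex of the Cayley complex. -/
def cvert (g : G) : P.cayleyComplex.V := g

/-- The edge of the Cayley complex starting at `g` and labelled `a`. -/
def cdart (g : G) (a : P.A) : P.cayleyComplex.D := (g, a)

/-- The edge path of the Cayley complex starting at `g` and labelled `w`. -/
def cpath (g : G) (w : List P.A) : List P.cayleyComplex.D := P.path g w

@[simp] theorem term_cdart (g : G) (a : P.A) :
    P.cayleyComplex.term (P.cdart g a) = P.cvert (g * P.rep a) := rfl

@[simp] theorem rev_cdart (g : G) (a : P.A) :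
    P.cayleyComplex.rev (P.cdart g a) = P.cdart (g * P.rep a) (P.inv a) := rfl

theorem cvert_injective : Function.Injective P.cvert := fun _ _ h => h

theorem cdart_injective {g h : G} {a b : P.A} (e : P.cdart g a = P.cdart h b) : g = h ∧ a = b :=
  Prod.ext_iff.1 e

theorem exists_cdart (d : P.cayleyComplex.D) : ∃ g a, d = P.cdart g a := ⟨d.1, d.2, rfl⟩

@[simp] theorem cpath_nil (g : G) : P.cpath g [] = [] := rfl

@[simp] theorem cpath_cons (g : G) (a : P.A) (w : List P.A) :
    P.cpath g (a :: w) = P.cdart g a :: P.cpath (g * P.rep a) w := rfl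

@[simp] theorem length_cpath (g : G) (w : List P.A) : (P.cpath g w).length = w.length :=
  P.length_path g w

theorem cpath_append (g : G) (v w : List P.A) :
    P.cpath g (v ++ w) = P.cpath g v ++ P.cpath (g * P.eval v) w := P.path_append g v w

theorem isWalk_cpath (g : G) (w : List P.A) :
    P.cayleyComplex.IsWalk (P.cpath g w) (P.cvert g) (P.cvert (g * P.eval w)) := P.isWalk_path g w

theorem isWalk_cpath_one (w : List P.A) :
    P.cayleyComplex.IsWalk (P.cpath 1 w) P.origin (P.cvert (P.eval w)) := by
  have := P.isWalk_cpath 1 w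
  rwa [one_mul] at this

theorem revWalk_cpath (g : G) (w : List P.A) :
    P.cayleyComplex.revWalk (P.cpath g w) = P.cpath (g * P.eval w) (invWord P.inv w) := by
  induction w generalizing g with
  | nil => rfl
  | cons a w ih =>
    rw [cpath_cons, DartGraph.revWalk_cons, ih, invWord_cons, cpath_append]
    simp [mul_assoc]

theorem walkVert_cpath (g : G) (w : List P.A) (k : ℕ) (hk : k ≤ w.length) :
    P.cayleyComplex.walkVert (P.cvert g) (P.cpath g w) k = P.cvert (g * P.eval (w.take k)) := by
  induction w generalizing g k with
  | nil => simp at hk; subst hk; simp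
  | cons a w ih =>
    cases k with
    | zero => simp
    | succ k =>
      rw [cpath_cons, DartGraph.walkVert_cons_succ, List.take_succ_cons, eval_cons, ← mul_assoc,
        term_cdart]
      exact ih _ k (by simpa using hk)

theorem exists_word (g : G) : ∃ w, P.eval w = g := by
  obtain ⟨x, rfl⟩ := P.surjective g
  induction x using FreeGroup.induction_on with
  | C1 => exact ⟨[], by simp⟩
  | of a => exact ⟨[a], by simp⟩
  | inv_of a _ => exact ⟨[P.inv a], by simp [P.rep_inv]⟩
  | mul x y hx hy =>
    obtain ⟨u, hu⟩ := hx
    obtain ⟨v, hv⟩ := hy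
    exact ⟨u ++ v, by simp [hu, hv]⟩

theorem exists_cpath_of_isWalk {l : List P.cayleyComplex.D} {g : G} {h : P.cayleyComplex.V}
    (hl : P.cayleyComplex.IsWalk l (P.cvert g) h) :
    ∃ w, l = P.cpath g w ∧ h = P.cvert (g * P.eval w) := by
  induction l generalizing g with
  | nil => exact ⟨[], rfl, by simpa using (show P.cvert g = h from hl).symm⟩
  | cons d l ih =>
    obtain ⟨h1, h2⟩ := hl
    obtain ⟨g', a, rfl⟩ := P.exists_cdart d
    obtain rfl : g' = g := h1
    rw [term_cdart] at h2
    obtain ⟨w, rfl, rfl⟩ := ih h2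
    exact ⟨a :: w, by simp, by simp [mul_assoc]⟩

theorem connectedFrom_origin : P.cayleyComplex.ConnectedFrom P.origin := by
  intro v
  obtain ⟨w, hw⟩ := P.exists_word v
  refine ⟨P.cpath 1 w, ?_⟩
  have := P.isWalk_cpath_one w
  rw [hw] at this
  exact this

theorem exists_geodesic (g : G) :
    ∃ w, P.eval w = g ∧ w.length = P.cayleyComplex.dist P.origin (P.cvert g) := by
  obtain ⟨l, hl⟩ := P.connectedFrom_origin (P.cvert g)
  obtain ⟨m, hm, hlen⟩ := DartGraph.exists_walk_dist hl
  obtain ⟨w, rfl, h2⟩ := P.exists_cpath_of_isWalk (g := 1) hm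
  refine ⟨w, ?_, by simpa using hlen⟩
  simpa using (P.cvert_injective h2).symm

theorem dist_eval_le (w : List P.A) :
    P.cayleyComplex.dist P.origin (P.cvert (P.eval w)) ≤ w.length := by
  simpa using DartGraph.dist_le (P.isWalk_cpath_one w)

theorem init_ne_term (d : P.cayleyComplex.D) : P.cayleyComplex.init d ≠ P.cayleyComplex.term d := by
  obtain ⟨g, a, rfl⟩ := P.exists_cdart d
  intro h
  have h' : g = g * P.rep a := h
  exact P.rep_ne_one a (by simpa using h')

theorem finite_init (v : P.cayleyComplex.V) : {d | P.cayleyComplex.init d = v}.Finite := by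
  have := P.finite_A
  refine (Set.finite_range fun a : P.A => P.cdart v a).subset ?_
  intro d h
  obtain ⟨g, a, rfl⟩ := P.exists_cdart d
  exact ⟨a, by rw [show g = v from h]⟩

end SymmPresentation

/-- Bijectivity of the enumeration of darts by the faces to their left. -/
theorem bijective_get_iff {α ι : Type*} (fw : ι → List α) :
    Function.Bijective (fun c : Σ o : ι, Fin (fw o).length => (fw c.1).get c.2) ↔
      (∀ o, (fw o).Nodup) ∧ ∀ d, ∃! o, d ∈ fw o := by
  constructor
  · rintro ⟨hi, hs⟩
    refine ⟨fun o => List.nodup_iff_injective_get.2 fun i j h => ?_, fun d => ?_⟩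
    · have := @hi ⟨o, i⟩ ⟨o, j⟩ h
      simpa using this
    · obtain ⟨⟨o, k⟩, rfl⟩ := hs d
      refine ⟨o, List.get_mem _ _, fun o' h => ?_⟩
      obtain ⟨k', hk'⟩ := List.mem_iff_get.1 h
      have := @hi ⟨o', k'⟩ ⟨o, k⟩ hk'
      exact congrArg Sigma.fst this
  · rintro ⟨hn, hu⟩
    refine ⟨?_, fun d => ?_⟩
    · rintro ⟨o, k⟩ ⟨o', k'⟩ h
      simp only at h
      obtain rfl : o = o' := (hu ((fw o).get k)).unique (List.get_mem _ _) (h ▸ List.get_mem _ _)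
      rw [List.nodup_iff_injective_get.1 (hn o) h]
    · obtain ⟨o, ho, -⟩ := hu d
      obtain ⟨k, hk⟩ := List.mem_iff_get.1 ho
      exact ⟨⟨o, k⟩, hk⟩

/-! ### Projections and labels of van Kampen diagrams -/

namespace VanKampenDiagram

open CombComplex

variable {G : Type*} [Group G] {P : SymmPresentation G} {w : List P.A}
  (Δ : VanKampenDiagram P w)

theorem boundary_length : Δ.boundary.length = w.length := by
  rw [← List.length_map (f := Δ.label), Δ.boundary_label]

/-- The effect of a projection on the 1-skeleton. -/
structure IsLabelling (π : Δ.Space → P.cayleyComplex.Space) (φ : Δ.V → G) : Prop where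
  base : φ Δ.base = 1
  vert : ∀ v, π (Δ.vert v) = P.cayleyComplex.vert (P.cvert (φ v))
  edge : ∀ d t, π (Δ.edgePt d t) = P.cayleyComplex.edgePt (P.cdart (φ (Δ.init d)) (Δ.label d)) t

variable {Δ}

theorem IsProjection.exists_labelling {π : Δ.Space → P.cayleyComplex.Space}
    (h : Δ.IsProjection π) : ∃ φ, Δ.IsLabelling π φ := by
  obtain ⟨φ, h1, h2, h3, -⟩ := h
  exact ⟨φ, h1, h2, h3⟩

theorem IsProjection.continuous {π : Δ.Space → P.cayleyComplex.Space}
    (h : Δ.IsProjection π) : Continuous π := by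
  obtain ⟨φ, h1, h2, h3, h4⟩ := h
  refine continuous_iff_cells.2 ⟨fun d => ?_, fun f => ?_⟩
  · simp only [h3]; exact continuous_edgePt _
  · obtain ⟨f', ρ, hρ⟩ := h4 f
    simp only [hρ]
    refine (continuous_facePt f').comp ?_
    exact Continuous.subtype_mk (ρ.continuous.comp continuous_subtype_val) _

namespace IsLabelling

variable {π : Δ.Space → P.cayleyComplex.Space} {φ : Δ.V → G} (h : Δ.IsLabelling π φ)
include h

theorem term (d : Δ.D) : φ (Δ.term d) = φ (Δ.init d) * P.rep (Δ.label d) :=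
  P.cvert_injective (term_map (jv := fun v => P.cvert (φ v)) h.vert h.edge d)

theorem init_ne_term (d : Δ.D) : Δ.init d ≠ Δ.term d := by
  intro he
  have := h.term d
  rw [← he] at this
  exact P.rep_ne_one _ (by simpa using this)

theorem walk_end {l : List Δ.D} {u v : Δ.V} (hl : Δ.IsWalk l u v) :
    φ v = φ u * P.eval (l.map Δ.label) := by
  induction l generalizing u with
  | nil => obtain rfl : u = v := hl; simp
  | cons d l ih =>
    obtain ⟨rfl, hl⟩ := hl
    rw [ih hl, h.term, List.map_cons, P.eval_cons, mul_assoc]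

theorem map_darts {l : List Δ.D} {u v : Δ.V} (hl : Δ.IsWalk l u v) :
    l.map (fun d => P.cdart (φ (Δ.init d)) (Δ.label d)) = P.cpath (φ u) (l.map Δ.label) := by
  induction l generalizing u with
  | nil => rfl
  | cons d l ih =>
    obtain ⟨rfl, hl⟩ := hl
    rw [List.map_cons, ih hl, List.map_cons, P.cpath_cons, h.term]

theorem walkPt {l : List Δ.D} {u v : Δ.V} (hl : Δ.IsWalk l u v) (x : ℝ) :
    π (Δ.walkPt u l x) = P.cayleyComplex.walkPt (P.cvert (φ u)) (P.cpath (φ u) (l.map Δ.label)) x := by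
  rw [map_walkPt (jv := fun v => P.cvert (φ v)) h.vert h.edge, h.map_darts hl]

theorem walkPt_base {l : List Δ.D} {v : Δ.V} (hl : Δ.IsWalk l Δ.base v) (x : ℝ) :
    π (Δ.walkPt Δ.base l x) = P.cayleyComplex.walkPt P.origin (P.cpath 1 (l.map Δ.label)) x := by
  rw [h.walkPt hl, h.base]; rfl

theorem walkVert {l : List Δ.D} {u v : Δ.V} (hl : Δ.IsWalk l u v) (k : ℕ) (hk : k ≤ l.length) :
    φ (Δ.walkVert u l k) = φ u * P.eval ((l.map Δ.label).take k) := by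
  induction l generalizing u k with
  | nil => simp at hk; subst hk; simp
  | cons d l ih =>
    cases k with
    | zero => simp
    | succ k =>
      obtain ⟨rfl, hl⟩ := hl
      rw [DartGraph.walkVert_cons_succ, ih hl k (by simpa using hk), h.term, List.map_cons,
        List.take_succ_cons, P.eval_cons, mul_assoc]

end IsLabelling

theorem label_revWalk (l : List Δ.D) :
    (Δ.revWalk l).map Δ.label = invWord P.inv (l.map Δ.label) := by
  induction l with
  | nil => rfl
  | cons d l ih => simp [ih, Δ.label_rev]

/-! ### The mirror image of a diagram -/

variable (Δ)

/-- The mirror image of a van Kampen diagram. -/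
def mirror : VanKampenDiagram P (invWord P.inv w) where
  V := Δ.V
  D := Δ.D
  rev := Δ.rev
  rev_rev := Δ.rev_rev
  rev_ne := Δ.rev_ne
  init := Δ.init
  F := Δ.F
  bdry f := Δ.revWalk (Δ.bdry f)
  bdry_ne_nil f h := Δ.bdry_ne_nil f (by
    have := congrArg Δ.revWalk h
    simpa using this)
  bdry_closed f := by
    obtain ⟨v, hv⟩ := Δ.bdry_closed f
    exact ⟨v, hv.revWalk⟩
  finite_V := Δ.finite_V
  finite_D := Δ.finite_D
  finite_F := Δ.finite_F
  base := Δ.base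
  label := Δ.label
  label_rev := Δ.label_rev
  boundary := Δ.revWalk Δ.boundary
  boundary_walk := Δ.boundary_walk.revWalk
  boundary_label := by rw [label_revWalk, Δ.boundary_label]
  bdry_label f := by rw [label_revWalk]; exact P.invWord_mem _ (Δ.bdry_label f)
  connected := Δ.connected
  faceWalk o := Δ.revWalk (Δ.faceWalk o)
  faceWalk_none := by rw [Δ.faceWalk_none]
  faceWalk_some f := by rw [Δ.faceWalk_some]
  left_face := by
    obtain ⟨h1, h2⟩ := (bijective_get_iff _).1 Δ.left_face
    refine (bijective_get_iff _).2 ⟨fun o => ?_, fun d => ?_⟩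
    · exact (List.nodup_reverse.2 (h1 o)).map DartGraph.rev_injective
    · simp only [DartGraph.mem_revWalk]
      exact h2 (Δ.rev d)
  vertex_link := by
    -- Reversing the face walks reverses the cyclic order of the edges around each vertex, so the
    -- chain of turns is run backwards.
    intro d d' hd
    have hlink := Δ.vertex_link d' d hd.symm
    have h := Relation.reflTransGen_swap.2 hlink
    refine Relation.ReflTransGen.mono (fun e e' hee => ?_) d d' h
    obtain ⟨o, k, hk⟩ := hee
    have h1 : CyclicSucc (Δ.faceWalk o) (Δ.rev e') e := ⟨k, hk⟩
    obtain ⟨k', hk'⟩ := (cyclicSucc_reverse h1).map Δ.rev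
    rw [Δ.rev_rev] at hk'
    exact ⟨o, k', hk'⟩
  euler := Δ.euler

/-- Complex conjugation reflects the disk and carries the k-th arc to the arc n-1-k with the
opposite direction, which is the index shift of a reversed boundary walk. -/
theorem diskMap_conj_circlePt {n k : ℕ} (hk : k < n) (t : unitInterval) :
    diskMap Complex.conjLIE (circlePt n k t) = circlePt n (n - 1 - k) (unitInterval.symm t) := by
  have hn : (n : ℝ) ≠ 0 := by
    have : 0 < n := by omega
    positivity
  apply Subtype.ext
  simp only [diskMap, circlePt]
  rw [Complex.conjLIE_apply, ← Complex.exp_conj, Complex.exp_eq_exp_iff_exists_int]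
  -- The angle of the reflected point and the negative of the original angle differ by one full
  -- turn.
  refine ⟨-1, ?_⟩
  have e : ((2 * Real.pi * (((n - 1 - k : ℕ) + (unitInterval.symm t : ℝ)) / n) : ℝ)) =
      2 * Real.pi - 2 * Real.pi * ((k + t) / n) := by
    rw [Nat.cast_sub (by omega), Nat.cast_sub (by omega), unitInterval.coe_symm_eq]
    field_simp
    push_cast; ring
  rw [e]
  simp only [map_mul, Complex.conj_ofReal, Complex.conj_I]
  push_cast; ring

/-- The homeomorphism onto the mirror image, as a map that preserves the 1-skeleton. -/
theorem exists_mirrorMap : ∃ m : Δ.Space → Δ.mirror.Space, Continuous m ∧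
    (∀ v, m (Δ.vert v) = Δ.mirror.vert v) ∧ (∀ d t, m (Δ.edgePt d t) = Δ.mirror.edgePt d t) ∧
    ∀ π : Δ.Space → P.cayleyComplex.Space, Δ.IsProjection π →
      ∃ π' : Δ.mirror.Space → P.cayleyComplex.Space, Δ.mirror.IsProjection π' ∧
        ∀ p, π' (m p) = π p := by
  obtain ⟨m, m1, m2, m3⟩ := exists_lift (K := Δ.toCombComplex) (fun v => Δ.mirror.vert v)
    (fun d t => Δ.mirror.edgePt d t) (fun f z => Δ.mirror.facePt f (diskMap Complex.conjLIE z))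
    (fun d t => edgePt_rev (K := Δ.mirror.toCombComplex) d t)
    (fun d => edgePt_zero (K := Δ.mirror.toCombComplex) d)
    (fun f k hk t => by
      have hlen : (Δ.bdry f).length = (Δ.mirror.bdry f).length :=
        (DartGraph.length_revWalk _).symm
      have hk' : (Δ.bdry f).length - 1 - k < (Δ.mirror.bdry f).length := by omega
      have e : (Δ.mirror.bdry f)[(Δ.bdry f).length - 1 - k]'hk' = Δ.rev (Δ.bdry f)[k] := by
        refine (DartGraph.getElem_revWalk (K := Δ.toDartGraph) _ _ (hlen ▸ hk')).trans ?_
        congr 2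
        omega
      rw [diskMap_conj_circlePt hk]
      have h1 := facePt_circlePt (K := Δ.mirror.toCombComplex) f _ hk' (unitInterval.symm t)
      rw [← hlen] at h1
      exact h1.trans ((congrArg (fun d => Δ.mirror.edgePt d (unitInterval.symm t)) e).trans
        (edgePt_rev (K := Δ.mirror.toCombComplex) _ t)))
  refine ⟨m, continuous_iff_cells.2 ⟨fun d => ?_, fun f => ?_⟩, m1, m2, ?_⟩
  · simp only [m2]; exact continuous_edgePt (K := Δ.mirror.toCombComplex) d
  · simp only [m3]
    refine (continuous_facePt (K := Δ.mirror.toCombComplex) f).comp ?_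
    exact Continuous.subtype_mk (Complex.conjLIE.continuous.comp continuous_subtype_val) _
  · intro π hπ
    have hcc : ∀ z : Disk, diskMap Complex.conjLIE (diskMap Complex.conjLIE z) = z := by
      intro z; apply Subtype.ext; simp [diskMap]
    obtain ⟨φ, p1, p2, p3, p4⟩ := hπ
    obtain ⟨π', q1, q2, q3⟩ := exists_lift (K := Δ.mirror.toCombComplex) (fun v => π (Δ.vert v))
      (fun d t => π (Δ.edgePt d t)) (fun f z => π (Δ.facePt f (diskMap Complex.conjLIE z)))
      (fun d t => congrArg π (edgePt_rev (K := Δ.toCombComplex) d t))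
      (fun d => congrArg π (edgePt_zero (K := Δ.toCombComplex) d))
      (fun f k hk t => by
        have hlen : (Δ.mirror.bdry f).length = (Δ.bdry f).length := DartGraph.length_revWalk _
        have hk' : (Δ.mirror.bdry f).length - 1 - k < (Δ.bdry f).length := by omega
        have e : (Δ.bdry f)[(Δ.mirror.bdry f).length - 1 - k]'hk' =
            Δ.rev ((Δ.mirror.bdry f)[k]'hk) := by
          have := DartGraph.getElem_revWalk (K := Δ.toDartGraph) (Δ.bdry f) k (hlen ▸ hk)
          refine Eq.trans ?_ (congrArg Δ.rev this).symm
          rw [Δ.rev_rev]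
          congr 1
          omega
        rw [diskMap_conj_circlePt hk]
        have h1 := facePt_circlePt (K := Δ.toCombComplex) f _ hk' (unitInterval.symm t)
        rw [← hlen] at h1
        exact congrArg π (h1.trans ((congrArg (fun d => Δ.edgePt d (unitInterval.symm t)) e).trans
          (edgePt_rev (K := Δ.toCombComplex) _ t))))
    refine ⟨π', ⟨φ, p1, fun v => (q1 v).trans (p2 v), fun d t => (q2 d t).trans (p3 d t),
      fun f => ?_⟩, fun p => ?_⟩
    · obtain ⟨f', ρ, hρ⟩ := p4 f
      refine ⟨f', Complex.conjLIE.trans ρ, fun z => ?_⟩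
      rw [q3, hρ]; rfl
    · refine space_cases (motive := fun p => π' (m p) = π p) p (fun v => ?_) (fun d t => ?_) (fun f z => ?_)
      · rw [m1]; exact q1 v
      · rw [m2]; exact q2 d t
      · rw [m3]
        exact (q3 f _).trans (by rw [hcc])

end VanKampenDiagram

/-! ### Reparametrizations of the unit interval -/

/-- Runs through the unit interval during the first half of the time. -/
def early (t : unitInterval) : unitInterval := Set.projIcc 0 1 zero_le_one (2 * (t : ℝ))

/-- Runs from `0` to `1` during the second half of the time. -/
def late (t : unitInterval) : ℝ := max 0 (2 * (t : ℝ) - 1)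

theorem continuous_early : Continuous early := by unfold early; fun_prop

theorem continuous_late : Continuous late := by unfold late; fun_prop

theorem monotone_early : Monotone early := fun _ _ h =>
  Set.monotone_projIcc _ (mul_le_mul_of_nonneg_left h zero_le_two)

theorem monotone_late : Monotone late := fun a b h =>
  max_le_max le_rfl (by have h' : (a : ℝ) ≤ b := h
                        linarith)

@[simp] theorem early_zero : early 0 = 0 := by simp [early]

@[simp] theorem early_one : early 1 = 1 :=
  Set.projIcc_of_right_le _ (by norm_num)

@[simp] theorem late_zero : late 0 = 0 := by simp [late]

@[simp] theorem late_one : late 1 = 1 := by norm_num [late]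

theorem early_eq_one {t : unitInterval} (h : 1 / 2 ≤ (t : ℝ)) : early t = 1 :=
  Set.projIcc_of_right_le _ (by linarith)

theorem late_eq_zero {t : unitInterval} (h : (t : ℝ) ≤ 1 / 2) : late t = 0 :=
  max_eq_left (by linarith)

theorem late_nonneg (t : unitInterval) : 0 ≤ late t := le_max_left _ _

theorem late_le_one (t : unitInterval) : late t ≤ 1 :=
  max_le zero_le_one (by have := t.2.2; linarith)

namespace CombComplex

variable {K : CombComplex}

/-- Travelling along the top of a tame strip. -/
theorem tamePath_travel {y : K.V} {f : QuarterNat → QuarterNat} (hf : Monotone f)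
    (hd : K.Dominates y f) {Φ : ℝ → unitInterval → K.Space} {x z : ℝ}
    (hx : K.TamePath y (QuarterNat.widen 2 f) (Φ x))
    (h : ∀ s s' : ℝ, 0 ≤ s → s ≤ s' → s' ≤ 1 →
      K.coarseDistRat y (Φ (x + s * (z - x)) 1) ≤ K.coarseDistRat y (Φ (x + s' * (z - x)) 1) + 1) :
    K.TamePath y (QuarterNat.widen 3 f) (fun t => Φ (x + late t * (z - x)) (early t)) := by
  intro s t hst
  rcases le_total (t : ℝ) (1 / 2) with ht | ht
  · have hs : (s : ℝ) ≤ 1 / 2 := le_trans hst ht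
    simp only [late_eq_zero ht, late_eq_zero hs, zero_mul, add_zero]
    -- Both times in the first half: only the given path is seen.
    exact (hx _ _ (monotone_early hst)).trans (widen_mono hf (by norm_num) _)
  rcases le_total (s : ℝ) (1 / 2) with hs | hs
  · simp only [late_eq_zero hs, early_eq_one ht, zero_mul, add_zero]
    have h1 := hx (early s) 1 (early s).2.2
    have h2 := h 0 (late t) le_rfl (late_nonneg t) (late_le_one t)
    rw [zero_mul, add_zero] at h2
    -- The path ends its first half at `Φ x 1`, whose distance exceeds that of the later point by at
    -- most 1. Together with the shift 2 already present this gives the 3.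
    refine le_widen hf (b := (K.coarseDist y (Φ x 1)).shift 2) ?_ ?_
    · change K.coarseDistRat y _ + ((2 : ℕ) : ℚ) ≤ K.coarseDistRat y _ + ((3 : ℕ) : ℚ)
      push_cast
      linarith
    · have h3 : (K.coarseDist y (Φ x (early s))).1 ≤
        (f ((K.coarseDist y (Φ x 1)).shift 2)).1 + (2 : ℕ) := h1
      push_cast at h3 ⊢
      linarith
  · simp only [early_eq_one ht, early_eq_one hs]
    have h2 := h (late s) (late t) (late_nonneg s) (monotone_late hst) (late_le_one t)
    refine le_widen hf (b := K.coarseDist y (Φ (x + late t * (z - x)) 1))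
      (by push_cast; linarith) ?_
    -- Both times in the second half: error 1 from the near monotonicity and 2 from domination.
    have h3 := hd (Φ (x + late t * (z - x)) 1)
    change K.coarseDistRat y _ ≤ _
    push_cast
    linarith

theorem walkPt_mem_union (u : K.V) (l : List K.D) (x : ℝ) :
    K.walkPt u l x ∈ {K.vert u} ∪ ⋃ d ∈ l, K.closedEdge d := by
  induction l generalizing u x with
  | nil => exact Or.inl rfl
  | cons d l ih =>
    rw [walkPt]
    split_ifs
    · exact Or.inr (Set.mem_iUnion₂.2 ⟨d, by simp, edgePt_mem_closedEdge _ _⟩)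
    · rcases ih (K.term d) (x - 1) with h | h
      · rw [h]
        exact Or.inr (Set.mem_iUnion₂.2 ⟨d, by simp, mem_closedEdge_vert.2 (Or.inr rfl)⟩)
      · obtain ⟨e, he, h⟩ := Set.mem_iUnion₂.1 h
        exact Or.inr (Set.mem_iUnion₂.2 ⟨e, by simp [he], h⟩)

end CombComplex

/-! ### Geodesic words -/

namespace SymmPresentation

open CombComplex

variable {G : Type*} [Group G] (P : SymmPresentation G)

/-- A word of minimal length among those representing the same element. -/
def IsGeodesicWord (w : List P.A) : Prop :=
  w.length = P.cayleyComplex.dist P.origin (P.cvert (P.eval w))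

variable {P}

/-- A shorter word for a prefix, followed by the remaining letters, would shorten the whole word. -/
theorem IsGeodesicWord.dist_take {w : List P.A} (hw : P.IsGeodesicWord w) {k : ℕ}
    (hk : k ≤ w.length) :
    P.cayleyComplex.dist P.origin (P.cvert (P.eval (w.take k))) = k := by
  refine le_antisymm ?_ ?_
  · refine (P.dist_eval_le _).trans ?_
    simp
  · obtain ⟨v, hv, hlen⟩ := P.exists_geodesic (P.eval (w.take k))
    have h1 : P.eval (v ++ w.drop k) = P.eval w := by
      rw [P.eval_append, hv, ← P.eval_append, List.take_append_drop]
    have h2 := P.dist_eval_le (v ++ w.drop k)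
    rw [h1, ← hw] at h2
    simp at h2
    omega

theorem IsGeodesicWord.isSimpleWord {w : List P.A} (hw : P.IsGeodesicWord w) :
    P.IsSimpleWord w := by
  intro i j hij hj h
  have h1 := hw.dist_take (hij.le.trans hj)
  have h2 := hw.dist_take hj
  rw [h] at h1
  omega

/-- The vertices of a geodesic lie at distances 0, 1, 2, …, so the coarse distance is k at the k-th
vertex and k + 1/2 on the following open edge. The mean of floor and ceiling writes both cases as
one monotone expression. -/
theorem IsGeodesicWord.coarseDistRat_walkPt {w : List P.A} (hw : P.IsGeodesicWord w) {x : ℝ}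
    (h0 : 0 ≤ x) (h1 : x ≤ w.length) :
    P.cayleyComplex.coarseDistRat P.origin (P.cayleyComplex.walkPt P.origin (P.cpath 1 w) x) =
      (⌊x⌋₊ + ⌈x⌉₊) / 2 := by
  have hwalk := P.isWalk_cpath_one w
  have hvert : ∀ k, k ≤ w.length → P.cayleyComplex.coarseDistRat P.origin
      (P.cayleyComplex.walkPt P.origin (P.cpath 1 w) k) = k := by
    intro k hk
    rw [walkPt_nat hwalk k (by simpa using hk), coarseDistRat_vert]
    have := P.walkVert_cpath 1 w k hk
    rw [one_mul] at this
    have h2 : P.cayleyComplex.walkVert P.origin (P.cpath 1 w) k = P.cvert (P.eval (w.take k)) := this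
    rw [h2, hw.dist_take hk]
  by_cases hx : x = ⌊x⌋₊
  · have hk : ⌊x⌋₊ ≤ w.length := by
      rw [hx] at h1; exact_mod_cast h1
    have := hvert _ hk
    rw [← hx] at this
    have hc : ⌈x⌉₊ = ⌊x⌋₊ := by conv_lhs => rw [hx, Nat.ceil_natCast]
    rw [this, hc]; ring
  · have hlt : (⌊x⌋₊ : ℝ) < x := lt_of_le_of_ne (Nat.floor_le h0) (Ne.symm hx)
    have hlt' := Nat.lt_floor_add_one x
    have hc : ⌈x⌉₊ = ⌊x⌋₊ + 1 := by
      rw [Nat.ceil_eq_iff (by omega)]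
      constructor
      · simpa using hlt
      · push_cast; exact hlt'.le
    have hk : ⌊x⌋₊ < w.length := by
      have : (⌊x⌋₊ : ℝ) < w.length := lt_of_lt_of_le hlt h1
      exact_mod_cast this
    have ht : x - ⌊x⌋₊ ∈ unitInterval := ⟨by linarith, by linarith⟩
    have hk' : ⌊x⌋₊ < (P.cpath 1 w).length := by simpa using hk
    have e := walkPt_edge hwalk ⌊x⌋₊ hk' ⟨_, ht⟩
    simp only [add_sub_cancel] at e
    rw [e, coarseDistRat_edgePt _ _ (fun h => by
        have h' : x - ⌊x⌋₊ = 0 := congrArg Subtype.val h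
        linarith) (fun h => by
        have h' : x - ⌊x⌋₊ = 1 := congrArg Subtype.val h
        linarith), edgeDist]
    have e1 := hvert ⌊x⌋₊ hk.le
    have e2 := hvert (⌊x⌋₊ + 1) hk
    rw [walkPt_nat hwalk _ hk'.le, coarseDistRat_vert, ← hwalk.init_getElem _ hk'] at e1
    rw [walkPt_nat hwalk _ hk', coarseDistRat_vert, ← hwalk.term_getElem' _ hk'] at e2
    have e1' := Nat.cast_injective e1
    have e2' := Nat.cast_injective e2
    rw [e1', e2', hc, min_eq_left (by omega)]
    push_cast; ring

theorem IsGeodesicWord.coarseDistRat_mono {w : List P.A} (hw : P.IsGeodesicWord w) {x x' : ℝ}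
    (h : x ≤ x') :
    P.cayleyComplex.coarseDistRat P.origin (P.cayleyComplex.walkPt P.origin (P.cpath 1 w) x) ≤
    P.cayleyComplex.coarseDistRat P.origin (P.cayleyComplex.walkPt P.origin (P.cpath 1 w) x') := by
  have hwalk := P.isWalk_cpath_one w
  rw [walkPt_clamp hwalk x, walkPt_clamp hwalk x', length_cpath]
  have hmono : max 0 (min x (w.length : ℝ)) ≤ max 0 (min x' (w.length : ℝ)) :=
    max_le_max le_rfl (min_le_min h le_rfl)
  have hb : ∀ z : ℝ, max 0 (min z (w.length : ℝ)) ≤ w.length := fun z =>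
    max_le (by positivity) (min_le_right _ _)
  rw [hw.coarseDistRat_walkPt (le_max_left _ _) (hb _),
    hw.coarseDistRat_walkPt (le_max_left _ _) (hb _)]
  have h1 : (⌊max 0 (min x (w.length : ℝ))⌋₊ : ℚ) ≤ ⌊max 0 (min x' (w.length : ℝ))⌋₊ := by
    exact_mod_cast Nat.floor_mono hmono
  have h2 : (⌈max 0 (min x (w.length : ℝ))⌉₊ : ℚ) ≤ ⌈max 0 (min x' (w.length : ℝ))⌉₊ := by
    exact_mod_cast Nat.ceil_mono hmono
  linarith

/-- The coarse distance along the boundary of a geodesic triangle with one edge as a side. -/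
theorem coarseDistRat_triangle {v v' : List P.A} {a : P.A} (hv : P.IsGeodesicWord v)
    (hv' : P.IsGeodesicWord v') (he : P.eval v * P.rep a = P.eval v') {τ : ℝ} (hτ0 : 0 ≤ τ)
    (hτ1 : τ ≤ 1) {x s s' : ℝ} (hss : s ≤ s') (hs' : s' ≤ 1) :
    P.cayleyComplex.coarseDistRat P.origin (P.cayleyComplex.walkPt P.origin
      (P.cpath 1 (v ++ a :: invWord P.inv v')) (x + s * (v.length + τ - x))) ≤
    P.cayleyComplex.coarseDistRat P.origin (P.cayleyComplex.walkPt P.origin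
      (P.cpath 1 (v ++ a :: invWord P.inv v')) (x + s' * (v.length + τ - x))) + 1 := by
  set W := P.cpath 1 (v ++ a :: invWord P.inv v') with hW
  set k : ℝ := (v.length : ℝ) with hk
  have hwalk : P.cayleyComplex.IsWalk W P.origin P.origin := by
    have := P.isWalk_cpath_one (v ++ a :: invWord P.inv v')
    rw [show P.eval (v ++ a :: invWord P.inv v') = 1 by
      rw [eval_append, eval_cons, eval_invWord, ← he, ← mul_assoc, mul_inv_cancel]] at this
    exact this
  have hW1 : W = P.cpath 1 v ++ P.cdart (P.eval v) a ::
      P.cpath (P.eval v') (invWord P.inv v') := by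
    rw [hW, cpath_append, cpath_cons, one_mul, he]
  have hrev : P.cayleyComplex.revWalk W = P.cpath 1 v' ++
      P.cayleyComplex.revWalk (P.cpath 1 v ++ [P.cdart (P.eval v) a]) := by
    have h1 : P.cayleyComplex.revWalk (P.cpath (P.eval v') (invWord P.inv v')) = P.cpath 1 v' := by
      rw [revWalk_cpath, invWord_invWord, eval_invWord, mul_inv_cancel]
    have h2 : W = (P.cpath 1 v ++ [P.cdart (P.eval v) a]) ++
      P.cpath (P.eval v') (invWord P.inv v') := by rw [hW1]; simp
    rw [h2, DartGraph.revWalk_append, h1]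
  have hleft : ∀ z ≤ k, P.cayleyComplex.walkPt P.origin W z =
      P.cayleyComplex.walkPt P.origin (P.cpath 1 v) z := by
    intro z hz
    rw [hW1]
    exact walkPt_append_left (hW1 ▸ hwalk) (by simpa using hz)
  have hlen : (W.length : ℝ) = k + 1 + v'.length := by
    rw [hW]; simp; ring
  have hright : ∀ z, k + 1 ≤ z → P.cayleyComplex.walkPt P.origin W z =
      P.cayleyComplex.walkPt P.origin (P.cpath 1 v') (k + 1 + v'.length - z) := by
    intro z hz
    have h1 := walkPt_revWalk hwalk (k + 1 + v'.length - z)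
    rw [hlen, sub_sub_cancel] at h1
    have h2 := hwalk.revWalk
    rw [hrev] at h2
    rw [← h1, hrev]
    refine walkPt_append_left h2 ?_
    rw [length_cpath]; linarith
  have hmid : ∀ z, k ≤ z → z ≤ k + 1 → P.cayleyComplex.walkPt P.origin W z ∈
      P.cayleyComplex.closedEdge (P.cdart (P.eval v) a) := by
    intro z h1 h2
    have hlt : v.length < W.length := by rw [hW1]; simp
    have := walkPt_edge hwalk v.length hlt ⟨z - k, by linarith, by linarith⟩
    simp only [← hk, add_sub_cancel] at this
    rw [this]
    have e : W[v.length] = P.cdart (P.eval v) a := by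
      simp only [hW1]
      rw [List.getElem_append_right (by simp)]
      simp
    rw [e]
    exact edgePt_mem_closedEdge _ _
  have hedge := fun {p q} => @coarseDistRat_edge_le P.cayleyComplex P.origin P.connectedFrom_origin
    (P.cdart (P.eval v) a) p q
  set z := x + s * (k + τ - x) with hz
  set z' := x + s' * (k + τ - x) with hz'
  -- Before the edge the motion goes away from the origin along the first geodesic; beyond the edge
  -- it runs the boundary backwards, again away from the origin along the second geodesic. Only the
  -- part on the middle edge can lose distance, and at most 1.
  rcases le_total x (k + τ) with hcase | hcase
  · have h1 : z ≤ z' := by rw [hz, hz']; nlinarith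
    have h2 : z' ≤ k + τ := by rw [hz']; nlinarith
    rcases le_total z' k with h3 | h3
    · rw [hleft z (h1.trans h3), hleft z' h3]
      linarith [hv.coarseDistRat_mono h1]
    rcases le_total z k with h4 | h4
    · have h5 := hedge (hmid k le_rfl (by linarith)) (hmid z' h3 (by linarith))
      have h6 := hv.coarseDistRat_mono h4
      rw [← hleft z h4, ← hleft k le_rfl] at h6
      linarith
    · exact hedge (hmid z h4 (by linarith)) (hmid z' h3 (by linarith))
  · have h1 : z' ≤ z := by rw [hz, hz']; nlinarith
    have h2 : k + τ ≤ z' := by rw [hz']; nlinarith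
    rcases le_total (k + 1) z' with h3 | h3
    · rw [hright z (h3.trans h1), hright z' h3]
      linarith [hv'.coarseDistRat_mono (show k + 1 + v'.length - z ≤ k + 1 + v'.length - z' by linarith)]
    rcases le_total (k + 1) z with h4 | h4
    · have h5 := hedge (hmid (k + 1) (by linarith) le_rfl) (hmid z' (by linarith) h3)
      have h6 := hv'.coarseDistRat_mono (show k + 1 + v'.length - z ≤ k + 1 + v'.length - (k + 1) by linarith)
      rw [← hright z h4, ← hright (k + 1) le_rfl] at h6
      linarith
    · exact hedge (hmid z (by linarith) h4) (hmid z' (by linarith) h3)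

end SymmPresentation

/-! ### Tame combings from tame fillings -/

namespace VanKampenDiagram

open CombComplex

variable {G : Type*} [Group G] {P : SymmPresentation G} {w : List P.A}

/-- A parametrized family of paths to the points of the boundary edge `d`, where the paths to the
endpoints follow the two parts `l₁` and `l₂` of the boundary during the second half of the time. -/
structure IsEdgeFamily (Δ : VanKampenDiagram P w) (l₁ : List Δ.D) (d : Δ.D) (l₂ : List Δ.D)
    (Θ : unitInterval → unitInterval → Δ.Space) : Prop where
  boundary_eq : Δ.boundary = l₁ ++ d :: l₂
  continuous : Continuous fun q : unitInterval × unitInterval => Θ q.1 q.2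
  start : ∀ τ, Θ τ 0 = Δ.vert Δ.base
  finish : ∀ τ, Θ τ 1 = Δ.edgePt d τ
  init : ∀ t, Θ 0 t = Δ.walkPt Δ.base l₁ (late t * l₁.length)
  term : ∀ t, Θ 1 t = Δ.walkPt Δ.base (Δ.revWalk l₂) (late t * l₂.length)

variable {Δ : VanKampenDiagram P w} {l₁ l₂ : List Δ.D} {d : Δ.D}

theorem walk_left (h : Δ.boundary = l₁ ++ d :: l₂) : Δ.IsWalk l₁ Δ.base (Δ.init d) := by
  have := Δ.boundary_walk
  rw [h] at this
  obtain ⟨x, h1, rfl, h3⟩ := DartGraph.isWalk_append.1 this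
  exact h1

theorem walk_right (h : Δ.boundary = l₁ ++ d :: l₂) : Δ.IsWalk l₂ (Δ.term d) Δ.base := by
  have := Δ.boundary_walk
  rw [h] at this
  obtain ⟨x, h1, h2, h3⟩ := DartGraph.isWalk_append.1 this
  exact h3

/-- Needed because only one orientation of each Cayley edge carries the chosen family, whereas a
diagrammatic combing asks for a diagram for both. -/
theorem IsEdgeFamily.mirror {Θ : unitInterval → unitInterval → Δ.Space}
    (h : Δ.IsEdgeFamily l₁ d l₂ Θ) {m : Δ.Space → Δ.mirror.Space} (hm : Continuous m)
    (hv : ∀ v, m (Δ.vert v) = Δ.mirror.vert v)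
    (he : ∀ d t, m (Δ.edgePt d t) = Δ.mirror.edgePt d t) :
    Δ.mirror.IsEdgeFamily (Δ.revWalk l₂) (Δ.rev d) (Δ.revWalk l₁)
      (fun τ t => m (Θ (unitInterval.symm τ) t)) where
  boundary_eq := by
    change Δ.revWalk Δ.boundary = Δ.revWalk l₂ ++ Δ.rev d :: Δ.revWalk l₁
    rw [h.boundary_eq]; simp
  continuous := by
    have hs : Continuous fun q : unitInterval × unitInterval => (unitInterval.symm q.1, q.2) := by
      fun_prop
    exact hm.comp (h.continuous.comp hs)
  start τ := by rw [h.start, hv]; rfl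
  finish τ := by
    rw [h.finish, he]
    exact (edgePt_rev' (K := Δ.mirror.toCombComplex) d τ).symm
  init t := by
    have e : ((Δ.revWalk l₂).length : ℝ) = l₂.length := by simp
    rw [unitInterval.symm_zero, h.term]
    refine (map_walkPt (K := Δ.toCombComplex) (K' := Δ.mirror.toCombComplex) (m := m)
      (jv := fun v => v) (jd := fun d => d) hv he _ _ _).trans ?_
    refine (congrArg (fun l => Δ.mirror.walkPt Δ.base l _) (List.map_id' (Δ.revWalk l₂))).trans ?_
    exact congrArg (fun z => Δ.mirror.walkPt Δ.base (Δ.revWalk l₂) (late t * z)) e.symm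
  term t := by
    have e : ((Δ.revWalk l₁).length : ℝ) = l₁.length := by simp
    have h1 : Δ.revWalk (Δ.revWalk l₁) = l₁ := DartGraph.revWalk_revWalk l₁
    rw [unitInterval.symm_one, h.init]
    refine (map_walkPt (K := Δ.toCombComplex) (K' := Δ.mirror.toCombComplex) (m := m)
      (jv := fun v => v) (jd := fun d => d) hv he _ _ _).trans ?_
    refine (congrArg (fun l => Δ.mirror.walkPt Δ.base l _) ((List.map_id' l₁).trans h1.symm)).trans ?_
    exact congrArg (fun z => Δ.mirror.walkPt Δ.base (Δ.revWalk (Δ.revWalk l₁)) (late t * z)) e.symm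

/-- Descends from the parameter of the edge to its points. A combing must be constant over the
basepoint, which is why an endpoint of `d` equal to the basepoint has to come with an empty boundary
part. -/
theorem IsEdgeFamily.exists_edgeOneCombing {Θ : unitInterval → unitInterval → Δ.Space}
    (h : Δ.IsEdgeFamily l₁ d l₂ Θ) (hd : Δ.init d ≠ Δ.term d) (h1 : Δ.init d = Δ.base → l₁ = [])
    (h2 : Δ.term d = Δ.base → l₂ = []) :
    ∃ θ : Δ.closedEdge d → unitInterval → Δ.Space, Δ.IsEdgeOneCombing l₁ d l₂ θ ∧
      ∀ τ (p : Δ.closedEdge d), (p : Δ.Space) = Δ.edgePt d τ → θ p = Θ τ := by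
  have he := isClosedEmbedding_edgePt hd
  let e : unitInterval ≃ₜ Δ.closedEdge d := he.isEmbedding.toHomeomorph
  let θ : Δ.closedEdge d → unitInterval → Δ.Space := fun p => Θ (e.symm p)
  have hθ : ∀ τ (p : Δ.closedEdge d), (p : Δ.Space) = Δ.edgePt d τ → θ p = Θ τ := by
    intro τ p hp
    have : p = e τ := Subtype.ext hp
    simp only [θ]
    rw [this, e.symm_apply_apply]
  have hvert : ∀ (p : Δ.closedEdge d) (v : Δ.V), (p : Δ.Space) = Δ.vert v →
      (v = Δ.init d ∧ θ p = Θ 0) ∨ (v = Δ.term d ∧ θ p = Θ 1) := by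
    intro p v hp
    obtain ⟨τ, hτ⟩ := p.2
    rw [hθ τ p hτ.symm]
    rw [← hτ] at hp
    rcases edgePt_eq_vert_iff.1 hp with ⟨rfl, rfl⟩ | ⟨rfl, rfl⟩
    · exact Or.inl ⟨rfl, rfl⟩
    · exact Or.inr ⟨rfl, rfl⟩
  have hw1 := walk_left h.boundary_eq
  have hw2 := (walk_right h.boundary_eq).revWalk
  have hf : ∀ l : List Δ.D, ∀ v, Δ.IsWalk l Δ.base v → ∀ γ : unitInterval → Δ.Space,
      (∀ t, γ t = Δ.walkPt Δ.base l (late t * l.length)) → Δ.Follows Δ.base l γ := by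
    intro l v hl γ hγ
    refine follows_walkPt hl (continuous_late.mul continuous_const) ?_ (by simp) (by simp) hγ
    exact fun a b hab => mul_le_mul_of_nonneg_right (monotone_late hab) (by positivity)
  refine ⟨θ, ⟨h.boundary_eq, ⟨?_, ?_, ?_, ?_, ?_⟩, ?_, ?_⟩, hθ⟩
  · have : Continuous fun q : Δ.closedEdge d × unitInterval => (e.symm q.1, q.2) := by fun_prop
    exact h.continuous.comp this
  · intro p; exact h.start _
  · intro p
    obtain ⟨τ, hτ⟩ := p.2
    rw [hθ τ p hτ.symm, h.finish, hτ]
  · intro p hp t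
    rcases hvert p _ hp with ⟨hv, hp⟩ | ⟨hv, hp⟩
    · rw [hp, h.init, h1 hv.symm]; rfl
    · rw [hp, h.term, h2 hv.symm]; rfl
  · rintro p ⟨v, hv⟩ t
    rcases hvert p _ hv.symm with ⟨-, hp⟩ | ⟨-, hp⟩
    · rw [hp, h.init]; exact walkPt_mem_oneSkeleton _ _ _
    · rw [hp, h.term]; exact walkPt_mem_oneSkeleton _ _ _
  · intro p hp
    rcases hvert p _ hp with ⟨-, hp⟩ | ⟨hv, -⟩
    · exact hf l₁ _ hw1 _ fun t => by rw [hp, h.init]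
    · exact absurd hv hd
  · intro p hp
    rcases hvert p _ hp with ⟨hv, -⟩ | ⟨-, hp⟩
    · exact absurd hv.symm hd
    · exact hf _ _ hw2 _ fun t => by rw [hp, h.term, DartGraph.length_revWalk]

end VanKampenDiagram

namespace SymmPresentation

open CombComplex VanKampenDiagram

variable {G : Type*} [Group G] {P : SymmPresentation G}

/-- For a word `u` of `v`, any filling of `u` followed by its inverse has a boundary vertex over
`v`, and the tame combing path to it projects to a path in the 1-skeleton that ends at `v`. -/
theorem IsExtrinsicTameFilling.dominates {f : QuarterNat → QuarterNat}
    (h : P.IsExtrinsicTameFilling f) : P.cayleyComplex.Dominates P.origin f := by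
  obtain ⟨hf, h⟩ := h
  refine dominates_of_vertices hf fun v => ?_
  obtain ⟨u, rfl⟩ := P.exists_word v
  obtain ⟨Δ, ψ, π, hψ, hπ, ht⟩ := h (u ++ invWord P.inv u) (by simp)
  obtain ⟨φ, hφ⟩ := hπ.exists_labelling
  have hmem : Δ.walkPt Δ.base Δ.boundary u.length ∈ Δ.boundarySet := by
    have := walkPt_mem_union (K := Δ.toCombComplex) Δ.base Δ.boundary u.length
    exact this
  have hlen : u.length ≤ Δ.boundary.length := by rw [Δ.boundary_length]; simp
  have hp := walkPt_nat Δ.boundary_walk u.length hlen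
  have hφv : φ (Δ.walkVert Δ.base Δ.boundary u.length) = P.eval u := by
    rw [hφ.walkVert Δ.boundary_walk _ hlen, hφ.base, Δ.boundary_label]
    simp
  refine dist_le_of_tame (γ := fun t => π (ψ ⟨_, hmem⟩ t)) P.connectedFrom_origin ?_ ?_ ?_
    fun s t hst => ht _ s t hst
  · have : Continuous fun t : unitInterval => ((⟨_, hmem⟩ : Δ.boundarySet), t) := by fun_prop
    exact hπ.continuous.comp (hψ.continuous.comp this)
  · simp only [hψ.finish]
    rw [hp, hφ.vert, hφv]; rfl
  · intro t
    have := hψ.vertex ⟨_, hmem⟩ ⟨_, hp.symm⟩ t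
    rcases this with ⟨x, hx⟩ | hx
    · rw [← hx, hφ.vert]; exact vert_mem_oneSkeleton _
    · obtain ⟨e, τ, hx⟩ := Set.mem_iUnion.1 hx
      rw [← hx, hφ.edge]; exact edgePt_mem_oneSkeleton _ _

/-- A filling yields a tame family of paths to the points of an edge. -/
theorem IsExtrinsicTameFilling.exists_edgeFamily {f : QuarterNat → QuarterNat}
    (h : P.IsExtrinsicTameFilling f) {v v' : List P.A} {a : P.A} (hv : P.IsGeodesicWord v)
    (hv' : P.IsGeodesicWord v') (he : P.eval v * P.rep a = P.eval v') :
    ∃ (Δ : VanKampenDiagram P (v ++ a :: invWord P.inv v')) (l₁ : List Δ.D) (d : Δ.D)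
      (l₂ : List Δ.D) (Θ : unitInterval → unitInterval → Δ.Space)
      (π : Δ.Space → P.cayleyComplex.Space), l₁.map Δ.label = v ∧ Δ.label d = a ∧
      l₂.map Δ.label = invWord P.inv v' ∧ Δ.IsEdgeFamily l₁ d l₂ Θ ∧ Δ.IsProjection π ∧
      ∀ τ, P.cayleyComplex.TamePath P.origin (QuarterNat.widen 3 f) (fun t => π (Θ τ t)) := by
  have hdom := h.dominates
  obtain ⟨hf, h⟩ := h
  obtain ⟨Δ, ψ, π, hψ, hπ, ht⟩ := h (v ++ a :: invWord P.inv v') (by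
    rw [eval_append, eval_cons, eval_invWord, ← he]; group)
  obtain ⟨φ, hφ⟩ := hπ.exists_labelling
  obtain ⟨l₁, l', hb, hl1, hl'⟩ := List.map_eq_append_iff.1 Δ.boundary_label
  obtain ⟨d, l₂, rfl, hd, hl2⟩ := List.map_eq_cons_iff.1 hl'
  have hlen1 : l₁.length = v.length := by simpa using congrArg List.length hl1
  have hlen2 : l₂.length = v'.length := by simpa using congrArg List.length hl2
  have hlen : (Δ.boundary.length : ℝ) = v.length + 1 + v'.length := by
    rw [hb]; simp [hlen1, hlen2]; ring
  have hw := Δ.boundary_walk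
  have hmem : ∀ x : ℝ, Δ.walkPt Δ.base Δ.boundary x ∈ Δ.boundarySet := fun x =>
    walkPt_mem_union (K := Δ.toCombComplex) Δ.base Δ.boundary x
  let Φ : ℝ → unitInterval → Δ.Space := fun x t => ψ ⟨_, hmem x⟩ t
  have hΦ1 : ∀ x, Φ x 1 = Δ.walkPt Δ.base Δ.boundary x := fun x => hψ.finish _
  have hΦb : ∀ x, Δ.walkPt Δ.base Δ.boundary x = Δ.vert Δ.base → ∀ t, Φ x t = Δ.vert Δ.base :=
    fun x hx => hψ.base ⟨_, hmem x⟩ hx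
  have hΦc : Continuous fun q : ℝ × unitInterval => Φ q.1 q.2 := by
    have : Continuous fun q : ℝ × unitInterval =>
        ((⟨Δ.walkPt Δ.base Δ.boundary q.1, hmem q.1⟩ : Δ.boundarySet), q.2) :=
      (Continuous.subtype_mk ((continuous_walkPt hw).comp continuous_fst) _).prodMk continuous_snd
    exact hψ.continuous.comp this
  have hk0 : (0 : ℝ) ≤ v.length := by positivity
  have hk0' : (0 : ℝ) ≤ v'.length := by positivity
  let N : ℝ := v.length + 1 + v'.length
  -- First the combing path to the boundary point `τ * N`, then a slide along the boundary to the
  -- point τ of the edge `d`, whose boundary parameter is `v.length + τ`. At τ = 0 and τ = 1 the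
  -- first half is constant, since 0 and `N` are both the basepoint.
  let Θ : unitInterval → unitInterval → Δ.Space := fun τ t =>
    Φ (τ * N + late t * (v.length + τ - τ * N)) (early t)
  refine ⟨Δ, l₁, d, l₂, Θ, π, hl1, hd, hl2, ⟨hb, ?_, ?_, ?_, ?_, ?_⟩, hπ, ?_⟩
  · have : Continuous fun q : unitInterval × unitInterval =>
        ((q.1 : ℝ) * N + late q.2 * (v.length + q.1 - q.1 * N), early q.2) := by
      have := continuous_late
      have := continuous_early
      fun_prop
    exact hΦc.comp this
  · intro τ
    simp only [Θ, early_zero]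
    exact hψ.start _
  · intro τ
    simp only [Θ, early_one, late_one, hΦ1]
    have hlt : l₁.length < Δ.boundary.length := by rw [hb]; simp
    have := walkPt_edge hw l₁.length hlt τ
    have e : Δ.boundary[l₁.length] = d := by
      simp only [hb]
      rw [List.getElem_append_right (by simp)]; simp
    rw [e] at this
    rw [← this, hlen1]
    congr 1; ring
  · intro t
    simp only [Θ, Set.Icc.coe_zero, zero_mul, zero_add, add_zero, sub_zero, hlen1]
    rcases le_total (t : ℝ) (1 / 2) with h | h
    · rw [late_eq_zero h, zero_mul, hΦb 0 (walkPt_of_nonpos hw le_rfl),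
        walkPt_of_nonpos (walk_left hb) le_rfl]
    · have hw' : Δ.IsWalk (l₁ ++ d :: l₂) Δ.base Δ.base := hb ▸ hw
      rw [early_eq_one h, hΦ1]
      simp only [hb]
      refine walkPt_append_left hw' ?_
      rw [hlen1]
      nlinarith [late_le_one t]
  · intro t
    simp only [Θ, Set.Icc.coe_one, one_mul, hlen2]
    rcases le_total (t : ℝ) (1 / 2) with h | h
    · rw [late_eq_zero h, zero_mul, zero_mul, add_zero,
        hΦb N (walkPt_of_ge hw hlen.le), walkPt_of_nonpos (walk_right hb).revWalk le_rfl]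
    · rw [early_eq_one h, hΦ1]
      have h1 := walkPt_revWalk hw (late t * v'.length)
      rw [hlen] at h1
      have h2 : N + late t * (v.length + 1 - N) =
        v.length + 1 + v'.length - late t * v'.length := by simp only [N]; ring
      rw [h2, ← h1]
      have h3 : Δ.revWalk Δ.boundary = Δ.revWalk l₂ ++ Δ.revWalk (l₁ ++ [d]) := by
        rw [hb, ← DartGraph.revWalk_append]; simp
      have hw' : Δ.IsWalk (Δ.revWalk l₂ ++ Δ.revWalk (l₁ ++ [d])) Δ.base Δ.base := h3 ▸ hw.revWalk
      rw [h3]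
      refine walkPt_append_left hw' ?_
      rw [DartGraph.length_revWalk, hlen2]
      nlinarith [late_le_one t]
  · intro τ
    refine tamePath_travel (Φ := fun x t => π (Φ x t)) (x := τ * N) (z := v.length + τ) hf hdom
      (hdom.tamePath hf fun s t hst => ht _ s t hst) ?_
    intro s s' hs hss hs'
    simp only [hΦ1]
    rw [hφ.walkPt_base hw, hφ.walkPt_base hw, Δ.boundary_label]
    exact coarseDistRat_triangle hv hv' he τ.2.1 τ.2.2 hss hs'

/-- Tame combing functions from extrinsic tame filling functions. -/
theorem IsExtrinsicTameFilling.isTameCombing {f : QuarterNat → QuarterNat}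
    (h : P.IsExtrinsicTameFilling f) : P.IsTameCombing (QuarterNat.widen 3 f) := by
  refine ⟨QuarterNat.widen_monotone h.1 3, ?_⟩
  -- Geodesic words are simple, represent the identity by the empty word, and make sliding along
  -- them monotone in coarse distance.
  choose word hword1 hword2 using P.exists_geodesic
  have hgeo : ∀ g, P.IsGeodesicWord (word g) := fun g => by
    rw [IsGeodesicWord, hword1, hword2]
  have hone : word 1 = [] := by
    have := hword2 1
    rw [show P.cvert 1 = P.origin from rfl, CombComplex.dist_self] at this
    exact List.length_eq_zero_iff.1 this
  have hnil : ∀ g : G, g = 1 → word g = [] := fun g hg => by rw [hg, hone]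
  have key := fun (u : G) (a : P.A) => h.exists_edgeFamily (v := word u) (v' := word (u * P.rep a))
    (a := a) (hgeo _) (hgeo _) (by rw [hword1, hword1])
  choose Δ l₁ d l₂ Θ π hl1 hd hl2 hΘ hπ htame using key
  choose φ hφ using fun u a => (hπ u a).exists_labelling
  have hinit : ∀ u a, φ u a ((Δ u a).init (d u a)) = u := by
    intro u a
    rw [(hφ u a).walk_end (walk_left (hΘ u a).boundary_eq), (hφ u a).base, hl1, hword1, one_mul]
  have hterm : ∀ u a, φ u a ((Δ u a).term (d u a)) = u * P.rep a := by
    intro u a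
    rw [(hφ u a).term, hinit, hd]
  let X := P.cayleyComplex
  let c : X.V → unitInterval → X.Space := fun v t =>
    X.walkPt P.origin (P.cpath 1 (word v)) (late t * (word v).length)
  have hΘ0 : ∀ u a t, π u a (Θ u a 0 t) = c (P.cvert u) t := by
    intro u a t
    have hlen : (l₁ u a).length = (word u).length := by simpa using congrArg List.length (hl1 u a)
    rw [(hΘ u a).init, (hφ u a).walkPt_base (walk_left (hΘ u a).boundary_eq), hl1, hlen]
    rfl
  have hΘ1 : ∀ u a t, π u a (Θ u a 1 t) = c (P.cvert (u * P.rep a)) t := by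
    intro u a t
    have hlen : (l₂ u a).length = (word (u * P.rep a)).length := by
      simpa using congrArg List.length (hl2 u a)
    rw [(hΘ u a).term, (hφ u a).walkPt_base (walk_right (hΘ u a).boundary_eq).revWalk,
      label_revWalk, hl2, invWord_invWord, hlen]
    rfl
  have hcwalk : ∀ v, X.IsWalk (P.cpath 1 (word v)) P.origin (P.cvert v) := fun v => by
    have := P.isWalk_cpath_one (word v)
    rwa [hword1] at this
  have : Nonempty X.Space := ⟨X.vert P.origin⟩
  -- Over the ends of each edge the projected family is `c`, which depends on the vertex only, so
  -- the families fit together. The Cayley graph is locally finite because the alphabet is finite.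
  obtain ⟨Υ, hΥv, hΥe, hΥc⟩ := exists_edgewise (K := X) P.init_ne_term Set.univ
    (fun p => (finite_closedEdge_mem P.finite_init p).subset fun d hd => hd.2) c
    (fun v => (continuous_walkPt (hcwalk v)).comp (continuous_late.mul continuous_const))
    (fun d τ t => π d.1 d.2 (Θ d.1 d.2 τ t))
    (fun d _ => (hπ _ _).continuous.comp (hΘ _ _).continuous)
    (fun d _ t => hΘ0 d.1 d.2 t) (fun d _ t => hΘ1 d.1 d.2 t)
  have hΥe' : ∀ dd : X.D, ∃ u a, (dd = P.cdart u a ∨ dd = X.rev (P.cdart u a)) ∧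
      ∀ τ, Υ (X.edgePt (P.cdart u a) τ) = fun t => π u a (Θ u a τ t) := by
    intro dd
    obtain ⟨d', -, h1, h2⟩ := hΥe dd trivial
    obtain ⟨u, a, rfl⟩ := P.exists_cdart d'
    refine ⟨u, a, ?_, h2⟩
    rcases h1 with h1 | h1
    · exact Or.inl h1.symm
    · exact Or.inr (by rw [h1, X.rev_rev])
  have hcases : ∀ p ∈ X.oneSkeleton, (∃ v, p = X.vert v) ∨
      ∃ u a τ, p = X.edgePt (P.cdart u a) τ ∧
        ∀ τ, Υ (X.edgePt (P.cdart u a) τ) = fun t => π u a (Θ u a τ t) := by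
    rintro p (⟨v, rfl⟩ | hp)
    · exact Or.inl ⟨v, rfl⟩
    · obtain ⟨dd, τ, rfl⟩ := Set.mem_iUnion.1 hp
      obtain ⟨u, a, h1, h2⟩ := hΥe' dd
      right
      rcases h1 with rfl | rfl
      · exact ⟨u, a, τ, rfl, h2⟩
      · exact ⟨u, a, _, edgePt_rev' _ _, h2⟩
  have hπe : ∀ u a τ, π u a ((Δ u a).edgePt (d u a) τ) = X.edgePt (P.cdart u a) τ := by
    intro u a τ
    rw [(hφ u a).edge, hinit, hd]
  refine ⟨fun q => Υ q, ⟨⟨?_, ?_, ?_, ?_, ?_⟩, word, fun v => ⟨(hgeo v).isSimpleWord, ?_⟩, ?_⟩, ?_⟩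
  · rw [← continuousOn_univ]
    refine hΥc.comp (f := fun q : X.oneSkeleton × unitInterval => ((q.1 : X.Space), q.2))
      (by fun_prop) ?_
    rintro ⟨⟨p, hp⟩, t⟩ -
    refine ⟨?_, trivial⟩
    rcases hp with hp | hp
    · exact Or.inl hp
    · obtain ⟨dd, hdd⟩ := Set.mem_iUnion.1 hp
      exact Or.inr (Set.mem_iUnion₂.2 ⟨dd, trivial, hdd⟩)
  · rintro ⟨p, hp⟩
    rcases hcases p hp with ⟨v, rfl⟩ | ⟨u, a, τ, rfl, hu⟩
    · refine (congrFun (hΥv v) 0).trans ?_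
      simp only [c, late_zero, zero_mul]
      exact walkPt_of_nonpos (hcwalk v) le_rfl
    · simp only [hu, (hΘ u a).start, (hφ u a).vert, (hφ u a).base]; rfl
  · rintro ⟨p, hp⟩
    rcases hcases p hp with ⟨v, rfl⟩ | ⟨u, a, τ, rfl, hu⟩
    · refine (congrFun (hΥv v) 1).trans ?_
      simp only [c, late_one, one_mul]
      exact walkPt_of_ge (hcwalk v) (by exact_mod_cast (P.length_cpath 1 (word v)).le)
    · simp only [hu, (hΘ u a).finish, hπe]
  · rintro ⟨p, hp⟩ hpb t
    simp only at hpb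
    subst hpb
    refine (congrFun (hΥv P.origin) t).trans ?_
    simp only [c]
    rw [show word P.origin = [] from hone]; rfl
  · rintro ⟨p, hp⟩ ⟨v, hv⟩ t
    simp only at hv
    subst hv
    rw [show Υ (X.vert v) t = _ from congrFun (hΥv v) t]
    exact walkPt_mem_oneSkeleton _ _ _
  · rintro ⟨p, hp⟩ hpv
    simp only at hpv
    subst hpv
    refine follows_walkPt (hcwalk v) (s := fun t => late t * (word v).length)
      (continuous_late.mul continuous_const) ?_ (by simp) ?_ ?_
    · exact fun a b hab => mul_le_mul_of_nonneg_right (monotone_late hab) (by positivity)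
    · have := P.length_cpath 1 (word v)
      simp only [late_one, one_mul]
      exact_mod_cast this.symm
    · intro t
      exact congrFun (hΥv v) t
  · intro u a
    obtain ⟨u', a', h1, h2⟩ := hΥe' (P.cdart u a)
    have hproj : ∀ τ t (q : X.oneSkeleton), (q : X.Space) = X.edgePt (P.cdart u' a') τ →
        Υ q t = π u' a' (Θ u' a' τ t) := by
      intro τ t q hq
      rw [hq, h2]
    have hne := (hφ u' a').init_ne_term (d u' a')
    -- A diagram vertex equal to the basepoint lies over the identity, whose chosen word is empty.
    have hb1 : (Δ u' a').init (d u' a') = (Δ u' a').base → l₁ u' a' = [] := by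
      intro hb
      have : u' = 1 := by rw [← hinit u' a', hb, (hφ u' a').base]
      simpa [hnil u' this] using congrArg List.length (hl1 u' a')
    have hb2 : (Δ u' a').term (d u' a') = (Δ u' a').base → l₂ u' a' = [] := by
      intro hb
      have : u' * P.rep a' = 1 := by rw [← hterm u' a', hb, (hφ u' a').base]
      simpa [hnil _ this] using congrArg List.length (hl2 u' a')
    rcases h1 with h1 | h1
    · obtain ⟨rfl, rfl⟩ := P.cdart_injective h1
      obtain ⟨θ, hθ1, hθ2⟩ := (hΘ u a).exists_edgeOneCombing hne hb1 hb2
      refine ⟨Δ u a, l₁ u a, d u a, l₂ u a, θ, π u a, ?_, hθ1, hπ u a, ?_⟩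
      · have h3 := congrArg List.length (hl1 u a)
        rwa [List.length_map] at h3
      · intro p q t hq
        obtain ⟨τ, hτ⟩ := p.2
        rw [hθ2 τ p hτ.symm]
        exact hproj τ t q (by rw [hq, ← hτ, hπe])
    · rw [rev_cdart] at h1
      obtain ⟨e1, e2⟩ := P.cdart_injective h1
      -- The family of the opposite orientation was used on this edge. Its mirror image has the
      -- inverse boundary word, which is exactly the word required here.
      have hwd : word u ++ a :: invWord P.inv (word (u * P.rep a)) =
          invWord P.inv (word u' ++ a' :: invWord P.inv (word (u' * P.rep a'))) := by
        rw [e1, e2, P.rep_inv]; simp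
      rw [hwd]
      obtain ⟨m, m1, m2, m3, m4⟩ := (Δ u' a').exists_mirrorMap
      obtain ⟨π', hπ', hπm⟩ := m4 (π u' a') (hπ u' a')
      have hfam := (hΘ u' a').mirror m1 m2 m3
      obtain ⟨θ, hθ1, hθ2⟩ := hfam.exists_edgeOneCombing
        (fun h => hne ((DartGraph.term_rev (K := (Δ u' a').toDartGraph) (d u' a')).symm.trans h.symm))
        (fun h => by rw [hb2 h]; rfl)
        (fun h => by
          rw [hb1 ((DartGraph.term_rev (K := (Δ u' a').toDartGraph) (d u' a')).symm.trans h)]; rfl)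
      refine ⟨_, _, _, _, θ, π', ?_, hθ1, hπ', ?_⟩
      · refine (DartGraph.length_revWalk (K := (Δ u' a').toDartGraph) (l₂ u' a')).trans ?_
        have h3 : (l₂ u' a').length = (word (u' * P.rep a')).length := by
          simpa using congrArg List.length (hl2 u' a')
        rw [h3, ← e1]
      · intro p q t hq
        obtain ⟨τ, hτ⟩ := p.2
        rw [hθ2 τ p hτ.symm]
        simp only [hπm]
        refine hproj _ t q ?_
        rw [hq, ← hτ, ← hπe, ← hπm, m3]
        exact congrArg π' (edgePt_rev' (K := (Δ u' a').mirror.toCombComplex) (d u' a') τ)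
  · rintro ⟨p, hp⟩ s t hst
    rcases hcases p hp with ⟨v, rfl⟩ | ⟨u, a, τ, rfl, hu⟩
    · simp only [hΥv, c]
      refine le_widen h.1 (b := X.coarseDist P.origin (X.walkPt P.origin (P.cpath 1 (word v))
        (late t * (word v).length))) (by push_cast; linarith) ?_
      have h3 := h.dominates (X.walkPt P.origin (P.cpath 1 (word v)) (late t * (word v).length))
      -- Over a vertex the path is a walk along a geodesic, so coarse distance does not decrease and
      -- domination alone gives tameness.
      have h4 := (hgeo v).coarseDistRat_mono (mul_le_mul_of_nonneg_right (monotone_late hst.le)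
        (Nat.cast_nonneg (word v).length))
      change X.coarseDistRat P.origin _ ≤ _
      have h5 : X.coarseDistRat P.origin (X.walkPt P.origin (P.cpath 1 (word v))
        (late t * (word v).length)) = P.cayleyComplex.coarseDistRat P.origin
          (P.cayleyComplex.walkPt P.origin (P.cpath 1 (word v)) (late t * (word v).length)) := rfl
      push_cast
      refine le_trans h4 ?_
      rw [← h5]
      linarith
    · simp only [hu]
      exact htame u a τ s t hst.le

end SymmPresentation

/-! ### Separating a diagram at a vertex -/

theorem DartGraph.IsWalk.sum_sub {K : DartGraph} {l : List K.D} {u v : K.V} (h : K.IsWalk l u v)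
    (φ : K.V → ℚ) : (l.map fun d => φ (K.term d) - φ (K.init d)).sum = φ v - φ u := by
  induction l generalizing u with
  | nil => obtain rfl : u = v := h; simp
  | cons d l ih =>
    obtain ⟨rfl, h⟩ := h
    rw [List.map_cons, List.sum_cons, ih h]; ring

/-- Membership in `s` or `t` can change between cyclic neighbours only after the last entry of `s`
or of `t`. For a loop inside the boundary walk these two places both lie at its base vertex. -/
theorem CyclicSucc.append {α : Type*} {s t : List α} {a b : α} (h : CyclicSucc (s ++ t) a b) :
    (a ∈ s ∧ b ∈ s) ∨ (a ∈ t ∧ b ∈ t) ∨ (∃ s', s = s' ++ [a]) ∨ ∃ t', t = t' ++ [a] := by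
  obtain ⟨p, q, h1, h2⟩ := cyclicSucc_iff.1 h
  rcases List.append_eq_append_iff.1 h1 with ⟨c, rfl, h3⟩ | ⟨c, rfl, h3⟩
  · rcases q with _ | ⟨e, q⟩
    · exact Or.inr (Or.inr (Or.inr ⟨c, h3⟩))
    · obtain rfl : e = b := by simpa using h2
      rw [h3]
      exact Or.inr (Or.inl ⟨by simp, by simp⟩)
  · rcases c with _ | ⟨e, c⟩
    · rcases q with _ | ⟨e, q⟩
      · exact Or.inr (Or.inr (Or.inr ⟨[], by simpa using h3.symm⟩))
      · obtain rfl : e = b := by simpa using h2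
        simp only [List.nil_append] at h3
        rw [← h3]
        exact Or.inr (Or.inl ⟨by simp, by simp⟩)
    · simp only [List.cons_append, List.cons.injEq] at h3
      obtain ⟨rfl, rfl⟩ := h3
      rcases c with _ | ⟨e, c⟩
      · exact Or.inr (Or.inr (Or.inl ⟨p, rfl⟩))
      · obtain rfl : e = b := by simpa using h2
        exact Or.inl ⟨by simp, by simp⟩

theorem CyclicSucc.append_comm {α : Type*} {s t : List α} {a b : α} (h : CyclicSucc (s ++ t) a b) :
    CyclicSucc (t ++ s) a b := by
  obtain ⟨m, hm⟩ : (t ++ s) ~r (s ++ t) := List.isRotated_append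
  obtain ⟨k, hk⟩ := h
  rw [← hm, List.rotate_rotate, List.rotate_rotate, ← add_assoc] at hk
  exact ⟨_, hk⟩

/-- A linear order on the directed edges picks the smaller one of each reversal pair. The set `O`
serves as a basis of the antisymmetric edge functions. -/
theorem DartGraph.exists_orientation (K : DartGraph) [Finite K.D] :
    ∃ O : Set K.D, (∀ d, d ∈ O ∨ K.rev d ∈ O) ∧ Nat.card K.D = 2 * Nat.card O := by
  let e := Finite.equivFin K.D
  let O : Set K.D := {d | e d < e (K.rev d)}
  have h1 : ∀ d, d ∈ Oᶜ ↔ K.rev d ∈ O := by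
    intro d
    simp only [O, Set.mem_compl_iff, Set.mem_ofPred_eq, K.rev_rev, not_lt]
    exact ⟨fun h => lt_of_le_of_ne h fun h' => K.rev_ne d (e.injective h'), le_of_lt⟩
  refine ⟨O, fun d => ?_, ?_⟩
  · by_cases h : d ∈ O
    · exact Or.inl h
    · exact Or.inr ((h1 d).1 h)
  · have h2 : Nat.card (Oᶜ : Set K.D) = Nat.card O := by
      refine Nat.card_congr ⟨fun d => ⟨K.rev d, (h1 d).1 d.2⟩, fun d => ⟨K.rev d, (h1 _).2 ?_⟩,
        fun d => Subtype.ext (K.rev_rev _), fun d => Subtype.ext (K.rev_rev _)⟩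
      rw [K.rev_rev]; exact d.2
    classical
    have h3 := Nat.card_congr (Equiv.Set.sumCompl O)
    rw [Nat.card_sum, h2] at h3
    omega

namespace VanKampenDiagram

open CombComplex

variable {G : Type*} [Group G] {P : SymmPresentation G} {w : List P.A}
  (Δ : VanKampenDiagram P w)

theorem faceWalk_closed (o : Option Δ.F) : ∃ v, Δ.IsWalk (Δ.faceWalk o) v v := by
  cases o with
  | none => rw [Δ.faceWalk_none]; exact ⟨_, Δ.boundary_walk.revWalk⟩
  | some f => rw [Δ.faceWalk_some]; exact Δ.bdry_closed f

/-- The face to the left of a directed edge. -/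
theorem exists_left : ∃ left : Δ.D → Option Δ.F, ∀ o d, d ∈ Δ.faceWalk o ↔ left d = o := by
  have h := ((bijective_get_iff _).1 Δ.left_face).2
  choose left h1 h2 using h
  exact ⟨left, fun o d => ⟨fun hd => (h2 d o hd).symm, fun hd => hd ▸ h1 d⟩⟩

theorem nodup_boundary : Δ.boundary.Nodup := by
  have h := ((bijective_get_iff _).1 Δ.left_face).1 none
  rw [Δ.faceWalk_none] at h
  exact List.nodup_reverse.1 (List.Nodup.of_map _ h)

variable {Δ} {left : Δ.D → Option Δ.F} (hleft : ∀ o d, d ∈ Δ.faceWalk o ↔ left d = o)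
include hleft

/-- Each directed edge occurs once in one face walk; along a face walk the coefficient is constant
and the differences of `φ` telescope around a closed path. -/
theorem sum_left [Fintype Δ.D] (φ : Δ.V → ℚ) (s : Option Δ.F → ℚ) :
    ∑ d, (φ (Δ.term d) - φ (Δ.init d)) * s (left d) = 0 := by
  have : Finite Δ.F := Δ.finite_F
  have : Fintype Δ.F := Fintype.ofFinite _
  rw [← Δ.left_face.sum_comp, Fintype.sum_sigma]
  refine Finset.sum_eq_zero fun o _ => ?_
  have h1 : ∀ k, left ((Δ.faceWalk o).get k) = o := fun k => (hleft o _).1 (List.get_mem _ _)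
  simp only [h1]
  rw [← Finset.sum_mul]
  obtain ⟨v, hv⟩ := Δ.faceWalk_closed o
  have h2 := hv.sum_sub φ
  rw [← Fin.sum_univ_fun_getElem] at h2
  simp only [List.get_eq_getElem]
  rw [h2]; ring

/-- Orthogonality of the coboundary of a vertex function and the boundary of a face function: the
statement ∂∂ = 0 on the sphere. -/
theorem sum_coboundary_mul_boundary [Fintype Δ.D] (φ : Δ.V → ℚ) (s : Option Δ.F → ℚ) :
    ∑ d, (φ (Δ.term d) - φ (Δ.init d)) * (s (left d) - s (left (Δ.rev d))) = 0 := by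
  have h1 := sum_left hleft φ s
  have h2 : ∑ d, (φ (Δ.term d) - φ (Δ.init d)) * s (left (Δ.rev d)) = 0 := by
    have hb : Function.Bijective Δ.rev := (Function.Involutive.bijective Δ.rev_rev)
    rw [← hb.sum_comp]
    simp only [Δ.rev_rev, DartGraph.term_rev, DartGraph.init_rev]
    rw [← neg_eq_zero, ← Finset.sum_neg_distrib, ← h1]
    exact Finset.sum_congr rfl fun d _ => by ring
  simp only [mul_sub _ (s _) (s _), Finset.sum_sub_distrib]
  rw [h1, h2, sub_zero]

/-- A face function without jumps across edges is constant around every vertex, because the faces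
there form one cycle, and then constant along edge paths by connectedness. The boundary must be
nonempty for the exterior face to have an edge. -/
theorem eq_of_boundary_eq_zero (hne : Δ.boundary ≠ []) {s : Option Δ.F → ℚ}
    (h : ∀ d, s (left d) = s (left (Δ.rev d))) (o : Option Δ.F) : s o = s none := by
  have h1 : ∀ d d', Δ.init d = Δ.init d' → s (left d) = s (left d') := by
    intro d d' hd
    have := Δ.vertex_link d d' hd
    clear hd
    induction this with
    | refl => rfl
    | tail h2 h3 ih =>
      rename_i b c
      obtain ⟨o, k, hk⟩ := h3
      have h5 : CyclicSucc (Δ.faceWalk o) (Δ.rev b) c := ⟨k, hk⟩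
      rw [ih, h, (hleft _ _).1 h5.mem_left, (hleft _ _).1 h5.mem_right]
  have h2 : ∀ (l : List Δ.D) (u v : Δ.V) (d d' : Δ.D), Δ.IsWalk l u v → Δ.init d = u →
      Δ.init d' = v → s (left d) = s (left d') := by
    intro l
    induction l with
    | nil => rintro u v d d' hl rfl rfl; exact h1 _ _ hl
    | cons e l ih =>
      rintro u v d d' ⟨rfl, hl⟩ hd rfl
      rw [h1 _ _ hd, h e]
      exact ih _ _ _ _ hl rfl rfl
  have h3 : ∀ o, Δ.faceWalk o ≠ [] := by
    rintro (_ | f)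
    · rw [Δ.faceWalk_none]
      intro h0
      exact hne (by simpa using congrArg Δ.revWalk h0)
    · rw [Δ.faceWalk_some]; exact Δ.bdry_ne_nil f
  have h4 : ∀ o, ∃ d, left d = o := fun o => by
    obtain ⟨d, hd⟩ := List.exists_mem_of_ne_nil _ (h3 o)
    exact ⟨d, (hleft _ _).1 hd⟩
  obtain ⟨d, rfl⟩ := h4 o
  obtain ⟨d', hd'⟩ := h4 none
  obtain ⟨l, hl⟩ := Δ.connected (Δ.init d)
  obtain ⟨l', hl'⟩ := Δ.connected (Δ.init d')
  rw [← hd']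
  exact h2 _ _ _ _ _ (hl.revWalk.append hl') rfl rfl

/-- Every 1-cycle is the boundary of a combination of faces. -/
theorem exists_boundary_eq (hne : Δ.boundary ≠ []) {q : Δ.D → ℚ} (hq : ∀ d, q (Δ.rev d) = - q d)
    (hcl : ∀ φ : Δ.V → ℚ, ∀ [Fintype Δ.D], ∑ d, (φ (Δ.term d) - φ (Δ.init d)) * q d = 0) :
    ∃ s : Option Δ.F → ℚ, s none = 0 ∧ ∀ d, s (left d) - s (left (Δ.rev d)) = q d := by
  have := Δ.finite_D
  have := Δ.finite_V
  have := Δ.finite_F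
  have : Fintype Δ.D := Fintype.ofFinite _
  have : Fintype Δ.V := Fintype.ofFinite _
  have : Fintype Δ.F := Fintype.ofFinite _
  obtain ⟨O, hO, hcard⟩ := Δ.exists_orientation
  have : Fintype O := Fintype.ofFinite _
  let e : Δ.D → (Δ.V → ℚ) × (Option Δ.F → ℚ) → ℚ := fun d z =>
    (z.1 (Δ.term d) - z.1 (Δ.init d)) + (z.2 (left d) - z.2 (left (Δ.rev d)))
  -- The sum of coboundary and boundary on one orientation of each edge. The two extra coordinates,
  -- at the basepoint and at the exterior face, remove the constants from its kernel.
  let L : (Δ.V → ℚ) × (Option Δ.F → ℚ) →ₗ[ℚ] (O → ℚ) × ℚ × ℚ :=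
    { toFun := fun z => (fun d => e d z, z.1 Δ.base, z.2 none)
      map_add' := fun a b => by
        refine Prod.ext (funext fun d => ?_) rfl
        simp only [e, Prod.fst_add, Prod.snd_add, Pi.add_apply]; ring
      map_smul' := fun a b => by
        refine Prod.ext (funext fun d => ?_) rfl
        simp only [e, Prod.smul_fst, Prod.smul_snd, Pi.smul_apply, smul_eq_mul, RingHom.id_apply]
        ring }
  have hanti : ∀ d z, e (Δ.rev d) z = - e d z := by
    intro d z
    simp only [e, DartGraph.term_rev, DartGraph.init_rev, Δ.rev_rev]; ring
  have hall : ∀ (q : Δ.D → ℚ) z, (∀ d, q (Δ.rev d) = - q d) → (∀ d : O, e d z = q d) →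
      ∀ d, e d z = q d := by
    intro q z hq h d
    rcases hO d with hd | hd
    · exact h ⟨d, hd⟩
    · have := h ⟨_, hd⟩
      rw [hanti, hq] at this
      exact neg_injective this
  have hconst : ∀ φ : Δ.V → ℚ, (∑ d, (φ (Δ.term d) - φ (Δ.init d)) ^ 2 = 0) →
      ∀ d, φ (Δ.term d) - φ (Δ.init d) = 0 := by
    intro φ h d
    have := (Finset.sum_eq_zero_iff_of_nonneg (fun d _ => sq_nonneg _)).1 h d (Finset.mem_univ _)
    exact pow_eq_zero_iff (two_ne_zero) |>.1 this
  have hinj : Function.Injective L := by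
    rw [← LinearMap.ker_eq_bot, LinearMap.ker_eq_bot']
    rintro ⟨φ, s⟩ h
    have h1 : ∀ d : O, e d (φ, s) = 0 := fun d => congrFun (congrArg Prod.fst h) d
    have h2 : φ Δ.base = 0 := congrArg (fun z => z.2.1) h
    have h3 : s none = 0 := congrArg (fun z => z.2.2) h
    have h4 := hall (fun _ => 0) (φ, s) (by simp) h1
    have h5 := sum_coboundary_mul_boundary hleft φ s
    have h6 : ∀ d, s (left d) - s (left (Δ.rev d)) = - (φ (Δ.term d) - φ (Δ.init d)) := fun d => by
      have := h4 d
      simp only [e] at this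
      linarith
    -- In the kernel the coboundary is minus a boundary, hence orthogonal to itself, hence zero.
    have h7 := hconst φ (by
      simp only [h6] at h5
      rw [← neg_eq_zero, ← h5, ← Finset.sum_neg_distrib]
      exact Finset.sum_congr rfl fun d _ => by ring)
    have h8 : ∀ (l : List Δ.D) (u v : Δ.V), Δ.IsWalk l u v → φ v = φ u := by
      intro l u v hl
      have := hl.sum_sub φ
      simp only [h7] at this
      rw [← sub_eq_zero, ← this]
      simp
    refine Prod.ext (funext fun v => ?_) (funext fun o => ?_)
    · obtain ⟨l, hl⟩ := Δ.connected v
      exact (h8 _ _ _ hl).trans h2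
    · refine (eq_of_boundary_eq_zero hleft hne (fun d => ?_) o).trans h3
      have := h6 d
      rw [h7] at this
      linarith
  -- This is Euler's formula in the form V + (F + 1) = E + 2, so the injective map is also onto.
  have hdim : Module.finrank ℚ ((Δ.V → ℚ) × (Option Δ.F → ℚ)) =
      Module.finrank ℚ ((O → ℚ) × ℚ × ℚ) := by
    have := Δ.euler
    simp only [Module.finrank_prod, Module.finrank_fintype_fun_eq_card, Module.finrank_self,
      ← Nat.card_eq_fintype_card, Finite.card_option] at *
    omega
  obtain ⟨⟨φ, s⟩, hz⟩ := (LinearMap.injective_iff_surjective_of_finrank_eq_finrank hdim).1 hinj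
    (fun d => q d, 0, 0)
  have h1 := hall q (φ, s) hq fun d => congrFun (congrArg Prod.fst hz) d
  have h2 : s none = 0 := congrArg (fun z => z.2.2) hz
  have h3 := hcl φ
  -- The cycle is a coboundary plus a boundary. It is orthogonal to all coboundaries and so is the
  -- boundary part, so the coboundary part vanishes.
  have h4 := hconst φ (by
    have h5 := sum_coboundary_mul_boundary hleft φ s
    simp only [← h1, e, mul_add, Finset.sum_add_distrib] at h3
    rw [h5, add_zero] at h3
    rw [← h3]
    exact Finset.sum_congr rfl fun d _ => sq _)
  refine ⟨s, h2, fun d => ?_⟩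
  rw [← h1]
  simp only [e, h4, zero_add]

omit hleft

variable (Δ)

theorem cyclicSucc_term_eq {o : Option Δ.F} {a b : Δ.D} (h : CyclicSucc (Δ.faceWalk o) a b) :
    Δ.term a = Δ.init b := by
  obtain ⟨p, q, h1, h2⟩ := cyclicSucc_iff.1 h
  obtain ⟨v, hv⟩ := Δ.faceWalk_closed o
  rw [h1] at hv
  obtain ⟨y, h3, rfl, h4⟩ := DartGraph.isWalk_append.1 hv
  rcases q with _ | ⟨c, q⟩
  · obtain rfl : Δ.term a = v := h4
    rcases p with _ | ⟨c, p⟩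
    · obtain rfl : a = b := by simpa using h2
      exact h3
    · obtain rfl : c = b := by simpa using h2
      exact h3.1.symm
  · obtain rfl : c = b := by simpa using h2
    exact h4.1.symm

/-- A vertex that a part of the boundary path starts and ends at separates the diagram. -/
theorem exists_separation {p l r : List Δ.D} {x : Δ.V} (hb : Δ.boundary = p ++ l ++ r)
    (hl : Δ.IsWalk l x x) (hx : x ≠ Δ.base) (hne : l ≠ []) : ∃ T : Δ.D → ℚ,
      (∀ d, T (Δ.rev d) = T d) ∧ (∀ d d', Δ.init d = Δ.init d' → Δ.init d ≠ x → T d = T d') ∧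
      (∀ f, ∀ d ∈ Δ.bdry f, ∀ d' ∈ Δ.bdry f, T d = T d') ∧
      (∀ d, Δ.init d = Δ.base → T d = 0) ∧ ∀ d ∈ l, T d = 1 := by
  classical
  obtain ⟨left, hleft⟩ := Δ.exists_left
  have hbne : Δ.boundary ≠ [] := by rw [hb]; simp [hne]
  have hnd := Δ.nodup_boundary
  rw [hb] at hnd
  have hw := Δ.boundary_walk
  rw [hb] at hw
  obtain ⟨y, hw1, hw3⟩ := DartGraph.isWalk_append.1 hw
  obtain ⟨x', hw1, hw2⟩ := DartGraph.isWalk_append.1 hw1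
  obtain rfl : x' = x := by
    obtain ⟨e, l', rfl⟩ := List.exists_cons_of_ne_nil hne
    exact hw2.1.symm.trans hl.1
  obtain rfl := hw2.unique hl
  have hw4 := hw3.append hw1
  -- The indicator of the loop; its antisymmetrization is a 1-cycle, and the face function bounding
  -- it counts how often the loop winds around each face.
  let N : Δ.D → ℚ := fun d => if d ∈ l then 1 else 0
  have hNl : ∀ d ∈ l, N d = 1 := fun d hd => if_pos hd
  have hN0 : ∀ d, d ∉ l → N d = 0 := fun d hd => if_neg hd
  have hsum : ∀ (φ : Δ.V → ℚ) [Fintype Δ.D], ∑ d, (φ (Δ.term d) - φ (Δ.init d)) * N d = 0 := by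
    intro φ _
    have h1 := hl.sum_sub φ
    rw [sub_self, ← List.sum_toFinset _ (hnd.sublist (by simp))] at h1
    simp only [N, mul_ite, mul_one, mul_zero]
    rw [← Finset.sum_filter, ← h1]
    exact Finset.sum_congr (by ext; simp) fun _ _ => rfl
  obtain ⟨s, hs0, hs⟩ := exists_boundary_eq hleft hbne (q := fun d => N d - N (Δ.rev d))
    (fun d => by simp only [Δ.rev_rev]; ring) (by
      intro φ _
      have h2 : ∑ d, (φ (Δ.term d) - φ (Δ.init d)) * N (Δ.rev d) = 0 := by
        have hbij : Function.Bijective Δ.rev := (Function.Involutive.bijective Δ.rev_rev)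
        rw [← hbij.sum_comp]
        simp only [Δ.rev_rev, DartGraph.term_rev, DartGraph.init_rev]
        rw [← neg_eq_zero, ← Finset.sum_neg_distrib, ← hsum φ]
        exact Finset.sum_congr rfl fun d _ => by ring
      simp only [mul_sub _ (N _) (N _), Finset.sum_sub_distrib]
      rw [hsum, h2, sub_zero])
  have hext : ∀ d ∈ Δ.boundary, left (Δ.rev d) = none := fun d hd =>
    (hleft _ _).1 (by rw [Δ.faceWalk_none, DartGraph.mem_revWalk, Δ.rev_rev]; exact hd)
  have hN1 : ∀ d f, left (Δ.rev d) = some f → N d = 0 := fun d f h => hN0 d fun hd => by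
    rw [hext d (by rw [hb]; simp [hd])] at h
    simp at h
  -- The winding number to the left of `d`, corrected when the reverse of `d` belongs to the loop.
  -- The correction makes it the same on both sides of an edge, including boundary edges.
  let T : Δ.D → ℚ := fun d => s (left d) + N (Δ.rev d)
  have hTrev : ∀ d, T (Δ.rev d) = T d := by
    intro d
    have := hs d
    simp only [T, Δ.rev_rev]
    linarith
  have hTb : ∀ d ∈ Δ.boundary, T d = N d := by
    intro d hd
    rw [← hTrev]
    simp only [T, hext d hd, Δ.rev_rev, hs0, zero_add]
  have hstar : ∀ d d', Δ.init d = Δ.init d' → Δ.init d ≠ y → T d = T d' := by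
    intro d d' hd hdx
    have hlink := Δ.vertex_link d d' hd
    clear hd
    have : Δ.init d' = Δ.init d ∧ T d = T d' := by
      induction hlink with
      | refl => exact ⟨rfl, rfl⟩
      | tail h2 h3 ih =>
        rename_i b c
        obtain ⟨o, k, hk⟩ := h3
        have h5 : CyclicSucc (Δ.faceWalk o) (Δ.rev b) c := ⟨k, hk⟩
        have h6 : Δ.init b = Δ.init c := by
          rw [← Δ.cyclicSucc_term_eq h5, DartGraph.term_rev]
        refine ⟨h6.symm.trans ih.1, ih.2.trans ?_⟩
        have h7 := (hleft _ _).1 h5.mem_left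
        have h8 := (hleft _ _).1 h5.mem_right
        rw [← hTrev b]
        simp only [T, h7, h8, Δ.rev_rev]
        -- Both edges border the face `o`, so only the corrections must agree. They vanish at an
        -- interior face; at the exterior face they could differ only where the boundary walk enters
        -- or leaves the loop, which happens at the excluded vertex.
        congr 1
        cases o with
        | some f => rw [hN1 _ _ h7, hN1 (Δ.rev c) f (by rw [Δ.rev_rev, h8])]
        | none =>
          rw [Δ.faceWalk_none] at h5
          have h9 : CyclicSucc (Δ.revWalk (Δ.revWalk Δ.boundary)) (Δ.rev c) (Δ.rev (Δ.rev b)) :=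
            (cyclicSucc_reverse h5).map Δ.rev
          rw [DartGraph.revWalk_revWalk, Δ.rev_rev, hb, List.append_assoc] at h9
          have h9 := h9.append_comm
          rw [List.append_assoc] at h9
          have hcx : Δ.term (Δ.rev c) ≠ y := by
            rw [DartGraph.term_rev, ← h6, ih.1]; exact hdx
          have hend : ∀ t : List Δ.D, Δ.IsWalk t y y → ∀ t', t ≠ t' ++ [Δ.rev c] := by
            rintro t ht t' rfl
            obtain ⟨z, -, h⟩ := DartGraph.isWalk_append.1 ht
            exact hcx h.2
          have hdisj : ∀ d ∈ r ++ p, d ∉ l := by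
            intro d hd hdl
            have h11 : (l ++ (r ++ p)).Nodup := by
              refine (List.Perm.nodup_iff ?_).1 hnd
              rw [List.append_assoc]
              refine List.perm_append_comm.trans ?_
              rw [List.append_assoc]
            exact (List.disjoint_of_nodup_append h11) hdl hd
          rcases CyclicSucc.append h9 with h | h | ⟨t', h⟩ | ⟨t', h⟩
          · rw [hNl _ h.1, hNl _ h.2]
          · rw [hN0 _ (hdisj _ h.1), hN0 _ (hdisj _ h.2)]
          · exact absurd h (hend _ hl _)
          · exact absurd h (hend _ hw4 _)
    exact this.2
  refine ⟨T, hTrev, hstar, ?_, ?_, ?_⟩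
  · have : ∀ f, ∀ d ∈ Δ.bdry f, T d = s (some f) := by
      intro f d hd
      have h1 : left d = some f := (hleft _ _).1 (by rw [Δ.faceWalk_some]; exact hd)
      have h2 : N (Δ.rev d) = 0 := hN1 _ f (by rw [Δ.rev_rev, h1])
      simp only [T, h1, h2, add_zero]
    intro f d hd d' hd'
    rw [this f d hd, this f d' hd']
  · intro d hd
    -- Since the loop is not based at the basepoint, a nonempty part of the boundary precedes it.
    -- Its first edge lies outside the loop, so `T` is 0 there and, by constancy around the
    -- basepoint, on every edge starting there.
    rcases p with _ | ⟨e, p⟩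
    · exact absurd hw1.symm hx
    · rw [hstar d e (hd.trans hw1.1.symm) (by rw [hd]; exact hx.symm), hTb e (by rw [hb]; simp)]
      refine hN0 _ fun he => ?_
      simp only [List.cons_append, List.nodup_cons] at hnd
      exact hnd.1 (by simp [he])
  · intro d hd
    rw [hTb d (by rw [hb]; simp [hd]), hNl d hd]

end VanKampenDiagram

/-! ### Cutting off part of a diagram -/

namespace CombComplex

/-- Collapse to the vertex `x` all cells off `x` that are not in a given union of components. -/
theorem exists_collapse {K : CombComplex} (x : K.V) (C : Set K.D) (hrev : ∀ d, K.rev d ∈ C ↔ d ∈ C)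
    (hstar : ∀ d d', K.init d = K.init d' → K.init d ≠ x → (d ∈ C ↔ d' ∈ C))
    (hface : ∀ f, ∀ d ∈ K.bdry f, ∀ d' ∈ K.bdry f, (d ∈ C ↔ d' ∈ C)) :
    ∃ r : K.Space → K.Space, Continuous r ∧ (∀ d ∈ C, ∀ t, r (K.edgePt d t) = K.edgePt d t) ∧
      (∀ d ∉ C, ∀ t, r (K.edgePt d t) = K.vert x) ∧
      (∀ f, ∀ d ∈ K.bdry f, d ∈ C → ∀ z, r (K.facePt f z) = K.facePt f z) ∧
      (∀ f, ∀ d ∈ K.bdry f, d ∉ C → ∀ z, r (K.facePt f z) = K.vert x) ∧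
      r (K.vert x) = K.vert x := by
  classical
  obtain ⟨r, h1, h2, h3⟩ := exists_lift (K := K)
    -- Away from `x` all edges at a vertex lie on the same side, so this tests the side; at `x` both
    -- branches give `x`.
    (fun v => if ∀ d, K.init d = v → d ∈ C then K.vert v else K.vert x)
    (fun d t => if d ∈ C then K.edgePt d t else K.vert x)
    (fun f z => if ∀ d ∈ K.bdry f, d ∈ C then K.facePt f z else K.vert x)
    (fun d t => by simp only [hrev]; split_ifs; exacts [edgePt_rev d t, rfl])
    (fun d => by
      by_cases hd : K.init d = x
      · simp only [edgePt_zero, hd, ite_self]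
      · have : (∀ d', K.init d' = K.init d → d' ∈ C) ↔ d ∈ C :=
          ⟨fun h => h d rfl, fun h d' hd' => (hstar d d' hd'.symm hd).1 h⟩
        simp only [this, edgePt_zero])
    (fun f k hk t => by
      have : (∀ d ∈ K.bdry f, d ∈ C) ↔ (K.bdry f)[k] ∈ C :=
        ⟨fun h => h _ (List.getElem_mem _), fun h d hd => (hface f d hd _ (List.getElem_mem hk)).2 h⟩
      simp only [this, facePt_circlePt f k hk])
  refine ⟨r, continuous_iff_cells.2 ⟨fun d => ?_, fun f => ?_⟩, fun d hd t => ?_, fun d hd t => ?_,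
    fun f d hd hC z => ?_, fun f d hd hC z => ?_, ?_⟩
  · simp only [h2]
    split_ifs
    exacts [continuous_edgePt d, continuous_const]
  · simp only [h3]
    split_ifs
    exacts [continuous_facePt f, continuous_const]
  · rw [h2, if_pos hd]
  · rw [h2, if_neg hd]
  · rw [h3, if_pos fun d' hd' => (hface f d hd d' hd').1 hC]
  · rw [h3, if_neg fun h => hC (h d hd)]
  · rw [h1, ite_self]

/-- `r` is a retraction that, along each path from `y`, differs from the identity only after a
passage through the vertex `x`, and then maps to `x`. -/
structure IsCutOff (K : CombComplex) (y x : K.V) (r : K.Space → K.Space) : Prop where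
  continuous : Continuous r
  passage : ∀ γ : unitInterval → K.Space, Continuous γ → γ 0 = K.vert y → ∀ t, r (γ t) ≠ γ t →
    ∃ t' ≤ t, γ t' = K.vert x ∧ ∀ s, t' ≤ s → s ≤ t → r (γ s) = K.vert x

variable {K : CombComplex} {y x : K.V} {r : K.Space → K.Space}

theorem isCutOff_const (K : CombComplex) (y : K.V) : K.IsCutOff y y fun _ => K.vert y :=
  ⟨continuous_const, fun _ _ h _ _ => ⟨0, unitInterval.nonneg', h, fun _ _ _ => rfl⟩⟩

/-- The space is the union of the parts fixed by `r` and by `r'`, which meet only in `x`. By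
connectedness of intervals a path cannot change from one part to the other without passing through
`x`. -/
theorem isCutOff_of_complement {r' : K.Space → K.Space} (hr : Continuous r) (hr' : Continuous r')
    (hy : r (K.vert y) ≠ K.vert x) (hx : r (K.vert x) = K.vert x)
    (h : ∀ p, (r p = p ∧ r' p = K.vert x) ∨ (r p = K.vert x ∧ r' p = p)) :
    K.IsCutOff y x r := by
  refine ⟨hr, fun γ hγ h0 t ht => ?_⟩
  have hx' : r' (K.vert x) = K.vert x := by rcases h (K.vert x) with h | h; exacts [h.2, h.2]
  have hcross : ∀ a b, a ≤ b → r (γ a) ≠ K.vert x → r (γ b) = K.vert x →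
      ∃ c, a ≤ c ∧ c ≤ b ∧ γ c = K.vert x := by
    intro a b hab ha hb
    by_contra! hc
    have ho : ∀ g : K.Space → K.Space, Continuous g → IsOpen {u | g (γ u) ≠ K.vert x} := fun g hg =>
      (isClosed_singleton_vert x).isOpen_compl.preimage (hg.comp hγ)
    -- If `x` were avoided on this interval, the two open sets where `r` and `r'` differ from `x`
    -- would cover it, both be met, and be disjoint.
    obtain ⟨c, ⟨hc1, hc2⟩, hc3, hc4⟩ := isPreconnected_Icc (a := a) (b := b) _ _ (ho r hr)
      (ho r' hr') (fun u hu => by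
        have hu' := hc u hu.1 hu.2
        rcases h (γ u) with h | h
        · left; simpa [h.1] using hu'
        · right; simpa [h.2] using hu')
      ⟨a, ⟨le_rfl, hab⟩, ha⟩ ⟨b, ⟨hab, le_rfl⟩, by
        rcases h (γ b) with h' | h'
        · exact absurd (h'.1.symm.trans hb) (hc b hab le_rfl)
        · simpa [h'.2] using hc b hab le_rfl⟩
    rcases h (γ c) with h | h
    exacts [hc4 h.2, hc3 h.1]
  have hrt : r (γ t) = K.vert x := by
    rcases h (γ t) with h | h
    exacts [absurd h.1 ht, h.1]
  have hclosed : IsClosed {u | γ u = K.vert x} := (isClosed_singleton_vert x).preimage hγ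
  obtain ⟨c, -, hc1, hc2⟩ := hcross 0 t unitInterval.nonneg' (by rwa [h0]) hrt
  -- The last visit to `x` before time `t`: afterwards the path remains in the collapsed part.
  obtain ⟨t', ⟨ht1, ht2⟩, ht3⟩ := (isClosed_Iic.inter hclosed).isCompact.exists_isGreatest
    ⟨c, hc1, hc2⟩
  refine ⟨t', ht1, ht2, fun s hs hst => ?_⟩
  by_contra hs'
  obtain ⟨c', h1, h2, h3⟩ := hcross s t hst hs' hrt
  have h4 : c' = t' := le_antisymm (ht3 ⟨h2, h3⟩) (hs.trans h1)
  have h5 : s = t' := le_antisymm (h1.trans h4.le) hs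
  rw [h5, ht2] at hs'
  exact hs' hx

/-- Every value of `r ∘ γ` is a value of `γ` at the same or an earlier time, and for s ≤ t these
times can be taken in order unless both values are `x`. In the latter case tameness with equal times
is used, which is why `TamePath` is not strict. -/
theorem IsCutOff.tamePath {X : CombComplex} {o : X.V} {f : QuarterNat → QuarterNat}
    (h : K.IsCutOff y x r) {π : K.Space → X.Space} {γ : unitInterval → K.Space}
    (hγ : Continuous γ) (h0 : γ 0 = K.vert y) (ht : X.TamePath o f fun t => π (γ t)) :
    X.TamePath o f fun t => π (r (γ t)) := by
  intro s t hst
  have hrefl : ∀ u, X.coarseDist o (π (γ u)) ≤ f (X.coarseDist o (π (γ u))) := fun u => ht u u le_rfl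
  by_cases h1 : r (γ t) = γ t
  · simp only [h1]
    by_cases h2 : r (γ s) = γ s
    · rw [h2]; exact ht s t hst
    · obtain ⟨s', hs', h3, h4⟩ := h.passage γ hγ h0 s h2
      rw [h4 s hs' le_rfl, ← h3]
      exact ht s' t (hs'.trans hst)
  · obtain ⟨t', ht', h3, h4⟩ := h.passage γ hγ h0 t h1
    simp only [h4 t ht' le_rfl]
    by_cases h2 : r (γ s) = γ s
    · rcases le_total t' s with h5 | h5
      · rw [h4 s h5 hst, ← h3]; exact hrefl t'
      · rw [h2, ← h3]; exact ht s t' h5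
    · obtain ⟨s', hs', h5, h6⟩ := h.passage γ hγ h0 s h2
      rw [h6 s hs' le_rfl, ← h3]; exact hrefl t'

/-- A path that rests at `x` after first reaching it never enters the collapsed part. -/
theorem IsCutOff.eq_of_stable (h : K.IsCutOff y x r) {γ : unitInterval → K.Space}
    (hγ : Continuous γ) (h0 : γ 0 = K.vert y)
    (hst : ∀ s t, s ≤ t → γ s = K.vert x → γ t = K.vert x) (t : unitInterval) : r (γ t) = γ t := by
  by_contra h1
  obtain ⟨t', ht', h3, h4⟩ := h.passage γ hγ h0 t h1
  exact h1 ((h4 t ht' le_rfl).trans (hst t' t ht' h3).symm)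

end CombComplex

namespace VanKampenDiagram

open CombComplex

variable {G : Type*} [Group G] {P : SymmPresentation G} {w : List P.A}

/-- The components on which the separating function `T` is nonzero contain the loop and not the
basepoint, and are collapsed to `x`. For a loop at the basepoint the whole diagram is collapsed, for
an empty loop nothing. -/
theorem exists_cutOff (Δ : VanKampenDiagram P w) {p l r : List Δ.D} {x : Δ.V}
    (hb : Δ.boundary = p ++ l ++ r) (hl : Δ.IsWalk l x x) :
    ∃ ρ : Δ.Space → Δ.Space, Δ.IsCutOff Δ.base x ρ ∧ ρ (Δ.vert x) = Δ.vert x ∧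
      ∀ d ∈ l, ∀ t, ρ (Δ.edgePt d t) = Δ.vert x := by
  by_cases hx : x = Δ.base
  · subst hx
    exact ⟨_, isCutOff_const _ _, rfl, fun _ _ _ => rfl⟩
  by_cases hne : l = []
  · subst hne
    refine ⟨id, ⟨continuous_id, fun _ _ _ _ h => absurd rfl h⟩, rfl, fun d hd => absurd hd (by simp)⟩
  obtain ⟨T, h1, h2, h3, h4, h5⟩ := Δ.exists_separation hb hl hx hne
  obtain ⟨r, r1, r2, r3, r4, r5, r6⟩ := exists_collapse (K := Δ.toCombComplex) x {d | T d = 0}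
    (fun d => by simp [h1]) (fun d d' h h' => by simp [h2 d d' h h'])
    (fun f d hd d' hd' => by simp [h3 f d hd d' hd'])
  obtain ⟨r', s1, s2, s3, s4, s5, s6⟩ := exists_collapse (K := Δ.toCombComplex) x {d | T d ≠ 0}
    (fun d => by simp [h1]) (fun d d' h h' => by simp [h2 d d' h h'])
    (fun f d hd d' hd' => by simp [h3 f d hd d' hd'])
  have hne' : Δ.boundary ≠ [] := by rw [hb]; simp [hne]
  have hdart : ∀ v, ∃ d, Δ.init d = v := by
    intro v
    obtain ⟨m, hm⟩ := Δ.connected v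
    rcases List.eq_nil_or_concat m with rfl | ⟨m, d, rfl⟩
    · obtain rfl : Δ.base = v := hm
      obtain ⟨e, l', he⟩ := List.exists_cons_of_ne_nil hne'
      have := Δ.boundary_walk
      rw [he] at this
      exact ⟨e, this.1⟩
    · obtain ⟨z, -, h⟩ := DartGraph.isWalk_append.1 (by simpa using hm)
      exact ⟨Δ.rev d, h.2⟩
  have hedge : ∀ d t, (r (Δ.edgePt d t) = Δ.edgePt d t ∧ r' (Δ.edgePt d t) = Δ.vert x) ∨
      (r (Δ.edgePt d t) = Δ.vert x ∧ r' (Δ.edgePt d t) = Δ.edgePt d t) := by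
    intro d t
    by_cases hd : T d = 0
    · exact Or.inl ⟨r2 d hd t, s3 d (by simp [hd]) t⟩
    · exact Or.inr ⟨r3 d (by simp [hd]) t, s2 d hd t⟩
  refine ⟨r, isCutOff_of_complement r1 s1 ?_ r6 fun p => ?_, r6, fun d hd t => ?_⟩
  · obtain ⟨d, hd⟩ := hdart Δ.base
    have := r2 d (h4 d hd) 0
    rw [edgePt_zero, hd] at this
    rw [this]
    exact fun h => hx (vert_injective h).symm
  · refine space_cases (motive := fun p => (r p = p ∧ r' p = Δ.vert x) ∨
      (r p = Δ.vert x ∧ r' p = p)) p (fun v => ?_) hedge (fun f z => ?_)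
    · obtain ⟨d, rfl⟩ := hdart v
      simpa using hedge d 0
    · obtain ⟨d, hd⟩ := List.exists_mem_of_ne_nil _ (Δ.bdry_ne_nil f)
      by_cases hT : T d = 0
      · exact Or.inl ⟨r4 f d hd hT z, s5 f d hd (by simp [hT]) z⟩
      · exact Or.inr ⟨r5 f d hd (by simp [hT]) z, s4 f d hd hT z⟩
  · exact r3 d (by simp [h5 d hd]) t

end VanKampenDiagram

/-! ### Gluing two diagrams along a boundary path -/

/-- `s` contains `b` immediately after `a`. -/
def List.Adjacent {α : Type*} (s : List α) (a b : α) : Prop := ∃ p q, s = p ++ a :: b :: q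

theorem List.Adjacent.cyclicSucc {α : Type*} {s : List α} {a b : α} (h : s.Adjacent a b)
    (u v : List α) : CyclicSucc (u ++ s ++ v) a b := by
  obtain ⟨p, q, rfl⟩ := h
  have := cyclicSucc_adjacent (u ++ p) (q ++ v) a b
  simpa using this

theorem List.Adjacent.map {α β : Type*} (f : α → β) {s : List α} {a b : α} (h : s.Adjacent a b) :
    (s.map f).Adjacent (f a) (f b) := by
  obtain ⟨p, q, rfl⟩ := h
  exact ⟨p.map f, q.map f, by simp⟩

/-- Consecutive elements of the cyclic list `s ++ t`, where `h` and `z` are the first and the last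
element of `s`. -/
theorem CyclicSucc.append_cases {α : Type*} {s t : List α} {a b h z : α} (hh : s.head? = some h)
    (hz : s.getLast? = some z) (hab : CyclicSucc (s ++ t) a b) :
    s.Adjacent a b ∨ ∃ (k : ℕ) (hk : k ≤ t.length),
      a = (z :: t)[k]'(by simp; omega) ∧ b = (t ++ [h])[k]'(by simp; omega) := by
  obtain ⟨p, q, h1, h2⟩ := cyclicSucc_iff.1 hab
  have key : ∀ c, p = s ++ c → t = c ++ a :: q → ∃ (k : ℕ) (hk : k ≤ t.length),
      a = (z :: t)[k]'(by simp; omega) ∧ b = (t ++ [h])[k]'(by simp; omega) := by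
    rintro c rfl rfl
    refine ⟨c.length + 1, by simp, by simp, ?_⟩
    rcases q with _ | ⟨e, q⟩
    · obtain ⟨s', rfl⟩ : ∃ s', s = h :: s' := by
        cases s with
        | nil => simp at hh
        | cons x s => exact ⟨s, by simpa using hh⟩
      simp at h2 ⊢
      exact h2.symm
    · simp at h2 ⊢
      exact h2.symm
  rcases List.append_eq_append_iff.1 h1 with ⟨c, h3, h4⟩ | ⟨c, h3, h4⟩
  · exact Or.inr (key c h3 h4)
  · rcases c with _ | ⟨e, c⟩
    · exact Or.inr (key [] (by simpa using h3.symm) (by simpa using h4.symm))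
    · simp only [List.cons_append, List.cons.injEq] at h4
      obtain ⟨rfl, rfl⟩ := h4
      rcases c with _ | ⟨e, c⟩
      · subst h3
        right
        refine ⟨0, Nat.zero_le _, by simpa using hz, ?_⟩
        have : (t ++ (p ++ [a])).head? = some b := by simpa using h2
        cases t with
        | nil => simp only [List.nil_append] at this; rw [hh] at this; simpa using this.symm
        | cons x t => simpa using this.symm
      · left
        obtain rfl : e = b := by simpa using h2
        exact ⟨p, c, h3⟩

theorem DartGraph.cyclicSucc_revWalk {K : DartGraph} {l : List K.D} {a b : K.D} :
    CyclicSucc (K.revWalk l) (K.rev a) b ↔ CyclicSucc l (K.rev b) a := by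
  constructor
  · intro h
    have h9 : CyclicSucc (K.revWalk (K.revWalk l)) (K.rev b) (K.rev (K.rev a)) :=
      (cyclicSucc_reverse h).map K.rev
    rwa [DartGraph.revWalk_revWalk, K.rev_rev] at h9
  · intro h
    have h9 : CyclicSucc (K.revWalk l) (K.rev a) (K.rev (K.rev b)) :=
      (cyclicSucc_reverse h).map K.rev
    rwa [K.rev_rev] at h9

/-- Stop the chain at its first visit to `b`. This yields chains that never use a step starting at
`b`. -/
theorem reflTransGen_bypass {α : Type*} {r : α → α → Prop} {a b : α}
    (h : Relation.ReflTransGen r a b) : Relation.ReflTransGen (fun x y => r x y ∧ x ≠ b) a b := by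
  induction h using Relation.ReflTransGen.head_induction_on with
  | refl => exact .refl
  | head h _ ih =>
    rename_i x y _
    by_cases hx : x = b
    · subst hx; exact .refl
    · exact .head ⟨h, hx⟩ ih

/-- The map from `α` to the amalgam of `α` and `β` along an embedded copy of the index set. -/
theorem exists_amalgam {ι α β : Type*} {a : ι → α} (ha : Function.Injective a) (b : ι → β) :
    ∃ j : α → β ⊕ ↥(Set.range a)ᶜ, (∀ k, j (a k) = .inl (b k)) ∧ ∀ x, j x.1 = .inr x := by
  classical
  refine ⟨fun x => if h : ∃ k, a k = x then .inl (b h.choose) else .inr ⟨x, h⟩, fun k => ?_,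
    fun x => ?_⟩
  · have h : ∃ k', a k' = a k := ⟨k, rfl⟩
    simp only [h, dif_pos]
    rw [ha h.choose_spec]
  · exact dif_neg x.2

/-- If two of these edges coincided, directly or after reversal, their endpoints would give a
repeated vertex. -/
theorem DartGraph.IsWalk.injective_darts {K : DartGraph} {l : List K.D} {u v : K.V}
    (h : K.IsWalk l u v) (hs : ∀ i j, i ≤ l.length → j ≤ l.length →
      K.walkVert u l i = K.walkVert u l j → i = j) :
    Function.Injective (Sum.elim (fun k : Fin l.length => l[k]) fun k : Fin l.length => K.rev l[k]) := by
  have h1 : ∀ k k' : Fin l.length, l[k] ≠ K.rev l[k'] := by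
    intro k k' e
    have e1 := hs k (k' + 1) k.2.le k'.2 (by
      rw [← h.init_getElem k k.2, ← h.term_getElem' k' k'.2]
      exact congrArg K.init e)
    have e2 := hs (k + 1) k' k.2 k'.2.le (by
      rw [← h.init_getElem k' k'.2, ← h.term_getElem' k k.2]
      exact (congrArg K.term e).trans (K.term_rev _))
    omega
  have h2 : ∀ k k' : Fin l.length, l[k] = l[k'] → k = k' := by
    intro k k' e
    refine Fin.ext (hs k k' k.2.le k'.2.le ?_)
    rw [← h.init_getElem k k.2, ← h.init_getElem k' k'.2]
    exact congrArg K.init e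
  rintro (k | k) (k' | k') e
  · exact congrArg _ (h2 _ _ e)
  · exact absurd e (h1 _ _)
  · exact absurd e.symm (h1 _ _)
  · exact congrArg _ (h2 _ _ (K.rev_injective e))

namespace VanKampenDiagram

open CombComplex

variable {G : Type*} [Group G] {P : SymmPresentation G} {w₁ w₂ : List P.A}

/-- The data for gluing two diagrams along the common part `m₁`, `m₂` of their boundaries, which
is a simple path in the second diagram. -/
structure Gluing (Δ₁ : VanKampenDiagram P w₁) (Δ₂ : VanKampenDiagram P w₂) where
  l₁ : List Δ₁.D
  m₁ : List Δ₁.D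
  m₂ : List Δ₂.D
  l₂ : List Δ₂.D
  boundary₁ : Δ₁.boundary = l₁ ++ Δ₁.revWalk m₁
  boundary₂ : Δ₂.boundary = m₂ ++ l₂
  l₁_ne : l₁ ≠ []
  l₂_ne : l₂ ≠ []
  label_eq : m₁.map Δ₁.label = m₂.map Δ₂.label
  simple : ∀ i j, i ≤ m₂.length → j ≤ m₂.length →
    Δ₂.walkVert Δ₂.base m₂ i = Δ₂.walkVert Δ₂.base m₂ j → i = j

namespace Gluing

variable {Δ₁ : VanKampenDiagram P w₁} {Δ₂ : VanKampenDiagram P w₂} (g : Gluing Δ₁ Δ₂)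

theorem length_eq : g.m₁.length = g.m₂.length := by simpa using congrArg List.length g.label_eq

theorem walk_m₁ : ∃ v, Δ₁.IsWalk g.m₁ Δ₁.base v ∧ Δ₁.IsWalk g.l₁ Δ₁.base v := by
  have := Δ₁.boundary_walk
  rw [g.boundary₁] at this
  obtain ⟨v, h1, h2⟩ := DartGraph.isWalk_append.1 this
  have := h2.revWalk
  rw [DartGraph.revWalk_revWalk] at this
  exact ⟨v, this, h1⟩

theorem walk_m₂ : ∃ v, Δ₂.IsWalk g.m₂ Δ₂.base v ∧ Δ₂.IsWalk g.l₂ v Δ₂.base := by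
  have := Δ₂.boundary_walk
  rw [g.boundary₂] at this
  exact DartGraph.isWalk_append.1 this

/-- The vertices of the arc. -/
def arcVert (k : Fin (g.m₂.length + 1)) : Δ₂.V := Δ₂.walkVert Δ₂.base g.m₂ k

/-- The directed edges of the arc. -/
def arcDart : Fin g.m₂.length ⊕ Fin g.m₂.length → Δ₂.D :=
  Sum.elim (fun k => g.m₂[k]) fun k => Δ₂.rev g.m₂[k]

theorem arcVert_injective : Function.Injective g.arcVert := fun i j h =>
  Fin.ext (g.simple i j (Nat.lt_succ_iff.1 i.2) (Nat.lt_succ_iff.1 j.2) h)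

theorem arcDart_injective : Function.Injective g.arcDart :=
  g.walk_m₂.choose_spec.1.injective_darts g.simple

theorem mem_range_arcDart {d : Δ₂.D} : d ∈ Set.range g.arcDart ↔ d ∈ g.m₂ ∨ Δ₂.rev d ∈ g.m₂ := by
  constructor
  · rintro ⟨k | k, rfl⟩
    · exact Or.inl (List.getElem_mem _)
    · right; simp [arcDart, Δ₂.rev_rev]
  · rintro (h | h)
    · obtain ⟨k, hk, rfl⟩ := List.getElem_of_mem h
      exact ⟨.inl ⟨k, hk⟩, rfl⟩
    · obtain ⟨k, hk, h⟩ := List.getElem_of_mem h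
      refine ⟨.inr ⟨k, hk⟩, ?_⟩
      simp only [arcDart, Sum.elim_inr, Fin.getElem_fin, h, Δ₂.rev_rev]

/-- The vertices of the union. -/
abbrev V : Type := Δ₁.V ⊕ ↥(Set.range g.arcVert)ᶜ

/-- The directed edges of the union. -/
abbrev D : Type := Δ₁.D ⊕ ↥(Set.range g.arcDart)ᶜ

theorem exists_jV : ∃ j : Δ₂.V → g.V,
    (∀ k, j (g.arcVert k) = .inl (Δ₁.walkVert Δ₁.base g.m₁ k)) ∧ ∀ x, j x.1 = .inr x :=
  exists_amalgam g.arcVert_injective fun k => Δ₁.walkVert Δ₁.base g.m₁ k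

theorem exists_jD : ∃ j : Δ₂.D → g.D,
    (∀ k, j (g.arcDart k) = .inl (Sum.elim (fun k => g.m₁[k.1]'(by rw [g.length_eq]; exact k.2))
      (fun k => Δ₁.rev (g.m₁[k.1]'(by rw [g.length_eq]; exact k.2))) k)) ∧ ∀ x, j x.1 = .inr x :=
  exists_amalgam g.arcDart_injective _

/-- The map from the vertices of the second diagram. -/
def jV : Δ₂.V → g.V := g.exists_jV.choose

/-- The map from the directed edges of the second diagram. -/
def jD : Δ₂.D → g.D := g.exists_jD.choose

theorem jV_arc (k : ℕ) (hk : k ≤ g.m₂.length) :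
    g.jV (Δ₂.walkVert Δ₂.base g.m₂ k) = .inl (Δ₁.walkVert Δ₁.base g.m₁ k) :=
  g.exists_jV.choose_spec.1 ⟨k, Nat.lt_succ_iff.2 hk⟩

theorem jV_off (v : ↥(Set.range g.arcVert)ᶜ) : g.jV v = .inr v := g.exists_jV.choose_spec.2 v

theorem jD_arc (k : ℕ) (hk : k < g.m₂.length) :
    g.jD g.m₂[k] = .inl (g.m₁[k]'(by rw [g.length_eq]; exact hk)) :=
  g.exists_jD.choose_spec.1 (.inl ⟨k, hk⟩)

theorem jD_arc_rev (k : ℕ) (hk : k < g.m₂.length) :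
    g.jD (Δ₂.rev g.m₂[k]) = .inl (Δ₁.rev (g.m₁[k]'(by rw [g.length_eq]; exact hk))) :=
  g.exists_jD.choose_spec.1 (.inr ⟨k, hk⟩)

theorem jD_off (d : ↥(Set.range g.arcDart)ᶜ) : g.jD d = .inr d := g.exists_jD.choose_spec.2 d

theorem map_jD : g.m₂.map g.jD = g.m₁.map .inl := by
  refine List.ext_getElem (by simp [g.length_eq]) fun k h1 h2 => ?_
  simp only [List.getElem_map]
  exact g.jD_arc k (by simpa using h1)

theorem dart_cases (d : Δ₂.D) : (∃ (k : ℕ) (hk : k < g.m₂.length), d = g.m₂[k]) ∨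
    (∃ (k : ℕ) (hk : k < g.m₂.length), d = Δ₂.rev g.m₂[k]) ∨ d ∉ Set.range g.arcDart := by
  by_cases h : d ∈ Set.range g.arcDart
  · obtain ⟨k | k, rfl⟩ := h
    exacts [Or.inl ⟨k, k.2, rfl⟩, Or.inr (Or.inl ⟨k, k.2, rfl⟩)]
  · exact Or.inr (Or.inr h)

/-- The reversal of directed edges in the union. -/
def rev : g.D → g.D
  | .inl d => .inl (Δ₁.rev d)
  | .inr d => g.jD (Δ₂.rev d)

/-- The initial vertex in the union. -/
def init : g.D → g.V
  | .inl d => .inl (Δ₁.init d)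
  | .inr d => g.jV (Δ₂.init d)

/-- The label in the union. -/
def label : g.D → P.A
  | .inl d => Δ₁.label d
  | .inr d => Δ₂.label d

theorem rev_jD (d : Δ₂.D) : g.rev (g.jD d) = g.jD (Δ₂.rev d) := by
  rcases g.dart_cases d with ⟨k, hk, rfl⟩ | ⟨k, hk, rfl⟩ | h
  · rw [jD_arc, jD_arc_rev]; rfl
  · rw [jD_arc_rev, Δ₂.rev_rev, jD_arc, rev, Δ₁.rev_rev]
  · rw [g.jD_off ⟨d, h⟩]; rfl

theorem init_jD (d : Δ₂.D) : g.init (g.jD d) = g.jV (Δ₂.init d) := by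
  obtain ⟨v₁, h1, -⟩ := g.walk_m₁
  obtain ⟨v₂, h2, -⟩ := g.walk_m₂
  rcases g.dart_cases d with ⟨k, hk, rfl⟩ | ⟨k, hk, rfl⟩ | h
  · rw [jD_arc, h2.init_getElem, jV_arc _ _ hk.le, init, h1.init_getElem]
  · rw [jD_arc_rev, init, DartGraph.init_rev, DartGraph.init_rev, h2.term_getElem', jV_arc _ _ hk,
      h1.term_getElem']
  · rw [g.jD_off ⟨d, h⟩]; rfl

theorem label_jD (d : Δ₂.D) : g.label (g.jD d) = Δ₂.label d := by
  have h : ∀ (k : ℕ) (hk : k < g.m₂.length),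
      Δ₁.label (g.m₁[k]'(by rw [g.length_eq]; exact hk)) = Δ₂.label g.m₂[k] := by
    intro k hk
    have := List.getElem_of_eq g.label_eq (i := k) (by simpa [g.length_eq] using hk)
    simpa using this
  rcases g.dart_cases d with ⟨k, hk, rfl⟩ | ⟨k, hk, rfl⟩ | hd
  · rw [jD_arc, ← h]; rfl
  · rw [jD_arc_rev, Δ₂.label_rev, ← h, label, Δ₁.label_rev]
  · rw [g.jD_off ⟨d, hd⟩]; rfl

theorem D_cases (d : g.D) : (∃ e, d = .inl e) ∨ ∃ e ∉ Set.range g.arcDart, d = g.jD e := by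
  rcases d with d | d
  · exact Or.inl ⟨d, rfl⟩
  · exact Or.inr ⟨d, d.2, (g.jD_off d).symm⟩

theorem V_cases (v : g.V) : (∃ u, v = .inl u) ∨ ∃ u ∉ Set.range g.arcVert, v = g.jV u := by
  rcases v with d | d
  · exact Or.inl ⟨d, rfl⟩
  · exact Or.inr ⟨d, d.2, (g.jV_off d).symm⟩

/-- The 1-skeleton of the union. -/
def graph : DartGraph where
  V := g.V
  D := g.D
  rev := g.rev
  rev_rev d := by
    rcases g.D_cases d with ⟨e, rfl⟩ | ⟨e, -, rfl⟩
    · simp only [rev, Δ₁.rev_rev]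
    · rw [rev_jD, rev_jD, Δ₂.rev_rev]
  rev_ne d h := by
    rcases d with d | d
    · exact Δ₁.rev_ne d (Sum.inl_injective h)
    · have hd : Δ₂.rev d ∉ Set.range g.arcDart := by
        have := d.2
        rw [Set.mem_compl_iff, g.mem_range_arcDart] at this
        rw [g.mem_range_arcDart, Δ₂.rev_rev]
        tauto
      rw [rev, g.jD_off ⟨_, hd⟩] at h
      exact Δ₂.rev_ne d (congrArg Subtype.val (Sum.inr_injective h))
  init := g.init

theorem isWalk_inl {l : List Δ₁.D} {u v : Δ₁.V} (h : Δ₁.IsWalk l u v) :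
    g.graph.IsWalk (l.map .inl) (.inl u) (.inl v) := by
  induction l generalizing u with
  | nil => exact congrArg _ h
  | cons d l ih => exact ⟨congrArg Sum.inl h.1, ih h.2⟩

theorem isWalk_jD {l : List Δ₂.D} {u v : Δ₂.V} (h : Δ₂.IsWalk l u v) :
    g.graph.IsWalk (l.map g.jD) (g.jV u) (g.jV v) := by
  induction l generalizing u with
  | nil => exact congrArg _ h
  | cons d l ih =>
    refine ⟨(g.init_jD d).trans (congrArg _ h.1), ?_⟩
    have h1 : g.graph.term (g.jD d) = g.jV (Δ₂.term d) := by
      change g.init (g.rev (g.jD d)) = _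
      rw [rev_jD, init_jD]; rfl
    rw [h1]
    exact ih h.2

theorem jV_base : g.jV Δ₂.base = .inl Δ₁.base := by
  have := g.jV_arc 0 (Nat.zero_le _)
  rwa [DartGraph.walkVert_zero, DartGraph.walkVert_zero] at this

/-- The union as a combinatorial 2-complex. -/
def complex : CombComplex where
  toDartGraph := g.graph
  F := Δ₁.F ⊕ Δ₂.F
  bdry f := f.elim (fun f => (Δ₁.bdry f).map .inl) fun f => (Δ₂.bdry f).map g.jD
  bdry_ne_nil f := by
    rcases f with f | f
    · exact fun h => Δ₁.bdry_ne_nil f (List.map_eq_nil_iff.1 h)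
    · exact fun h => Δ₂.bdry_ne_nil f (List.map_eq_nil_iff.1 h)
  bdry_closed f := by
    rcases f with f | f
    · obtain ⟨v, hv⟩ := Δ₁.bdry_closed f
      exact ⟨_, g.isWalk_inl hv⟩
    · obtain ⟨v, hv⟩ := Δ₂.bdry_closed f
      exact ⟨_, g.isWalk_jD hv⟩

/-- The boundary of the union. -/
def bd : List g.D := g.l₁.map .inl ++ g.l₂.map g.jD

/-- The boundary walks of all faces of the union. -/
def faceWalk : Option (Δ₁.F ⊕ Δ₂.F) → List g.D
  | none => g.graph.revWalk g.bd
  | some f => g.complex.bdry f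

theorem bd_walk : g.graph.IsWalk g.bd (.inl Δ₁.base) (.inl Δ₁.base) := by
  obtain ⟨v₁, h1, h1'⟩ := g.walk_m₁
  obtain ⟨v₂, h2, h2'⟩ := g.walk_m₂
  have h3 := g.isWalk_jD h2'
  have h4 : g.jV v₂ = .inl v₁ := by
    rw [← h2.walkVert_length, ← h1.walkVert_length, g.jV_arc _ le_rfl, g.length_eq]
  rw [h4, jV_base] at h3
  exact (g.isWalk_inl h1').append h3

end Gluing
end VanKampenDiagram

/-! ### Glued diagrams are van Kampen diagrams -/

namespace VanKampenDiagram

open CombComplex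

variable {G : Type*} [Group G] {P : SymmPresentation G} {w₁ w₂ : List P.A}

/-- Each directed edge lies on exactly one face walk, so the perimeters of all faces, with the
exterior one, add up to the number of directed edges. -/
theorem sum_length (Δ : VanKampenDiagram P w₁) :
    (∑ᶠ f, (Δ.bdry f).length) + Δ.boundary.length = Nat.card Δ.D := by
  have := Δ.finite_F
  have : Fintype Δ.F := Fintype.ofFinite _
  rw [← Nat.card_congr (Equiv.ofBijective _ Δ.left_face), Nat.card_sigma, Fintype.sum_option,
    finsum_eq_sum_of_fintype]
  simp only [Nat.card_fin, Δ.faceWalk_none, Δ.faceWalk_some, DartGraph.length_revWalk]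
  rw [add_comm]

namespace Gluing

variable {Δ₁ : VanKampenDiagram P w₁} {Δ₂ : VanKampenDiagram P w₂} (g : Gluing Δ₁ Δ₂)

theorem card_V : Nat.card g.V + (g.m₂.length + 1) = Nat.card Δ₁.V + Nat.card Δ₂.V := by
  classical
  have := Δ₁.finite_V
  have := Δ₂.finite_V
  have h := Nat.card_congr (Equiv.Set.sumCompl (Set.range g.arcVert))
  rw [Nat.card_sum, Nat.card_range_of_injective g.arcVert_injective, Nat.card_fin] at h
  rw [Nat.card_sum, ← h]
  ring

theorem card_D : Nat.card g.D + 2 * g.m₂.length = Nat.card Δ₁.D + Nat.card Δ₂.D := by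
  classical
  have := Δ₁.finite_D
  have := Δ₂.finite_D
  have h := Nat.card_congr (Equiv.Set.sumCompl (Set.range g.arcDart))
  rw [Nat.card_sum, Nat.card_range_of_injective g.arcDart_injective, Nat.card_sum, Nat.card_fin] at h
  rw [Nat.card_sum, ← h]
  ring

/-- The excluded edges are those of the reversed arc, whose left face in the second diagram is the
exterior one and is lost in the union. -/
theorem mem_faceWalk_jD {d : Δ₂.D} (hd : Δ₂.rev d ∉ g.m₂) : ∃ o, g.jD d ∈ g.faceWalk o := by
  obtain ⟨left, hleft⟩ := Δ₂.exists_left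
  obtain ⟨o, h⟩ : ∃ o, d ∈ Δ₂.faceWalk o := ⟨_, (hleft _ d).2 rfl⟩
  rcases o with _ | f
  · rw [Δ₂.faceWalk_none, DartGraph.mem_revWalk, g.boundary₂, List.mem_append] at h
    refine ⟨none, ?_⟩
    refine DartGraph.mem_revWalk.2 (List.mem_append_right _ ?_)
    change g.rev (g.jD d) ∈ _
    rw [rev_jD]
    exact List.mem_map_of_mem (h.resolve_left hd)
  · rw [Δ₂.faceWalk_some] at h
    exact ⟨some (.inr f), List.mem_map_of_mem h⟩

theorem mem_faceWalk_inl {d : Δ₁.D} (hd : d ∉ g.m₁) : ∃ o, Sum.inl d ∈ g.faceWalk o := by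
  obtain ⟨left, hleft⟩ := Δ₁.exists_left
  obtain ⟨o, h⟩ : ∃ o, d ∈ Δ₁.faceWalk o := ⟨_, (hleft _ d).2 rfl⟩
  rcases o with _ | f
  · rw [Δ₁.faceWalk_none, DartGraph.mem_revWalk, g.boundary₁, List.mem_append,
      DartGraph.mem_revWalk, Δ₁.rev_rev] at h
    refine ⟨none, ?_⟩
    refine DartGraph.mem_revWalk.2 (List.mem_append_left _ ?_)
    exact List.mem_map_of_mem (h.resolve_right hd)
  · rw [Δ₁.faceWalk_some] at h
    exact ⟨some (.inl f), List.mem_map_of_mem h⟩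

theorem rev_notMem {k : ℕ} (hk : k < g.m₂.length) : Δ₂.rev g.m₂[k] ∉ g.m₂ := by
  intro h
  obtain ⟨k', hk', h⟩ := List.getElem_of_mem h
  have : g.arcDart (.inl ⟨k', hk'⟩) = g.arcDart (.inr ⟨k, hk⟩) := h
  simpa using g.arcDart_injective this

/-- On the arc, an edge of `m₁` has the exterior face of the first diagram to its left and takes its
left face from the second diagram; the reversed edge takes it from the first. -/
theorem mem_faceWalk (d : g.D) : ∃ o, d ∈ g.faceWalk o := by
  rcases g.D_cases d with ⟨e, rfl⟩ | ⟨e, he, rfl⟩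
  · by_cases h : e ∈ g.m₁
    · obtain ⟨k, hk, rfl⟩ := List.getElem_of_mem h
      have hk' : k < g.m₂.length := by rwa [← g.length_eq]
      rw [← g.jD_arc k hk']
      exact g.mem_faceWalk_jD (g.rev_notMem hk')
    · exact g.mem_faceWalk_inl h
  · rw [mem_range_arcDart, not_or] at he
    exact g.mem_faceWalk_jD he.2

/-- Surjectivity suffices, since the total length of all face walks equals the number of directed
edges: gluing along n edges removes 2n from both counts. -/
theorem left_face : Function.Bijective
    (fun c : Σ o : Option (Δ₁.F ⊕ Δ₂.F), Fin (g.faceWalk o).length => (g.faceWalk c.1).get c.2) := by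
  have := Δ₁.finite_D
  have := Δ₂.finite_D
  have := Δ₁.finite_F
  have := Δ₂.finite_F
  have : Fintype Δ₁.F := Fintype.ofFinite _
  have : Fintype Δ₂.F := Fintype.ofFinite _
  have hs : Function.Surjective (fun c : Σ o : Option (Δ₁.F ⊕ Δ₂.F),
      Fin (g.faceWalk o).length => (g.faceWalk c.1).get c.2) := by
    intro d
    obtain ⟨o, ho⟩ := g.mem_faceWalk d
    obtain ⟨k, hk⟩ := List.mem_iff_get.1 ho
    exact ⟨⟨o, k⟩, hk⟩
  refine hs.bijective_of_nat_card_le ?_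
  have h1 := Δ₁.sum_length
  have h2 := Δ₂.sum_length
  have h3 := g.card_D
  have h4 := g.length_eq
  rw [finsum_eq_sum_of_fintype, g.boundary₁, List.length_append, DartGraph.length_revWalk] at h1
  rw [finsum_eq_sum_of_fintype, g.boundary₂, List.length_append] at h2
  rw [Nat.card_sigma, Fintype.sum_option, Fintype.sum_sum_type]
  simp only [Nat.card_fin]
  have e0 : (g.faceWalk none).length = g.l₁.length + g.l₂.length := by
    refine (DartGraph.length_revWalk _).trans ?_
    exact (List.length_append (as := g.l₁.map (Sum.inl : Δ₁.D → g.D))).trans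
      (congrArg₂ _ (List.length_map _) (List.length_map _))
  have e1 : ∀ f, (g.faceWalk (some (.inl f))).length = (Δ₁.bdry f).length := fun f =>
    List.length_map _
  have e2 : ∀ f, (g.faceWalk (some (.inr f))).length = (Δ₂.bdry f).length := fun f =>
    List.length_map _
  simp only [e0, e1, e2]
  omega

/-! ### The cyclic order of edges around the vertices of the union -/

/-- `e'` follows `e` around their common initial vertex. -/
def Turn (e e' : g.D) : Prop := ∃ o, CyclicSucc (g.faceWalk o) (g.rev e) e'

theorem turn_of_bd {e e' : g.D} (h : CyclicSucc g.bd (g.rev e') e) : g.Turn e e' :=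
  ⟨none, (DartGraph.cyclicSucc_revWalk (K := g.graph)).2 h⟩

/-- The first edge of the free part of the first boundary. -/
def h₁ : Δ₁.D := g.l₁.head g.l₁_ne

/-- The last edge of the free part of the first boundary. -/
def z₁ : Δ₁.D := g.l₁.getLast g.l₁_ne

/-- The first edge of the free part of the second boundary. -/
def h₂ : Δ₂.D := g.l₂.head g.l₂_ne

/-- The last edge of the free part of the second boundary. -/
def z₂ : Δ₂.D := g.l₂.getLast g.l₂_ne

/-- The new exterior corner at the basepoint, where the free part of the second boundary is followed
by that of the first. -/
theorem turn_h₁ : g.Turn (.inl g.h₁) (g.jD (Δ₂.rev g.z₂)) := by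
  refine g.turn_of_bd ?_
  rw [rev_jD, Δ₂.rev_rev, bd]
  refine CyclicSucc.append_comm ?_
  have h1 : g.l₁ = g.h₁ :: g.l₁.tail := (List.cons_head_tail g.l₁_ne).symm
  have h2 : g.l₂ = g.l₂.dropLast ++ [g.z₂] := (List.dropLast_append_getLast g.l₂_ne).symm
  rw [h1, h2]
  simpa using cyclicSucc_adjacent (g.l₂.dropLast.map g.jD) (g.l₁.tail.map Sum.inl) _ _

/-- The new exterior corner at the far end of the arc. -/
theorem turn_h₂ : g.Turn (g.jD g.h₂) (.inl (Δ₁.rev g.z₁)) := by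
  refine g.turn_of_bd ?_
  rw [rev, Δ₁.rev_rev, bd]
  have h1 : g.l₁ = g.l₁.dropLast ++ [g.z₁] := (List.dropLast_append_getLast g.l₁_ne).symm
  have h2 : g.l₂ = g.h₂ :: g.l₂.tail := (List.cons_head_tail g.l₂_ne).symm
  rw [h1, h2]
  simpa using cyclicSucc_adjacent (g.l₁.dropLast.map Sum.inl) (g.l₂.tail.map g.jD) _ _

/-- The edges that enter the vertices of the arc along the first boundary. -/
def a₁ (k : ℕ) : Δ₁.D := (Δ₁.rev g.h₁ :: g.m₁).getD k g.h₁

/-- The edges that leave the vertices of the arc along the first boundary. -/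
def b₁ (k : ℕ) : Δ₁.D := (g.m₁ ++ [Δ₁.rev g.z₁]).getD k g.h₁

/-- The edges that enter the vertices of the arc along the second boundary. -/
def a₂ (k : ℕ) : Δ₂.D := (g.z₂ :: g.m₂).getD k g.h₂

/-- The edges that leave the vertices of the arc along the second boundary. -/
def b₂ (k : ℕ) : Δ₂.D := (g.m₂ ++ [g.h₂]).getD k g.h₂

theorem a₁_succ {k : ℕ} (hk : k < g.m₁.length) : g.a₁ (k + 1) = g.m₁[k] := by simp [a₁, hk]

theorem a₂_succ {k : ℕ} (hk : k < g.m₂.length) : g.a₂ (k + 1) = g.m₂[k] := by simp [a₂, hk]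

theorem b₁_of_lt {k : ℕ} (hk : k < g.m₁.length) : g.b₁ k = g.m₁[k] := by
  simp [b₁, List.getElem?_append_left hk, hk]

theorem b₂_of_lt {k : ℕ} (hk : k < g.m₂.length) : g.b₂ k = g.m₂[k] := by
  simp [b₂, List.getElem?_append_left hk, hk]

theorem b₁_length : g.b₁ g.m₁.length = Δ₁.rev g.z₁ := by simp [b₁]

theorem b₂_length : g.b₂ g.m₂.length = g.h₂ := by simp [b₂]

theorem term_a₂ {k : ℕ} (hk : k ≤ g.m₂.length) : Δ₂.term (g.a₂ k) = Δ₂.walkVert Δ₂.base g.m₂ k := by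
  obtain ⟨v, h1, h2⟩ := g.walk_m₂
  cases k with
  | zero =>
    rw [← List.dropLast_append_getLast g.l₂_ne] at h2
    obtain ⟨z, -, h3⟩ := DartGraph.isWalk_append.1 h2
    have h4 : Δ₂.term g.z₂ = Δ₂.base := h3.2
    simpa [a₂] using h4
  | succ k => rw [g.a₂_succ hk, h1.term_getElem']

theorem init_b₂ {k : ℕ} (hk : k ≤ g.m₂.length) : Δ₂.init (g.b₂ k) = Δ₂.walkVert Δ₂.base g.m₂ k := by
  obtain ⟨v, h1, h2⟩ := g.walk_m₂
  rcases hk.lt_or_eq with hk | rfl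
  · rw [g.b₂_of_lt hk, h1.init_getElem]
  · rw [b₂_length, h1.walkVert_length]
    rw [← List.cons_head_tail g.l₂_ne] at h2
    exact h2.1

theorem term_a₁ {k : ℕ} (hk : k ≤ g.m₁.length) : Δ₁.term (g.a₁ k) = Δ₁.walkVert Δ₁.base g.m₁ k := by
  obtain ⟨v, h1, h2⟩ := g.walk_m₁
  cases k with
  | zero =>
    rw [← List.cons_head_tail g.l₁_ne] at h2
    have h4 : Δ₁.init g.h₁ = Δ₁.base := h2.1
    simpa [a₁] using h4
  | succ k => rw [g.a₁_succ hk, h1.term_getElem']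

theorem init_b₁ {k : ℕ} (hk : k ≤ g.m₁.length) : Δ₁.init (g.b₁ k) = Δ₁.walkVert Δ₁.base g.m₁ k := by
  obtain ⟨v, h1, h2⟩ := g.walk_m₁
  rcases hk.lt_or_eq with hk | rfl
  · rw [g.b₁_of_lt hk, h1.init_getElem]
  · rw [b₁_length, h1.walkVert_length]
    rw [← List.dropLast_append_getLast g.l₁_ne] at h2
    obtain ⟨z, -, h3⟩ := DartGraph.isWalk_append.1 h2
    exact h3.2

open Relation

/-- Passage from the first diagram into the second at the k-th arc vertex. For k > 0 the two edges
are identified, so no turn is needed; for k = 0 it is the new exterior corner at the basepoint. -/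
theorem reach_out {k : ℕ} (hk : k ≤ g.m₂.length) :
    ReflTransGen g.Turn (.inl (Δ₁.rev (g.a₁ k))) (g.jD (Δ₂.rev (g.a₂ k))) := by
  cases k with
  | zero =>
    have := g.turn_h₁
    simpa [a₁, a₂, Δ₁.rev_rev] using ReflTransGen.single this
  | succ k =>
    rw [g.a₂_succ hk, g.jD_arc_rev k hk, g.a₁_succ (by rw [g.length_eq]; exact hk)]

/-- Passage back into the first diagram: again an identification, except at the far end of the arc,
where it is the other new exterior corner. -/
theorem reach_in {k : ℕ} (hk : k ≤ g.m₂.length) :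
    ReflTransGen g.Turn (g.jD (g.b₂ k)) (.inl (g.b₁ k)) := by
  rcases hk.lt_or_eq with hk | rfl
  · rw [g.b₂_of_lt hk, g.jD_arc k hk, g.b₁_of_lt (by rw [g.length_eq]; exact hk)]
  · have h := g.b₁_length
    rw [length_eq] at h
    rw [b₂_length, h]
    exact ReflTransGen.single g.turn_h₂

/-- Turns of the second diagram survive in the union, apart from the exterior corners along the arc,
which go from `b₂ k` to the reverse of `a₂ k`. -/
theorem turn_jD {e e' : Δ₂.D} {o : Option Δ₂.F} (h : CyclicSucc (Δ₂.faceWalk o) (Δ₂.rev e) e') :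
    g.Turn (g.jD e) (g.jD e') ∨ ∃ k ≤ g.m₂.length, Δ₂.rev e' = g.a₂ k ∧ e = g.b₂ k := by
  rcases o with _ | f
  · rw [Δ₂.faceWalk_none, DartGraph.cyclicSucc_revWalk, g.boundary₂] at h
    rcases CyclicSucc.append_cases (List.head?_eq_some_head g.l₂_ne)
      (List.getLast?_eq_some_getLast g.l₂_ne) h.append_comm with h | ⟨k, hk, h1, h2⟩
    · refine Or.inl (g.turn_of_bd ?_)
      rw [rev_jD]
      simpa [bd] using (h.map g.jD).cyclicSucc (g.l₁.map Sum.inl) []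
    · refine Or.inr ⟨k, hk, ?_, ?_⟩
      · rw [h1, a₂, List.getD_eq_getElem]; rfl
      · rw [h2, b₂, List.getD_eq_getElem]; rfl
  · rw [Δ₂.faceWalk_some] at h
    refine Or.inl ⟨some (.inr f), ?_⟩
    rw [rev_jD]
    exact h.map g.jD

theorem revWalk_inl (l : List Δ₁.D) :
    g.graph.revWalk (l.map .inl) = (Δ₁.revWalk l).map .inl := by
  induction l with
  | nil => rfl
  | cons d l ih =>
    have h1 : (Δ₁.revWalk (d :: l)).map (Sum.inl : Δ₁.D → g.D) =
        (Δ₁.revWalk l).map Sum.inl ++ [Sum.inl (Δ₁.rev d)] := by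
      rw [DartGraph.revWalk_cons, List.map_append]; rfl
    exact ((DartGraph.revWalk_cons (K := g.graph) _ _).trans (congrArg (· ++ [_]) ih)).trans h1.symm

/-- For the first diagram the lost exterior corners run the opposite way, from the reverse of `a₁ k`
to `b₁ k`. -/
theorem turn_inl {e e' : Δ₁.D} {o : Option Δ₁.F} (h : CyclicSucc (Δ₁.faceWalk o) (Δ₁.rev e) e') :
    g.Turn (.inl e) (.inl e') ∨ ∃ k ≤ g.m₁.length, e = Δ₁.rev (g.a₁ k) ∧ e' = g.b₁ k := by
  rcases o with _ | f
  · rw [Δ₁.faceWalk_none, g.boundary₁, DartGraph.revWalk_append, DartGraph.revWalk_revWalk] at h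
    rcases CyclicSucc.append_cases (h := Δ₁.rev g.z₁) (z := Δ₁.rev g.h₁) (by
        simp [DartGraph.revWalk, z₁, List.getLast?_eq_some_getLast g.l₁_ne])
      (by simp [DartGraph.revWalk, h₁, List.head?_eq_some_head g.l₁_ne]) h.append_comm with h | ⟨k, hk, h1, h2⟩
    · refine Or.inl ⟨none, ?_⟩
      have h3 : g.faceWalk none = g.graph.revWalk (g.l₂.map g.jD) ++ (Δ₁.revWalk g.l₁).map .inl := by
        refine (DartGraph.revWalk_append (K := g.graph) _ _).trans ?_
        exact congrArg _ (g.revWalk_inl _)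
      have h4 := (h.map (Sum.inl : Δ₁.D → g.D)).cyclicSucc (g.graph.revWalk (g.l₂.map g.jD)) []
      rw [List.append_nil] at h4
      rw [h3]
      exact h4
    · refine Or.inr ⟨k, hk, ?_, ?_⟩
      · rw [a₁, List.getD_eq_getElem _ _ (by simp; omega), ← h1, Δ₁.rev_rev]
      · rw [h2, b₁, List.getD_eq_getElem]
  · rw [Δ₁.faceWalk_some] at h
    exact Or.inl ⟨some (.inl f), h.map Sum.inl⟩

/-- A lost corner of the first diagram is replaced by a detour: enter the second diagram, go around
the arc vertex there, and come back. -/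
theorem link_inl {d d' : Δ₁.D} (hdd : Δ₁.init d = Δ₁.init d')
    (hM : ∀ k ≤ g.m₂.length, ReflTransGen g.Turn (g.jD (Δ₂.rev (g.a₂ k))) (g.jD (g.b₂ k))) :
    ReflTransGen g.Turn (.inl d) (.inl d') := by
  have h := Δ₁.vertex_link d d' hdd
  clear hdd
  induction h with
  | refl => exact .refl
  | tail _ hab ih =>
    obtain ⟨o, ho⟩ := hab
    refine ih.trans ?_
    rcases g.turn_inl ho with h | ⟨k, hk, rfl, rfl⟩
    · exact .single h
    · rw [g.length_eq] at hk
      exact ((g.reach_out hk).trans (hM k hk)).trans (g.reach_in hk)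

theorem init_eq_of_turn {Δ : VanKampenDiagram P w₁} {e e' : Δ.D} {o : Option Δ.F}
    (h : CyclicSucc (Δ.faceWalk o) (Δ.rev e) e') : Δ.init e' = Δ.init e := by
  rw [← Δ.cyclicSucc_term_eq h, DartGraph.term_rev]

/-- A chain stopped at its first visit to `b₂ k` uses no lost corner, since lost corners start at
some `b₂ k'` and simplicity of the arc forces k' = k. -/
theorem reach_b₂ {k : ℕ} (hk : k ≤ g.m₂.length) {d : Δ₂.D}
    (hd : Δ₂.init d = Δ₂.walkVert Δ₂.base g.m₂ k) :
    ReflTransGen g.Turn (g.jD d) (g.jD (g.b₂ k)) := by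
  have h := reflTransGen_bypass (Δ₂.vertex_link d (g.b₂ k) (by rw [hd, g.init_b₂ hk]))
  induction h using ReflTransGen.head_induction_on with
  | refl => exact .refl
  | head h h' ih =>
    obtain ⟨⟨o, ho⟩, hne⟩ := h
    refine .head ?_ (ih ((init_eq_of_turn ho).trans hd))
    rcases g.turn_jD ho with h | ⟨k', hk', -, rfl⟩
    · exact h
    · rw [g.init_b₂ hk'] at hd
      rw [g.simple _ _ hk' hk hd] at hne
      exact absurd rfl hne

/-- The same argument for the chain read backwards, as a lost corner ends at the reverse of `a₂ k`.
-/
theorem reach_a₂ {k : ℕ} (hk : k ≤ g.m₂.length) {d : Δ₂.D}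
    (hd : Δ₂.init d = Δ₂.walkVert Δ₂.base g.m₂ k) :
    ReflTransGen g.Turn (g.jD (Δ₂.rev (g.a₂ k))) (g.jD d) := by
  have h := reflTransGen_bypass (reflTransGen_swap.2 (Δ₂.vertex_link (Δ₂.rev (g.a₂ k)) d (by
    rw [hd, DartGraph.init_rev, g.term_a₂ hk])))
  induction h using ReflTransGen.head_induction_on with
  | refl => exact .refl
  | head h h' ih =>
    obtain ⟨⟨o, ho⟩, hne⟩ := h
    refine .tail (ih ((init_eq_of_turn ho).symm.trans hd)) ?_
    rcases g.turn_jD ho with h | ⟨k', hk', h, -⟩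
    · exact h
    · have h2 := g.term_a₂ hk'
      rw [← h, DartGraph.term_rev, hd] at h2
      obtain rfl := g.simple _ _ hk hk' h2
      exact absurd (by rw [← h, Δ₂.rev_rev]) hne

theorem reach_jD {d d' : Δ₂.D} (hdd : Δ₂.init d = Δ₂.init d') (hd : Δ₂.init d ∉ Set.range g.arcVert) :
    ReflTransGen g.Turn (g.jD d) (g.jD d') := by
  have h := Δ₂.vertex_link d d' hdd
  clear hdd
  induction h using ReflTransGen.head_induction_on with
  | refl => exact .refl
  | head h h' ih =>
    obtain ⟨o, ho⟩ := h
    refine .head ?_ (ih (by rw [init_eq_of_turn ho]; exact hd))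
    rcases g.turn_jD ho with h | ⟨k', hk', -, rfl⟩
    · exact h
    · rw [g.init_b₂ hk'] at hd
      exact absurd ⟨⟨k', Nat.lt_succ_iff.2 hk'⟩, rfl⟩ hd

theorem exists_reach_inl (x : g.D) : (∃ d, g.init x = .inl (Δ₁.init d) ∧
    ReflTransGen g.Turn x (.inl d)) ∨ ∃ e, x = g.jD e ∧ Δ₂.init e ∉ Set.range g.arcVert := by
  rcases x with d | e
  · exact Or.inl ⟨d, rfl, .refl⟩
  · rw [← g.jD_off e]
    by_cases h : Δ₂.init e ∈ Set.range g.arcVert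
    · obtain ⟨k, hk⟩ := h
      have hk' := Nat.lt_succ_iff.1 k.2
      refine Or.inl ⟨g.b₁ k, ?_, (g.reach_b₂ hk' hk.symm).trans (g.reach_in hk')⟩
      rw [init_jD, ← hk, g.init_b₁ (by rwa [g.length_eq])]
      exact g.jV_arc k hk'
    · exact Or.inr ⟨e, rfl, h⟩

theorem exists_reach_of_inl (x : g.D) : (∃ d, g.init x = .inl (Δ₁.init d) ∧
    ReflTransGen g.Turn (.inl d) x) ∨ ∃ e, x = g.jD e ∧ Δ₂.init e ∉ Set.range g.arcVert := by
  rcases x with d | e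
  · exact Or.inl ⟨d, rfl, .refl⟩
  · rw [← g.jD_off e]
    by_cases h : Δ₂.init e ∈ Set.range g.arcVert
    · obtain ⟨k, hk⟩ := h
      have hk' := Nat.lt_succ_iff.1 k.2
      refine Or.inl ⟨Δ₁.rev (g.a₁ k), ?_, (g.reach_out hk').trans (g.reach_a₂ hk' hk.symm)⟩
      rw [init_jD, ← hk, DartGraph.init_rev, g.term_a₁ (by rwa [g.length_eq])]
      exact g.jV_arc k hk'
    · exact Or.inr ⟨e, rfl, h⟩

/-- At a vertex of the first diagram, move to edges of that diagram, use its link with detours, and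
move back. At the remaining vertices the link of the second diagram is untouched. -/
theorem vertex_link (x y : g.D) (h : g.init x = g.init y) : ReflTransGen g.Turn x y := by
  have hoff : ∀ e, Δ₂.init e ∉ Set.range g.arcVert → ∃ v, g.init (g.jD e) = .inr v ∧ v.1 = Δ₂.init e :=
    fun e he => ⟨⟨_, he⟩, by rw [init_jD, g.jV_off ⟨_, he⟩], rfl⟩
  rcases g.exists_reach_inl x with ⟨d, h1, h2⟩ | ⟨e, rfl, h1⟩
  · rcases g.exists_reach_of_inl y with ⟨d', h1', h2'⟩ | ⟨e', rfl, h1'⟩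
    · rw [h1, h1'] at h
      refine (h2.trans (g.link_inl (Sum.inl_injective h) fun k hk => ?_)).trans h2'
      exact g.reach_a₂ hk (g.init_b₂ hk)
    · obtain ⟨v, hv, -⟩ := hoff e' h1'
      rw [h1, hv] at h
      exact absurd h (by simp)
  · obtain ⟨v, hv, hv'⟩ := hoff e h1
    rcases g.exists_reach_of_inl y with ⟨d', h1', h2'⟩ | ⟨e', rfl, h1'⟩
    · rw [h1', hv] at h
      exact absurd h (by simp)
    · obtain ⟨v', hw, hw'⟩ := hoff e' h1'
      rw [hv, hw] at h
      refine g.reach_jD ?_ h1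
      rw [← hv', ← hw', Sum.inr_injective h]

end Gluing
end VanKampenDiagram

/-! ### Maps into glued diagrams -/

namespace VanKampenDiagram

open CombComplex

variable {G : Type*} [Group G] {P : SymmPresentation G} {w₁ w₂ : List P.A}

/-- A cellular map of diagrams that preserves basepoints, labels and projections. -/
structure IsDiagramMap {w w' : List P.A} (Δ : VanKampenDiagram P w) (Δ' : VanKampenDiagram P w')
    (π : Δ.Space → P.cayleyComplex.Space) (π' : Δ'.Space → P.cayleyComplex.Space)
    (jV : Δ.V → Δ'.V) (jD : Δ.D → Δ'.D) (ι : Δ.Space → Δ'.Space) : Prop where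
  continuous : Continuous ι
  base : jV Δ.base = Δ'.base
  vert : ∀ v, ι (Δ.vert v) = Δ'.vert (jV v)
  edge : ∀ d t, ι (Δ.edgePt d t) = Δ'.edgePt (jD d) t
  rev : ∀ d, jD (Δ.rev d) = Δ'.rev (jD d)
  label : ∀ d, Δ'.label (jD d) = Δ.label d
  proj : ∀ p, π' (ι p) = π p

namespace Gluing

variable {Δ₁ : VanKampenDiagram P w₁} {Δ₂ : VanKampenDiagram P w₂} (g : Gluing Δ₁ Δ₂)

/-- The union of two diagrams along a common part of their boundaries. -/
def diagram : VanKampenDiagram P (g.l₁.map Δ₁.label ++ g.l₂.map Δ₂.label) where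
  toCombComplex := g.complex
  finite_V := by
    have := Δ₁.finite_V
    have := Δ₂.finite_V
    exact inferInstanceAs (Finite g.V)
  finite_D := by
    have := Δ₁.finite_D
    have := Δ₂.finite_D
    exact inferInstanceAs (Finite g.D)
  finite_F := by
    have := Δ₁.finite_F
    have := Δ₂.finite_F
    exact inferInstanceAs (Finite (Δ₁.F ⊕ Δ₂.F))
  base := .inl Δ₁.base
  label := g.label
  label_rev d := by
    rcases g.D_cases d with ⟨e, rfl⟩ | ⟨e, -, rfl⟩
    · exact Δ₁.label_rev e
    · change g.label (g.rev (g.jD e)) = _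
      rw [rev_jD, label_jD, label_jD, Δ₂.label_rev]
  boundary := g.bd
  boundary_walk := g.bd_walk
  boundary_label := by
    refine (List.map_append (f := g.label)).trans ?_
    rw [List.map_map, List.map_map]
    refine congrArg _ (List.map_congr_left fun d _ => g.label_jD d)
  bdry_label f := by
    rcases f with f | f
    · refine Eq.mpr (congrArg (· ∈ P.R) ?_) (Δ₁.bdry_label f)
      exact List.map_map
    · refine Eq.mpr (congrArg (· ∈ P.R) ?_) (Δ₂.bdry_label f)
      exact List.map_map.trans (List.map_congr_left fun d _ => g.label_jD d)
  connected v := by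
    rcases g.V_cases v with ⟨u, rfl⟩ | ⟨u, -, rfl⟩
    · obtain ⟨l, hl⟩ := Δ₁.connected u
      exact ⟨_, g.isWalk_inl hl⟩
    · obtain ⟨l, hl⟩ := Δ₂.connected u
      have := g.isWalk_jD hl
      rw [jV_base] at this
      exact ⟨_, this⟩
  faceWalk := g.faceWalk
  faceWalk_none := rfl
  faceWalk_some _ := rfl
  left_face := g.left_face
  vertex_link := g.vertex_link
  euler := by
    have := Δ₁.finite_F
    have := Δ₂.finite_F
    have h1 := g.card_V
    have h2 := g.card_D
    have h3 := Δ₁.euler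
    have h4 := Δ₂.euler
    change 2 * Nat.card g.V + 2 * Nat.card (Δ₁.F ⊕ Δ₂.F) = Nat.card g.D + 2
    rw [show Nat.card (Δ₁.F ⊕ Δ₂.F) = _ from Nat.card_sum]
    -- An arc with n edges has n + 1 vertices, so V - E drops by 1 relative to the sum of the two
    -- diagrams, as the formula requires.
    omega

/-- The two projections agree on the arc because both start at the identity and read the same labels
there. -/
theorem exists_maps {π₁ : Δ₁.Space → P.cayleyComplex.Space} {π₂ : Δ₂.Space → P.cayleyComplex.Space}
    (hπ₁ : Δ₁.IsProjection π₁) (hπ₂ : Δ₂.IsProjection π₂) :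
    ∃ (ι₁ : Δ₁.Space → g.diagram.Space) (ι₂ : Δ₂.Space → g.diagram.Space)
      (π : g.diagram.Space → P.cayleyComplex.Space), g.diagram.IsProjection π ∧
      Δ₁.IsDiagramMap g.diagram π₁ π .inl .inl ι₁ ∧
      Δ₂.IsDiagramMap g.diagram π₂ π g.jV g.jD ι₂ := by
  obtain ⟨φ₁, p1, p2, p3, p4⟩ := hπ₁
  obtain ⟨φ₂, q1, q2, q3, q4⟩ := hπ₂
  have hφ₁ : Δ₁.IsLabelling π₁ φ₁ := ⟨p1, p2, p3⟩
  have hφ₂ : Δ₂.IsLabelling π₂ φ₂ := ⟨q1, q2, q3⟩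
  obtain ⟨ι₁, i1, i2, i3, i4⟩ := exists_cellMap (K := Δ₁.toCombComplex)
    (K' := g.diagram.toCombComplex) .inl .inl .inl (fun _ => rfl) (fun _ => rfl) (fun _ => rfl)
  obtain ⟨ι₂, j1, j2, j3, j4⟩ := exists_cellMap (K := Δ₂.toCombComplex)
    (K' := g.diagram.toCombComplex) g.jV g.jD .inr (fun d => (g.rev_jD d).symm) g.init_jD
    (fun _ => rfl)
  let φ : g.V → G := Sum.elim φ₁ fun v => φ₂ v
  have hφ : ∀ v, φ (g.jV v) = φ₂ v := by
    intro v
    by_cases hv : v ∈ Set.range g.arcVert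
    · obtain ⟨k, rfl⟩ := hv
      have hk := Nat.lt_succ_iff.1 k.2
      obtain ⟨v₁, h1, -⟩ := g.walk_m₁
      obtain ⟨v₂, h2, -⟩ := g.walk_m₂
      have h3 := hφ₁.walkVert h1 k (by rwa [g.length_eq])
      have h4 := hφ₂.walkVert h2 k hk
      rw [arcVert, g.jV_arc k hk, h4, ← g.label_eq, q1, ← p1]
      exact h3
    · rw [g.jV_off ⟨v, hv⟩]; rfl
  let e : g.D → unitInterval → P.cayleyComplex.Space := fun d t =>
    P.cayleyComplex.edgePt (P.cdart (φ (g.init d)) (g.label d)) t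
  have he₁ : ∀ d t, e (.inl d) t = π₁ (Δ₁.edgePt d t) := fun d t => (p3 d t).symm
  have he₂ : ∀ d t, e (g.jD d) t = π₂ (Δ₂.edgePt d t) := fun d t => by
    simp only [e, init_jD, hφ, label_jD]; exact (q3 d t).symm
  have he₀ : ∀ d, e d 0 = P.cayleyComplex.vert (P.cvert (φ (g.init d))) := fun d =>
    edgePt_zero _
  obtain ⟨π, r1, r2, r3⟩ := exists_lift (K := g.diagram.toCombComplex)
    (fun v => P.cayleyComplex.vert (P.cvert (φ v))) e
    (fun f => Sum.elim (fun f z => π₁ (Δ₁.facePt f z)) (fun f z => π₂ (Δ₂.facePt f z)) f)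
    (fun d t => by
      rcases g.D_cases d with ⟨d, rfl⟩ | ⟨d, -, rfl⟩
      · rw [he₁]
        refine (he₁ (Δ₁.rev d) _).trans (congrArg π₁ (edgePt_rev d t))
      · rw [he₂]
        refine (congrArg (fun d => e d _) (g.rev_jD d)).trans ?_
        exact (he₂ (Δ₂.rev d) _).trans (congrArg π₂ (edgePt_rev d t)))
    he₀
    (fun f k hk t => by
      rcases f with f | f
      · have hlen : (g.diagram.bdry (.inl f)).length = (Δ₁.bdry f).length := List.length_map _
        have hk' : k < (Δ₁.bdry f).length := hlen ▸ hk
        have h1 : (g.diagram.bdry (.inl f))[k]'hk = .inl (Δ₁.bdry f)[k] := List.getElem_map _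
        rw [hlen]
        refine (congrArg π₁ (facePt_circlePt f k hk' t)).trans ?_
        exact (he₁ _ t).symm.trans (congrArg (fun d => e d t) h1.symm)
      · have hlen : (g.diagram.bdry (.inr f)).length = (Δ₂.bdry f).length := List.length_map _
        have hk' : k < (Δ₂.bdry f).length := hlen ▸ hk
        have h1 : (g.diagram.bdry (.inr f))[k]'hk = g.jD (Δ₂.bdry f)[k] := List.getElem_map _
        rw [hlen]
        refine (congrArg π₂ (facePt_circlePt f k hk' t)).trans ?_
        exact (he₂ _ t).symm.trans (congrArg (fun d => e d t) h1.symm))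
  refine ⟨ι₁, ι₂, π, ⟨φ, p1, r1, r2, fun f => ?_⟩,
    ⟨i1, rfl, i2, i3, fun _ => rfl, fun _ => rfl, fun p => ?_⟩,
    ⟨j1, g.jV_base, j2, j3, fun d => (g.rev_jD d).symm, g.label_jD, fun p => ?_⟩⟩
  · rcases f with f | f
    · obtain ⟨f', ρ, h⟩ := p4 f
      exact ⟨f', ρ, fun z => (r3 _ z).trans (h z)⟩
    · obtain ⟨f', ρ, h⟩ := q4 f
      exact ⟨f', ρ, fun z => (r3 _ z).trans (h z)⟩
  · refine space_cases (motive := fun p => π (ι₁ p) = π₁ p) p (fun v => ?_) (fun d t => ?_)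
      fun f z => ?_
    · rw [i2]; exact (r1 _).trans (p2 v).symm
    · rw [i3]; exact (r2 _ t).trans (he₁ d t)
    · rw [i4]; exact r3 _ z
  · refine space_cases (motive := fun p => π (ι₂ p) = π₂ p) p (fun v => ?_) (fun d t => ?_)
      fun f z => ?_
    · rw [j2]; exact (r1 _).trans ((congrArg (fun a => P.cayleyComplex.vert (P.cvert a))
        (hφ v)).trans (q2 v).symm)
    · rw [j3]; exact (r2 _ t).trans (he₂ d t)
    · rw [j4]; exact r3 _ z

theorem exists_union {π₁ : Δ₁.Space → P.cayleyComplex.Space}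
    {π₂ : Δ₂.Space → P.cayleyComplex.Space} (hπ₁ : Δ₁.IsProjection π₁) (hπ₂ : Δ₂.IsProjection π₂) :
    ∃ (w : List P.A) (Δ : VanKampenDiagram P w) (π : Δ.Space → P.cayleyComplex.Space)
      (jV₁ : Δ₁.V → Δ.V) (jD₁ : Δ₁.D → Δ.D) (ι₁ : Δ₁.Space → Δ.Space)
      (jV₂ : Δ₂.V → Δ.V) (jD₂ : Δ₂.D → Δ.D) (ι₂ : Δ₂.Space → Δ.Space),
      Δ.IsProjection π ∧ Δ₁.IsDiagramMap Δ π₁ π jV₁ jD₁ ι₁ ∧ Δ₂.IsDiagramMap Δ π₂ π jV₂ jD₂ ι₂ ∧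
      Δ.boundary = g.l₁.map jD₁ ++ g.l₂.map jD₂ ∧ g.m₂.map jD₂ = g.m₁.map jD₁ := by
  obtain ⟨ι₁, ι₂, π, hπ, h1, h2⟩ := g.exists_maps hπ₁ hπ₂
  exact ⟨_, g.diagram, π, .inl, .inl, ι₁, g.jV, g.jD, ι₂, hπ, h1, h2, rfl, g.map_jD⟩

end Gluing
end VanKampenDiagram

/-! ### Strips over the edges of the Cayley graph -/

namespace CombComplex

variable {K : CombComplex}

/-- A path without repeated vertices is injective. -/
theorem walkPt_injOn {l : List K.D} {u v : K.V} (h : K.IsWalk l u v)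
    (hs : ∀ i j, i ≤ l.length → j ≤ l.length → K.walkVert u l i = K.walkVert u l j → i = j)
    {x y : ℝ} (hx0 : 0 ≤ x) (hx1 : x ≤ l.length) (hy0 : 0 ≤ y) (hy1 : y ≤ l.length)
    (hxy : K.walkPt u l x = K.walkPt u l y) : x = y := by
  rcases Nat.eq_zero_or_pos l.length with hl | hl
  · rw [hl] at hx1 hy1
    simp only [Nat.cast_zero] at hx1 hy1
    linarith
  have hvert : ∀ {k : ℕ} {t : unitInterval} (hk : k < l.length) {z : K.V},
      K.edgePt l[k] t = K.vert z → ∃ i ≤ l.length, (k : ℝ) + t = i ∧ z = K.walkVert u l i := by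
    intro k t hk z hz
    rcases edgePt_eq_vert_iff.1 hz with ⟨rfl, rfl⟩ | ⟨rfl, rfl⟩
    · exact ⟨k, hk.le, by simp, h.init_getElem k hk⟩
    · exact ⟨k + 1, hk, by simp, h.term_getElem' k hk⟩
  obtain ⟨k, t, hk, rfl⟩ := exists_nat_add_unit hl hx0 hx1
  obtain ⟨k', t', hk', rfl⟩ := exists_nat_add_unit hl hy0 hy1
  rw [walkPt_edge h k hk, walkPt_edge h k' hk'] at hxy
  by_cases hz : ∃ z, K.edgePt l[k] t = K.vert z
  · obtain ⟨z, hz⟩ := hz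
    obtain ⟨i, hi, h1, h2⟩ := hvert hk hz
    obtain ⟨j, hj, h3, h4⟩ := hvert hk' (hxy.symm.trans hz)
    rw [h1, h3, hs i j hi hj (h2.symm.trans h4)]
  · have h0 : t ≠ 0 := by rintro rfl; exact hz ⟨_, edgePt_zero _⟩
    have h1 : t ≠ 1 := by rintro rfl; exact hz ⟨_, edgePt_one _⟩
    rcases edgePt_eq_edgePt h0 h1 hxy with ⟨e, rfl⟩ | ⟨e, -⟩
    · have := hs k' k hk'.le hk.le (by
        rw [← h.init_getElem k hk, ← h.init_getElem k' hk', e])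
      rw [this]
    · have e1 := hs k' (k + 1) hk'.le hk (by
        rw [← h.init_getElem k' hk', ← h.term_getElem' k hk, e]; rfl)
      have e2 := hs (k' + 1) k hk' hk.le (by
        rw [← h.term_getElem' k' hk', ← h.init_getElem k hk, e, DartGraph.term_rev])
      omega

end CombComplex

namespace VanKampenDiagram

open CombComplex

variable {G : Type*} [Group G] {P : SymmPresentation G} {w : List P.A}

/-- Distinct images in the Cayley graph force distinct vertices in the diagram. -/
theorem IsLabelling.simple {Δ : VanKampenDiagram P w} {π : Δ.Space → P.cayleyComplex.Space}
    {φ : Δ.V → G} (h : Δ.IsLabelling π φ) {l : List Δ.D} {u v : Δ.V} (hl : Δ.IsWalk l u v)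
    (hs : P.IsSimpleWord (l.map Δ.label)) (i j : ℕ) (hi : i ≤ l.length) (hj : j ≤ l.length)
    (hij : Δ.walkVert u l i = Δ.walkVert u l j) : i = j := by
  have h1 := h.walkVert hl i hi
  rw [hij, h.walkVert hl j hj] at h1
  have h2 := mul_left_cancel h1
  rcases lt_trichotomy i j with hlt | rfl | hlt
  · exact absurd h2.symm (hs i j hlt (by simpa using hj))
  · rfl
  · exact absurd h2 (hs j i hlt (by simpa using hi))

/-- A family of paths to the points of the boundary edge `d` whose paths to the endpoints follow
the two parts of the boundary, with given parametrizations. -/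
structure IsStrip (Δ : VanKampenDiagram P w) (l₁ : List Δ.D) (d : Δ.D) (l₂ : List Δ.D)
    (H₀ H₁ : unitInterval → ℝ) (Θ : unitInterval → unitInterval → Δ.Space) : Prop where
  boundary_eq : Δ.boundary = l₁ ++ d :: l₂
  continuous : Continuous fun q : unitInterval × unitInterval => Θ q.1 q.2
  start : ∀ τ, Θ τ 0 = Δ.vert Δ.base
  finish : ∀ τ, Θ τ 1 = Δ.edgePt d τ
  init : ∀ t, Θ 0 t = Δ.walkPt Δ.base l₁ (H₀ t)
  term : ∀ t, Θ 1 t = Δ.walkPt Δ.base (Δ.revWalk l₂) (H₁ t)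

end VanKampenDiagram

namespace SymmPresentation

open CombComplex VanKampenDiagram

variable {G : Type*} [Group G] {P : SymmPresentation G}

theorem IsSimpleWord.walkVert {v : List P.A} (hs : P.IsSimpleWord v) (i j : ℕ)
    (hi : i ≤ (P.cpath 1 v).length) (hj : j ≤ (P.cpath 1 v).length)
    (hij : P.cayleyComplex.walkVert P.origin (P.cpath 1 v) i =
      P.cayleyComplex.walkVert P.origin (P.cpath 1 v) j) : i = j := by
  rw [length_cpath] at hi hj
  have h : ∀ k ≤ v.length, P.cayleyComplex.walkVert P.origin (P.cpath 1 v) k =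
    P.cvert (1 * P.eval (v.take k)) := P.walkVert_cpath 1 v
  rw [h i hi, h j hj] at hij
  have h2 := mul_left_cancel (P.cvert_injective hij)
  rcases lt_trichotomy i j with hlt | rfl | hlt
  · exact absurd h2 (hs i j hlt hj)
  · rfl
  · exact absurd h2.symm (hs j i hlt hi)

/-- The paths of a diagrammatic combing, seen in diagrams. -/
structure IsStripFamily (P : SymmPresentation G)
    (Υ : P.cayleyComplex.oneSkeleton → unitInterval → P.cayleyComplex.Space) (word : G → List P.A)
    (H : G → unitInterval → ℝ) : Prop where
  word_one : word 1 = []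
  simple : ∀ g, P.IsSimpleWord (word g)
  mono : ∀ g, Monotone (H g)
  zero : ∀ g, H g 0 = 0
  one : ∀ g, H g 1 = (word g).length
  strip : ∀ (u : G) (a : P.A), ∃ (w : List P.A) (Δ : VanKampenDiagram P w) (l₁ : List Δ.D) (d : Δ.D)
    (l₂ : List Δ.D) (Θ : unitInterval → unitInterval → Δ.Space)
    (π : Δ.Space → P.cayleyComplex.Space), l₁.map Δ.label = word u ∧ Δ.label d = a ∧
      l₂.map Δ.label = invWord P.inv (word (u * P.rep a)) ∧
      Δ.IsStrip l₁ d l₂ (H u) (H (u * P.rep a)) Θ ∧ Δ.IsProjection π ∧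
      ∀ τ, ∃ q, ∀ t, π (Θ τ t) = Υ q t

/-- The point is that `H g` depends only on the group element: strips sharing a side then carry the
same parametrized path on it and can be glued. -/
theorem IsDiagrammatic.exists_stripFamily
    {Υ : P.cayleyComplex.oneSkeleton → unitInterval → P.cayleyComplex.Space}
    (h : P.IsDiagrammatic Υ) : ∃ word H, P.IsStripFamily Υ word H := by
  obtain ⟨hΥ, word, hword, hedge⟩ := h
  let pt : G → P.cayleyComplex.oneSkeleton := fun g =>
    ⟨P.cayleyComplex.vert (P.cvert g), vert_mem_oneSkeleton _⟩
  have hwalk : ∀ g, P.cayleyComplex.IsWalk (P.cpath 1 (word g)) P.origin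
    (P.cvert (P.eval (word g))) := fun g => P.isWalk_cpath_one (word g)
  have hH := fun g => Follows.exists_walkPt (hwalk g) ((hword g).2 (pt g) rfl)
  choose H hH1 hH2 hH3 hH4 hH5 using hH
  have hlen : ∀ g, ((P.cpath 1 (word g)).length : ℝ) = (word g).length := fun g => by
    rw [length_cpath]
  have heval : ∀ g, P.eval (word g) = g := by
    intro g
    have h1 := hH5 g 1
    rw [hΥ.finish, hH4, walkPt_of_ge (hwalk g) le_rfl] at h1
    exact (P.cvert_injective (vert_injective h1)).symm
  refine ⟨word, H, ?_, fun g => (hword g).1, hH2, hH3, fun g => by rw [hH4, hlen], fun u a => ?_⟩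
  · by_contra hne
    -- The word of the identity ends where it begins, so simplicity makes it empty.
    refine (hword 1).1 0 (word 1).length (List.length_pos_iff.2 hne) le_rfl ?_
    rw [List.take_length, heval]; rfl
  · obtain ⟨Δ, l₁, d, l₂, θ, π, hl, hθ, hπ, hΥθ⟩ := hedge u a
    obtain ⟨φ, hφ⟩ := hπ.exists_labelling
    have hb := hθ.boundary_eq
    have hlab := Δ.boundary_label
    rw [hb, List.map_append, List.map_cons] at hlab
    obtain ⟨e1, e2⟩ := List.append_inj hlab (by simpa using hl)
    obtain ⟨e2, e3⟩ := List.cons.inj e2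
    have hw1 := walk_left hb
    have hw2 := (walk_right hb).revWalk
    have e4 : (Δ.revWalk l₂).map Δ.label = word (u * P.rep a) := by
      rw [label_revWalk, e3, invWord_invWord]
    have hinit : φ (Δ.init d) = u := by
      rw [hφ.walk_end hw1, hφ.base, e1, heval, one_mul]
    have hterm : φ (Δ.term d) = u * P.rep a := by rw [hφ.term, hinit, e2]
    have hkey : ∀ (g : G) (l : List Δ.D) (v : Δ.V) (p : Δ.closedEdge d), Δ.IsWalk l Δ.base v →
        l.map Δ.label = word g → (p : Δ.Space) = Δ.vert v → φ v = g → Δ.Follows Δ.base l (θ p) →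
        ∀ t, θ p t = Δ.walkPt Δ.base l (H g t) := by
      intro g l v p hl hlg hp hv hfol t
      obtain ⟨s, -, hs2, hs3, hs4, hs5⟩ := Follows.exists_walkPt hl hfol
      have hll : (l.length : ℝ) = (word g).length := by
        exact_mod_cast by simpa using congrArg List.length hlg
      have h1 := hΥθ p (pt g) t (by rw [hp, hφ.vert, hv])
      rw [hH5, hs5, hφ.walkPt_base hl, hlg] at h1
      rw [hs5]
      congr 1
      -- The parametrization in the diagram and that of the combing trace the same points of a
      -- simple path, so they coincide.
      refine (walkPt_injOn (hwalk g) (hword g).1.walkVert ?_ ?_ ?_ ?_ h1).symm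
      · rw [← hH3 g]; exact hH2 g unitInterval.nonneg'
      · rw [← hH4 g]; exact hH2 g unitInterval.le_one'
      · rw [← hs3]; exact hs2 unitInterval.nonneg'
      · rw [hlen, ← hll, ← hs4]; exact hs2 unitInterval.le_one'
    refine ⟨_, Δ, l₁, d, l₂, fun τ => θ ⟨Δ.edgePt d τ, edgePt_mem_closedEdge d τ⟩, π, e1, e2, e3,
      ⟨hb, ?_, fun τ => hθ.combing.start _, fun τ => hθ.combing.finish _, ?_, ?_⟩, hπ, fun τ => ?_⟩
    · have : Continuous fun q : unitInterval × unitInterval =>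
          ((⟨Δ.edgePt d q.1, edgePt_mem_closedEdge d q.1⟩ : Δ.closedEdge d), q.2) :=
        (Continuous.subtype_mk ((continuous_edgePt d).comp continuous_fst) _).prodMk continuous_snd
      exact hθ.combing.continuous.comp this
    · exact hkey u l₁ _ _ hw1 e1 (edgePt_zero d) hinit (hθ.follows_init _ (edgePt_zero d))
    · exact hkey _ _ _ _ hw2 e4 (edgePt_one d) hterm (hθ.follows_term _ (edgePt_one d))
    · refine ⟨⟨π (Δ.edgePt d τ), ?_⟩, fun t => (hΥθ _ _ t rfl).symm⟩
      rw [hφ.edge]; exact edgePt_mem_oneSkeleton _ _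

end SymmPresentation

/-! ### Fans of strips -/

namespace VanKampenDiagram.IsDiagramMap

open CombComplex

variable {G : Type*} [Group G] {P : SymmPresentation G} {w w' : List P.A}
  {Δ : VanKampenDiagram P w} {Δ' : VanKampenDiagram P w'}
  {π : Δ.Space → P.cayleyComplex.Space} {π' : Δ'.Space → P.cayleyComplex.Space}
  {jV : Δ.V → Δ'.V} {jD : Δ.D → Δ'.D} {ι : Δ.Space → Δ'.Space}
  (h : Δ.IsDiagramMap Δ' π π' jV jD ι)
include h

theorem walkPt_base (l : List Δ.D) (x : ℝ) :
    ι (Δ.walkPt Δ.base l x) = Δ'.walkPt Δ'.base (l.map jD) x := by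
  rw [map_walkPt h.vert h.edge, h.base]

theorem isWalk {l : List Δ.D} {v : Δ.V} (hl : Δ.IsWalk l Δ.base v) :
    Δ'.IsWalk (l.map jD) Δ'.base (jV v) := by
  rw [← h.base]; exact isWalk_map h.vert h.edge hl

theorem map_label (l : List Δ.D) : (l.map jD).map Δ'.label = l.map Δ.label := by
  rw [List.map_map]; exact List.map_congr_left fun d _ => h.label d

theorem revWalk (l : List Δ.D) : Δ'.revWalk (l.map jD) = (Δ.revWalk l).map jD := by
  induction l with
  | nil => rfl
  | cons d l ih => simp [ih, h.rev]

end VanKampenDiagram.IsDiagramMap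

namespace SymmPresentation

open CombComplex VanKampenDiagram

variable {G : Type*} [Group G] {P : SymmPresentation G}

/-- A diagram glued from the strips of a combing along a path labelled `v`. -/
structure IsFan (Υ : P.cayleyComplex.oneSkeleton → unitInterval → P.cayleyComplex.Space)
    (word : G → List P.A) (H : G → unitInterval → ℝ) (v : List P.A) {w : List P.A}
    (Δ : VanKampenDiagram P w) (π : Δ.Space → P.cayleyComplex.Space) (l m : List Δ.D)
    (Φ : ℝ → unitInterval → Δ.Space) : Prop where
  boundary_eq : Δ.boundary = l ++ Δ.revWalk m
  label_left : l.map Δ.label = v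
  label_right : m.map Δ.label = word (P.eval v)
  proj : Δ.IsProjection π
  continuous : Continuous fun q : ℝ × unitInterval => Φ q.1 q.2
  start : ∀ x, Φ x 0 = Δ.vert Δ.base
  finish : ∀ x : ℝ, 0 ≤ x → x ≤ l.length → Φ x 1 = Δ.walkPt Δ.base l x
  lift : ∀ x, ∃ q, ∀ t, π (Φ x t) = Υ q t
  arc : ∀ i ≤ l.length, ∃ m' u, Δ.IsWalk m' Δ.base u ∧
    m'.map Δ.label = word (P.eval (v.take i)) ∧
    ∀ t, Φ i t = Δ.walkPt Δ.base m' (H (P.eval (v.take i)) t)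
  last : ∀ t, Φ l.length t = Δ.walkPt Δ.base m (H (P.eval v) t)

variable {Υ : P.cayleyComplex.oneSkeleton → unitInterval → P.cayleyComplex.Space}
    {word : G → List P.A} {H : G → unitInterval → ℝ}

/-- The strip at the identity has an empty first side, since the word of the identity is empty; it
is a fan by itself. -/
theorem IsStripFamily.exists_fan_singleton (h : P.IsStripFamily Υ word H) (a : P.A) :
    ∃ (w : List P.A) (Δ : VanKampenDiagram P w) (π : Δ.Space → P.cayleyComplex.Space)
      (l m : List Δ.D) (Φ : ℝ → unitInterval → Δ.Space), IsFan Υ word H [a] Δ π l m Φ := by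
  obtain ⟨w, Δ, l₁, d, l₂, Θ, π, e1, e2, e3, hΘ, hπ, hΥ⟩ := h.strip 1 a
  have hl₁ : l₁ = [] := by simpa [h.word_one] using e1
  subst hl₁
  have hb := hΘ.boundary_eq
  have he : P.eval [a] = 1 * P.rep a := by simp
  have hw := walk_right hb
  have hd : Δ.init d = Δ.base := (walk_left hb).symm
  have hd1 : Δ.IsWalk [d] Δ.base (Δ.term d) := ⟨hd, rfl⟩
  refine ⟨w, Δ, π, [d], Δ.revWalk l₂, fun x t => Θ (Set.projIcc 0 1 zero_le_one x) t, ?_, ?_, ?_,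
    hπ, ?_, fun x => hΘ.start _, ?_, fun x => hΥ _, ?_, ?_⟩
  · rw [hb, DartGraph.revWalk_revWalk]; rfl
  · simp [e2]
  · rw [label_revWalk, e3, invWord_invWord, he]
  · have : Continuous fun q : ℝ × unitInterval =>
        (Set.projIcc (0 : ℝ) 1 zero_le_one q.1, q.2) := by fun_prop
    exact hΘ.continuous.comp this
  · intro x h0 h1
    rw [hΘ.finish]
    have h2 : x ∈ Set.Icc (0 : ℝ) 1 := ⟨h0, by simpa using h1⟩
    have := walkPt_edge hd1 0 (by simp) ⟨x, h2⟩
    rw [Set.projIcc_of_mem zero_le_one h2]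
    simpa using this.symm
  · intro i hi
    have hi : i = 0 ∨ i = 1 := by
      simp at hi; omega
    rcases hi with rfl | rfl
    · refine ⟨[], _, rfl, by simp [h.word_one], fun t => ?_⟩
      have := hΘ.init t
      simpa using this
    · refine ⟨Δ.revWalk l₂, _, hw.revWalk, ?_, fun t => ?_⟩
      · rw [label_revWalk, e3, invWord_invWord]; simp
      · have := hΘ.term t
        simpa using this
  · intro t
    have := hΘ.term t
    simpa using this

/-- The last side of the fan and the first side of the next strip have the same label. Gluing along
them matches the path families, which on this side use the same `H`. -/
theorem IsFan.exists_append (h : P.IsStripFamily Υ word H) {v w : List P.A}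
    {Δ₁ : VanKampenDiagram P w} {π₁ : Δ₁.Space → P.cayleyComplex.Space} {l m : List Δ₁.D}
    {Φ : ℝ → unitInterval → Δ₁.Space} (hF : IsFan Υ word H v Δ₁ π₁ l m Φ) (hv : v ≠ []) (a : P.A) :
    ∃ (w : List P.A) (Δ : VanKampenDiagram P w) (π : Δ.Space → P.cayleyComplex.Space)
      (l m : List Δ.D) (Φ : ℝ → unitInterval → Δ.Space), IsFan Υ word H (v ++ [a]) Δ π l m Φ := by
  obtain ⟨w₂, Δ₂, l₁, d, l₂, Θ, π₂, e1, e2, e3, hΘ, hπ, hΥ⟩ := h.strip (P.eval v) a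
  obtain ⟨φ₂, hφ₂⟩ := hπ.exists_labelling
  have hb := hΘ.boundary_eq
  let g : Gluing Δ₁ Δ₂ :=
    { l₁ := l, m₁ := m, m₂ := l₁, l₂ := d :: l₂
      boundary₁ := hF.boundary_eq
      boundary₂ := hb
      l₁_ne := fun hl => hv (by rw [← hF.label_left, hl]; rfl)
      l₂_ne := by simp
      label_eq := by rw [hF.label_right, e1]
      simple := hφ₂.simple (walk_left hb) (by rw [e1]; exact h.simple _) }
  obtain ⟨w', Δ, π, jV₁, jD₁, ι₁, jV₂, jD₂, ι₂, hπ', h1, h2, hbd, hmap⟩ := g.exists_union hF.proj hπ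
  have hbd : Δ.boundary = l.map jD₁ ++ jD₂ d :: l₂.map jD₂ := hbd
  have hmap : l₁.map jD₂ = m.map jD₁ := hmap
  have he : P.eval (v ++ [a]) = P.eval v * P.rep a := by simp
  have hlen : (l.map jD₁).length = l.length := List.length_map _
  have hwl := walk_left hbd
  have hwr := walk_right hbd
  have hwl' : Δ.IsWalk (l.map jD₁ ++ [jD₂ d]) Δ.base (Δ.term (jD₂ d)) :=
    hwl.append ⟨rfl, rfl⟩
  have hrev : Δ.revWalk (l₂.map jD₂) = (Δ₂.revWalk l₂).map jD₂ := h2.revWalk l₂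
  have hlab : (Δ.revWalk (l₂.map jD₂)).map Δ.label = word (P.eval v * P.rep a) := by
    rw [hrev]
    refine (h2.map_label _).trans ?_
    rw [label_revWalk, e3, invWord_invWord]
  let pr : ℝ → unitInterval := fun x => Set.projIcc (0 : ℝ) 1 zero_le_one (x - l.length)
  let Φ' : ℝ → unitInterval → Δ.Space := fun x t =>
    if x ≤ l.length then ι₁ (Φ x t) else ι₂ (Θ (pr x) t)
  have hpr0 : ∀ x : ℝ, x ≤ l.length → pr x = 0 := fun x hx =>
    Set.projIcc_of_le_left _ (by linarith)
  have hjoin : ∀ t, ι₁ (Φ l.length t) = ι₂ (Θ 0 t) := by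
    intro t
    rw [hF.last, hΘ.init, h1.walkPt_base, h2.walkPt_base, hmap]
  have hge : ∀ x : ℝ, l.length ≤ x → ∀ t, Φ' x t = ι₂ (Θ (pr x) t) := by
    intro x hx t
    simp only [Φ']
    split_ifs with hx'
    · obtain rfl : x = l.length := le_antisymm hx' hx
      rw [hpr0 _ le_rfl, hjoin]
    · rfl
  have hle : ∀ x : ℝ, x ≤ l.length → ∀ t, Φ' x t = ι₁ (Φ x t) := fun x hx t => if_pos hx
  have hpr1 : pr (l.length + 1) = 1 := Set.projIcc_of_right_le _ (by linarith)
  have hlast : ∀ t, Φ' (l.length + 1) t = Δ.walkPt Δ.base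
      (Δ.revWalk (l₂.map jD₂)) (H (P.eval v * P.rep a) t) := by
    intro t
    rw [hge _ (by linarith), hpr1, hΘ.term, h2.walkPt_base, hrev]
  have hlen' : (l.map jD₁ ++ [jD₂ d]).length = l.length + 1 := by
    rw [List.length_append, hlen]; rfl
  refine ⟨_, Δ, π, l.map jD₁ ++ [jD₂ d], Δ.revWalk (l₂.map jD₂), Φ', ?_, ?_, ?_,
    hπ', ?_, ?_, ?_, ?_, ?_, ?_⟩
  · rw [DartGraph.revWalk_revWalk, hbd]; simp
  · rw [List.map_append]
    refine congrArg₂ _ ((h1.map_label l).trans hF.label_left) ?_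
    exact congrArg (fun a => [a]) ((h2.label d).trans e2)
  · rw [hlab, he]
  · refine Continuous.if_le ?_ ?_ continuous_fst continuous_const ?_
    · exact h1.continuous.comp hF.continuous
    · have : Continuous fun q : ℝ × unitInterval => (pr q.1, q.2) := by
        simp only [pr]; fun_prop
      exact h2.continuous.comp (hΘ.continuous.comp this)
    · rintro ⟨x, t⟩ hx
      simp only at hx
      rw [hx, hjoin, hpr0 _ le_rfl]
  · intro x
    rcases le_total x l.length with hx | hx
    · rw [hle x hx, hF.start, h1.vert, h1.base]
    · rw [hge x hx, hΘ.start, h2.vert, h2.base]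
  · intro x hx0 hx1
    rw [hlen'] at hx1
    push_cast at hx1
    rcases le_total x l.length with hx | hx
    · rw [hle x hx, hF.finish x hx0 hx, h1.walkPt_base]
      exact (walkPt_append_left hwl' (by rw [hlen]; exact hx)).symm
    · rw [hge x hx, hΘ.finish, h2.edge]
      have := walkPt_edge hwl' l.length (by rw [hlen']; omega) (pr x)
      rw [List.getElem_append_right hlen.le] at this
      have e : (l.length : ℝ) + pr x = x := by
        simp only [pr]
        rw [Set.projIcc_of_mem zero_le_one ⟨by linarith, by linarith⟩]
        simp
      rw [e] at this
      rw [this]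
      simp
  · intro x
    rcases le_total x l.length with hx | hx
    · obtain ⟨q, hq⟩ := hF.lift x
      exact ⟨q, fun t => by rw [hle x hx, h1.proj, hq]⟩
    · obtain ⟨q, hq⟩ := hΥ (pr x)
      exact ⟨q, fun t => by rw [hge x hx, h2.proj, hq]⟩
  · intro i hi
    rw [hlen'] at hi
    rcases Nat.le_or_eq_of_le_succ hi with hi | rfl
    · obtain ⟨m', u, a1, a2, a3⟩ := hF.arc i hi
      have hvl : i ≤ v.length := by
        rw [← hF.label_left, List.length_map]; exact hi
      rw [List.take_append_of_le_length hvl]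
      refine ⟨m'.map jD₁, _, h1.isWalk a1, (h1.map_label m').trans a2, fun t => ?_⟩
      rw [hle _ (by exact_mod_cast hi), a3, h1.walkPt_base]
    · have hvl : (v ++ [a]).take (l.length + 1) = v ++ [a] := by
        refine List.take_of_length_le ?_
        rw [← hF.label_left]; simp
      rw [hvl, he]
      refine ⟨_, _, hwr.revWalk, hlab, fun t => ?_⟩
      push_cast
      exact hlast t
  · intro t
    rw [hlen', he]
    push_cast
    exact hlast t

theorem IsStripFamily.exists_fan (h : P.IsStripFamily Υ word H) {v : List P.A} (hv : v ≠ []) :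
    ∃ (w : List P.A) (Δ : VanKampenDiagram P w) (π : Δ.Space → P.cayleyComplex.Space)
      (l m : List Δ.D) (Φ : ℝ → unitInterval → Δ.Space), IsFan Υ word H v Δ π l m Φ := by
  induction v using List.reverseRecOn with
  | nil => exact absurd rfl hv
  | append_singleton v a ih =>
    by_cases hv' : v = []
    · subst hv'
      exact h.exists_fan_singleton a
    · obtain ⟨w, Δ, π, l, m, Φ, hF⟩ := ih hv'
      exact hF.exists_append h hv' a

/-- A family of paths in a diagram to the points of the boundary path. -/
structure IsBoundaryFamily {w : List P.A} (Δ : VanKampenDiagram P w)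
    (Φ : ℝ → unitInterval → Δ.Space) : Prop where
  continuous : Continuous fun q : ℝ × unitInterval => Φ q.1 q.2
  start : ∀ x, Φ x 0 = Δ.vert Δ.base
  finish : ∀ x : ℝ, 0 ≤ x → x ≤ Δ.boundary.length → Φ x 1 = Δ.walkPt Δ.base Δ.boundary x
  base : ∀ t, Φ 0 t = Δ.vert Δ.base
  oneSkeleton : ∀ i : ℕ, i ≤ Δ.boundary.length → ∀ t, Φ i t ∈ Δ.oneSkeleton
  stable : ∀ i : ℕ, i ≤ Δ.boundary.length → ∀ s t, s ≤ t → Φ i s = Φ i 1 → Φ i t = Φ i 1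

/-- For a word that represents the identity the last side of the fan is empty, so the free side is
the whole boundary. -/
theorem IsStripFamily.exists_boundaryFamily (h : P.IsStripFamily Υ word H) {w : List P.A}
    (hw : w ≠ []) (hw1 : P.eval w = 1) :
    ∃ (Δ : VanKampenDiagram P w) (π : Δ.Space → P.cayleyComplex.Space)
      (Φ : ℝ → unitInterval → Δ.Space), Δ.IsProjection π ∧ IsBoundaryFamily Δ Φ ∧
      ∀ x, ∃ q, ∀ t, π (Φ x t) = Υ q t := by
  obtain ⟨w', Δ, π, l, m, Φ, hF⟩ := h.exists_fan hw
  have hm : m = [] := by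
    have := hF.label_right
    rw [hw1, h.word_one] at this
    simpa using this
  subst hm
  have hb : Δ.boundary = l := by rw [hF.boundary_eq]; simp
  have hww : w' = w := by rw [← Δ.boundary_label, hb, hF.label_left]
  subst hww
  subst hb
  obtain ⟨φ, hφ⟩ := hF.proj.exists_labelling
  refine ⟨Δ, π, Φ, hF.proj, ⟨hF.continuous, hF.start, hF.finish, ?_, ?_, ?_⟩, hF.lift⟩
  · intro t
    obtain ⟨m', u, h1, h2, h3⟩ := hF.arc 0 (Nat.zero_le _)
    have hm : m' = [] := by simpa [h.word_one] using h2
    subst hm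
    have := h3 t
    rw [Nat.cast_zero] at this
    exact this
  · intro i hi t
    obtain ⟨m', u, h1, h2, h3⟩ := hF.arc i hi
    rw [h3]; exact walkPt_mem_oneSkeleton _ _ _
  · intro i hi s t hst hs
    obtain ⟨m', u, h1, h2, h3⟩ := hF.arc i hi
    set g := P.eval (w'.take i)
    have hlen : (m'.length : ℝ) = (word g).length := by
      exact_mod_cast by simpa using congrArg List.length h2
    rw [h3, h3, h.one, ← hlen] at hs
    have hb : ∀ t, 0 ≤ H g t ∧ H g t ≤ m'.length := fun t => by
      rw [hlen, ← h.zero g, ← h.one g]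
      exact ⟨h.mono g unitInterval.nonneg', h.mono g unitInterval.le_one'⟩
    -- The path to a boundary vertex runs monotonically along a simple path, so it can reach the end
    -- only at full length and stays there.
    have hs' := walkPt_injOn h1 (hφ.simple h1 (by rw [h2]; exact h.simple _)) (hb s).1 (hb s).2
      (by positivity) le_rfl hs
    rw [h3, h3, h.one, ← hlen, le_antisymm (hb t).2 (hs' ▸ h.mono g hst)]

end SymmPresentation

/-! ### Combings of the boundary -/

theorem DartGraph.IsWalk.take {K : DartGraph} {l : List K.D} {u v : K.V} (h : K.IsWalk l u v) (k : ℕ)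
    (hk : k ≤ l.length) :
    K.IsWalk (l.take k) u (K.walkVert u l k) ∧ K.IsWalk (l.drop k) (K.walkVert u l k) v := by
  have h1 := h
  rw [← List.take_append_drop k l] at h1
  obtain ⟨x, h2, h3⟩ := DartGraph.isWalk_append.1 h1
  have h4 := h2.walkVert_length
  rw [List.length_take, min_eq_left hk] at h4
  have h5 := DartGraph.walkVert_append_left (K := K) (l.take k) (l.drop k) u k (by simp [hk])
  rw [List.take_append_drop, h4] at h5
  rw [h5]
  exact ⟨h2, h3⟩

namespace VanKampenDiagram

open CombComplex SymmPresentation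

variable {G : Type*} [Group G] {P : SymmPresentation G} {w : List P.A} {Δ : VanKampenDiagram P w}

theorem exists_cutOff_between {i k : ℕ} (hik : i ≤ k) (hk : k ≤ Δ.boundary.length)
    (hx : Δ.walkVert Δ.base Δ.boundary i = Δ.walkVert Δ.base Δ.boundary k) :
    ∃ r, Δ.IsCutOff Δ.base (Δ.walkVert Δ.base Δ.boundary k) r ∧
      ∀ s : ℝ, i ≤ s → s ≤ k → r (Δ.walkPt Δ.base Δ.boundary s) =
        Δ.vert (Δ.walkVert Δ.base Δ.boundary k) := by
  have hw := Δ.boundary_walk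
  have h1 := (hw.take k hk).1
  have h2 := (h1.take i (by simp [hik, hk])).2
  have h3 := DartGraph.walkVert_append_left (K := Δ.toDartGraph) (Δ.boundary.take k)
    (Δ.boundary.drop k) Δ.base i (by simp [hik, hik.trans hk])
  rw [List.take_append_drop] at h3
  rw [← h3, hx] at h2
  have hb : Δ.boundary = Δ.boundary.take i ++ (Δ.boundary.take k).drop i ++ Δ.boundary.drop k := by
    have : Δ.boundary.take i = (Δ.boundary.take k).take i := by
      rw [List.take_take, min_eq_left hik]
    rw [this, List.take_append_drop, List.take_append_drop]
  obtain ⟨r, hr, hrx, hre⟩ := Δ.exists_cutOff hb h2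
  refine ⟨r, hr, fun s hs1 hs2 => ?_⟩
  rcases hik.eq_or_lt with rfl | hlt
  · rw [le_antisymm hs2 hs1, walkPt_nat hw _ hk, hrx]
  · obtain ⟨a, t, ha, hat⟩ := exists_nat_add_unit (n := k - i) (x := s - i) (by omega)
      (by linarith) (by rw [Nat.cast_sub hik]; linarith)
    have hs : s = ((i + a : ℕ) : ℝ) + t := by push_cast; linarith
    rw [hs, walkPt_edge hw (i + a) (by omega)]
    refine hre _ ?_ _
    refine List.mem_iff_getElem.2 ⟨a, by simp; omega, ?_⟩
    simp

/-- Replace a path to a point of the boundary by an earlier path to the same point. -/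
theorem exists_cap {Φ : ℝ → unitInterval → Δ.Space} (hΦ : IsBoundaryFamily Δ Φ) {i k : ℕ}
    (hik : i ≤ k) (hk : k ≤ Δ.boundary.length)
    (hx : Δ.walkVert Δ.base Δ.boundary i = Δ.walkVert Δ.base Δ.boundary k) :
    ∃ C : ℝ → unitInterval → Δ.Space, Continuous (fun q : ℝ × unitInterval => C q.1 q.2) ∧
      (∀ y, C y 0 = Δ.vert Δ.base) ∧ (∀ t, C 0 t = Φ i t) ∧ (∀ t, C 1 t = Φ k t) ∧
      (∀ y, 0 ≤ y → y ≤ 1 → C y 1 = Δ.vert (Δ.walkVert Δ.base Δ.boundary k)) ∧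
      ∀ (X : CombComplex) (o : X.V) (f : QuarterNat → QuarterNat) (π : Δ.Space → X.Space),
        (∀ x, X.TamePath o f fun t => π (Φ x t)) → ∀ y, X.TamePath o f fun t => π (C y t) := by
  obtain ⟨r, hr, hrb⟩ := exists_cutOff_between hik hk hx
  have hc : ∀ x, Continuous (Φ x) := fun x =>
    hΦ.continuous.comp (continuous_const.prodMk continuous_id)
  have hw := Δ.boundary_walk
  have hik' : (i : ℝ) ≤ k := by exact_mod_cast hik
  have hstable : ∀ a ≤ Δ.boundary.length, Δ.walkVert Δ.base Δ.boundary a =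
      Δ.walkVert Δ.base Δ.boundary k → ∀ t, r (Φ a t) = Φ a t := by
    intro a ha hax
    have h1 : Φ a 1 = Δ.vert (Δ.walkVert Δ.base Δ.boundary k) := by
      rw [hΦ.finish a (by positivity) (by exact_mod_cast ha), walkPt_nat hw a ha, hax]
    refine hr.eq_of_stable (hc a) (hΦ.start a) fun s t hst hs => ?_
    rw [← h1] at hs ⊢
    exact hΦ.stable a ha s t hst hs
  -- The paths to the boundary loop between visits i and k, cut off at the vertex. The loop itself
  -- collapses, so all of them end at the vertex; the first and the last are unchanged.
  refine ⟨fun y t => r (Φ (i + y * (k - i)) t), ?_, fun y => ?_, fun t => ?_, fun t => ?_,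
    fun y h0 h1 => ?_, fun X o f π h y => ?_⟩
  · have : Continuous fun q : ℝ × unitInterval => ((i : ℝ) + q.1 * (k - i), q.2) := by fun_prop
    exact hr.continuous.comp (hΦ.continuous.comp this)
  · simp only [hΦ.start]
    exact hr.eq_of_stable (γ := fun _ => Δ.vert Δ.base) continuous_const rfl (fun _ _ _ h => h) 0
  · simp only [zero_mul, add_zero]
    exact hstable i (hik.trans hk) hx t
  · simp only [one_mul, add_sub_cancel]
    exact hstable k hk rfl t
  · have h2 : (k : ℝ) ≤ Δ.boundary.length := by exact_mod_cast hk
    have h3 : 0 ≤ y * (k - i : ℝ) := mul_nonneg h0 (by linarith)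
    have h4 : y * (k - i : ℝ) ≤ 1 * (k - i) := mul_le_mul_of_nonneg_right h1 (by linarith)
    have h5 : (0 : ℝ) ≤ i := by positivity
    beta_reduce
    rw [hΦ.finish _ (by linarith) (by linarith)]
    exact hrb _ (by linarith) (by linarith)
  · exact hr.tamePath (hc _) (hΦ.start _) (h _)

/-- Paths to the points of a boundary edge that start and end with given paths to the endpoints. -/
theorem exists_edgeHomotopy {Φ : ℝ → unitInterval → Δ.Space} (hΦ : IsBoundaryFamily Δ Φ) {i j k : ℕ}
    (hk : k < Δ.boundary.length) (hik : i ≤ k) (hjk : j ≤ k + 1)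
    (hi : Δ.walkVert Δ.base Δ.boundary i = Δ.walkVert Δ.base Δ.boundary k)
    (hj : Δ.walkVert Δ.base Δ.boundary j = Δ.walkVert Δ.base Δ.boundary (k + 1)) :
    ∃ Q : ℝ → unitInterval → Δ.Space, Continuous (fun q : ℝ × unitInterval => Q q.1 q.2) ∧
      (∀ y, Q y 0 = Δ.vert Δ.base) ∧ (∀ t, Q 0 t = Φ i t) ∧ (∀ t, Q 3 t = Φ j t) ∧
      (∀ y, 0 ≤ y → y ≤ 3 →
        Q y 1 = Δ.edgePt Δ.boundary[k] (Set.projIcc 0 1 zero_le_one (y - 1))) ∧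
      ∀ (X : CombComplex) (o : X.V) (f : QuarterNat → QuarterNat) (π : Δ.Space → X.Space),
        (∀ x, X.TamePath o f fun t => π (Φ x t)) → ∀ y, X.TamePath o f fun t => π (Q y t) := by
  obtain ⟨C, c1, c2, c3, c4, c5, c6⟩ := exists_cap hΦ hik hk.le hi
  obtain ⟨C', c1', c2', c3', c4', c5', c6'⟩ := exists_cap hΦ hjk hk hj
  have hw := Δ.boundary_walk
  have hk' : (k : ℝ) + 1 ≤ Δ.boundary.length := by exact_mod_cast hk
  -- On [0,1] the cap at the initial vertex, on [1,2] the given paths to the points of the edge, on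
  -- [2,3] the cap at the terminal vertex, reversed.
  refine ⟨fun y t => if y ≤ 1 then C y t else if y ≤ 2 then Φ (k + (y - 1)) t else C' (3 - y) t,
    ?_, fun y => ?_, fun t => ?_, fun t => ?_, fun y h0 h3 => ?_, fun X o f π h y => ?_⟩
  · refine Continuous.if_le c1 (Continuous.if_le ?_ ?_ continuous_fst continuous_const ?_)
      continuous_fst continuous_const ?_
    · have : Continuous fun q : ℝ × unitInterval => ((k : ℝ) + (q.1 - 1), q.2) := by fun_prop
      exact hΦ.continuous.comp this
    · have : Continuous fun q : ℝ × unitInterval => (3 - q.1, q.2) := by fun_prop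
      exact c1'.comp this
    · rintro ⟨y, t⟩ (rfl : y = 2)
      have : (3 : ℝ) - 2 = 1 := by norm_num
      have h2 : (k : ℝ) + (2 - 1) = (k + 1 : ℕ) := by push_cast; ring
      simp only [this, c4', h2]
    · rintro ⟨y, t⟩ (rfl : y = 1)
      have : (1 : ℝ) ≤ 2 := by norm_num
      simp only [c4, sub_self, add_zero, if_pos this]
  · beta_reduce
    split_ifs
    exacts [c2 _, hΦ.start _, c2' _]
  · beta_reduce
    rw [if_pos zero_le_one, c3]
  · beta_reduce
    rw [if_neg (by norm_num), if_neg (by norm_num), sub_self, c3']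
  · beta_reduce
    split_ifs with h1 h2
    · rw [c5 y h0 h1, Set.projIcc_of_le_left _ (by linarith), ← hw.init_getElem k hk]
      exact (edgePt_zero _).symm
    · rw [hΦ.finish _ (by have : (0 : ℝ) ≤ k := by positivity
                          linarith) (by linarith)]
      have h4 : y - 1 ∈ Set.Icc (0 : ℝ) 1 := ⟨by linarith, by linarith⟩
      rw [Set.projIcc_of_mem _ h4]
      exact walkPt_edge hw k hk ⟨y - 1, h4⟩
    · rw [c5' _ (by linarith) (by linarith), Set.projIcc_of_right_le _ (by linarith),
        ← hw.term_getElem' k hk]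
      exact (edgePt_one _).symm
  · beta_reduce
    split_ifs
    exacts [c6 X o f π h y, h _, c6' X o f π h _]

end VanKampenDiagram

namespace SymmPresentation

open CombComplex VanKampenDiagram

variable {G : Type*} [Group G] {P : SymmPresentation G} {w : List P.A} {Δ : VanKampenDiagram P w}

/-- A family of paths to the points of the boundary path yields a combing of the boundary. -/
theorem IsBoundaryFamily.exists_combing {Φ : ℝ → unitInterval → Δ.Space}
    (hΦ : IsBoundaryFamily Δ Φ) (hw : w ≠ []) {π : Δ.Space → P.cayleyComplex.Space}
    (hπ : Δ.IsProjection π) {f : QuarterNat → QuarterNat} (hf : Monotone f)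
    (hdom : P.cayleyComplex.Dominates P.origin f)
    (ht : ∀ x, P.cayleyComplex.TamePath P.origin (QuarterNat.widen 2 f) fun t => π (Φ x t)) :
    ∃ ψ : Δ.boundarySet → unitInterval → Δ.Space, Δ.IsOneCombing Δ.boundarySet Δ.base ψ ∧
      P.cayleyComplex.IsTame P.origin (QuarterNat.widen 3 f) (fun p t => π (ψ p t)) := by
  classical
  obtain ⟨φ, hφ⟩ := hπ.exists_labelling
  have hb := Δ.boundary_walk
  have hfin : Finite Δ.D := Δ.finite_D
  have hne : Δ.boundary ≠ [] := by
    intro h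
    apply hw
    rw [← Δ.boundary_label, h]; rfl
  let Idx : Δ.V → ℕ → Prop := fun v i =>
    i ≤ Δ.boundary.length ∧ Δ.walkVert Δ.base Δ.boundary i = v
  -- The first visit to each vertex determines its path, so caps always run from an earlier to a
  -- later visit. The value 0 at vertices off the boundary plays no role.
  obtain ⟨idx, hidx1, hidx2, hidx3⟩ : ∃ idx : Δ.V → ℕ, (∀ v, idx v ≤ Δ.boundary.length) ∧
      (∀ v k, Idx v k → Δ.walkVert Δ.base Δ.boundary (idx v) = v) ∧
      ∀ v k, Idx v k → idx v ≤ k := by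
    refine ⟨fun v => if h : ∃ i, Idx v i then Nat.find h else 0, fun v => ?_, fun v k hk => ?_,
      fun v k hk => ?_⟩
    · beta_reduce
      split_ifs with h
      exacts [(Nat.find_spec h).1, Nat.zero_le _]
    · have h : ∃ i, Idx v i := ⟨k, hk⟩
      beta_reduce
      rw [dif_pos h]; exact (Nat.find_spec h).2
    · have h : ∃ i, Idx v i := ⟨k, hk⟩
      beta_reduce
      rw [dif_pos h]; exact Nat.find_min' h hk
  have hbase : idx Δ.base = 0 := Nat.le_zero.1 (hidx3 _ 0 ⟨Nat.zero_le _, by simp⟩)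
  let c : Δ.V → unitInterval → Δ.Space := fun v t => Φ (idx v) (early t)
  have hcc : ∀ x, Continuous (Φ x) := fun x =>
    hΦ.continuous.comp (continuous_const.prodMk continuous_id)
  have hedge : ∀ d, ∃ Θ : unitInterval → unitInterval → Δ.Space, d ∈ Δ.boundary →
      Continuous (fun q : unitInterval × unitInterval => Θ q.1 q.2) ∧
      (∀ t, Θ 0 t = c (Δ.init d) t) ∧ (∀ t, Θ 1 t = c (Δ.term d) t) ∧
      (∀ τ, Θ τ 0 = Δ.vert Δ.base) ∧ (∀ τ, Θ τ 1 = Δ.edgePt d τ) ∧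
      ∀ τ, P.cayleyComplex.TamePath P.origin (QuarterNat.widen 3 f) fun t => π (Θ τ t) := by
    intro d
    by_cases hd : d ∈ Δ.boundary
    swap
    · exact ⟨fun _ _ => Δ.vert Δ.base, fun h => absurd h hd⟩
    obtain ⟨k, hk, rfl⟩ := List.getElem_of_mem hd
    have hinit := hb.init_getElem k hk
    have hterm := hb.term_getElem' k hk
    have hI : Idx (Δ.init Δ.boundary[k]) k := ⟨hk.le, hinit.symm⟩
    have hT : Idx (Δ.term Δ.boundary[k]) (k + 1) := ⟨hk, hterm.symm⟩
    obtain ⟨Q, q1, q2, q3, q4, q5, q6⟩ := exists_edgeHomotopy hΦ hk (hidx3 _ _ hI) (hidx3 _ _ hT)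
      ((hidx2 _ _ hI).trans hinit) ((hidx2 _ _ hT).trans hterm)
    -- The path with index `3 * τ` ends at the wrong point of the edge, or at an endpoint; the
    -- second half moves the index to `1 + τ`, whose path ends at the point τ. The ends 0 and 3 keep
    -- the prescribed paths.
    refine ⟨fun τ t => Q (3 * τ + late t * (1 + τ - 3 * τ)) (early t), fun _ =>
      ⟨?_, fun t => ?_, fun t => ?_, fun τ => ?_, fun τ => ?_, fun τ => ?_⟩⟩
    · have : Continuous fun q : unitInterval × unitInterval =>
          ((3 * q.1 + late q.2 * (1 + q.1 - 3 * q.1) : ℝ), early q.2) := by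
        have := continuous_late
        have := continuous_early
        fun_prop
      exact q1.comp this
    · simp only [Set.Icc.coe_zero, mul_zero, zero_add, add_zero, sub_zero, mul_one, c]
      rcases le_total (t : ℝ) (1 / 2) with h | h
      · rw [late_eq_zero h, q3]
      · rw [early_eq_one h, q5 _ (late_nonneg t) (by linarith [late_le_one t]),
          Set.projIcc_of_le_left _ (by linarith [late_le_one t]), ← q3, q5 0 le_rfl (by norm_num),
          Set.projIcc_of_le_left _ (by norm_num)]
    · simp only [Set.Icc.coe_one, mul_one, c]
      rcases le_total (t : ℝ) (1 / 2) with h | h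
      · rw [late_eq_zero h, zero_mul, add_zero, q4]
      · have h1 := late_le_one t
        have h2 := late_nonneg t
        rw [early_eq_one h, q5 _ (by linarith) (by linarith),
          Set.projIcc_of_right_le _ (by linarith), ← q4, q5 3 (by norm_num) le_rfl,
          Set.projIcc_of_right_le _ (by norm_num)]
    · simp only [early_zero, q2]
    · have h1 := τ.2.1
      have h2 := τ.2.2
      simp only [early_one, late_one, one_mul]
      have : (3 * τ + (1 + τ - 3 * τ) : ℝ) = 1 + τ := by ring
      rw [this, q5 _ (by linarith) (by linarith), add_sub_cancel_left, Set.projIcc_val]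
    · refine tamePath_travel (Φ := fun y t => π (Q y t)) (x := 3 * τ) (z := 1 + τ) hf hdom
        (q6 _ _ _ _ ht _) ?_
      intro s s' hs hss hs'
      have h1 := τ.2.1
      have h2 := τ.2.2
      have hr : ∀ a : ℝ, 0 ≤ a → a ≤ 1 → 0 ≤ 3 * (τ : ℝ) + a * (1 + τ - 3 * τ) ∧
          3 * (τ : ℝ) + a * (1 + τ - 3 * τ) ≤ 3 := fun a h0 h1 => ⟨by nlinarith, by nlinarith⟩
      obtain ⟨a1, a2⟩ := hr s hs (hss.trans hs')
      obtain ⟨b1, b2⟩ := hr s' (hs.trans hss) hs'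
      simp only [q5 _ a1 a2, q5 _ b1 b2, hφ.edge]
      exact coarseDistRat_edge_le P.connectedFrom_origin (edgePt_mem_closedEdge _ _)
        (edgePt_mem_closedEdge _ _)
  choose Θ hΘ using hedge
  have : Nonempty Δ.Space := ⟨Δ.vert Δ.base⟩
  obtain ⟨Υ, hΥv, hΥe, hΥc⟩ := exists_edgewise (K := Δ.toCombComplex) hφ.init_ne_term
    {d | d ∈ Δ.boundary} (fun _ => Set.toFinite _) c
    (fun v => (hcc _).comp continuous_early) Θ (fun d hd => (hΘ d hd).1)
    (fun d hd => (hΘ d hd).2.1) (fun d hd => (hΘ d hd).2.2.1)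
  -- An edge may be traversed in both directions by the boundary walk, in which case only the
  -- selected direction describes the combing.
  have hsub : ∀ p ∈ Δ.boundarySet, ∃ d ∈ Δ.boundary, ∃ τ, p = Δ.edgePt d τ ∧ Υ p = Θ d τ := by
    have key : ∀ d ∈ Δ.boundary, ∀ τ, ∃ d' ∈ Δ.boundary, ∃ τ', Δ.edgePt d τ = Δ.edgePt d' τ' ∧
        Υ (Δ.edgePt d τ) = Θ d' τ' := by
      intro d hd τ
      obtain ⟨d', hd', rfl | rfl, h⟩ := hΥe d hd
      · exact ⟨_, hd', τ, rfl, h τ⟩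
      · have h2 : Δ.edgePt d τ = Δ.edgePt (Δ.rev d) (unitInterval.symm τ) := (edgePt_rev d τ).symm
        exact ⟨_, hd', unitInterval.symm τ, h2, by rw [h2, h]⟩
    rintro p (hp | hp)
    · obtain ⟨e, l, he⟩ := List.exists_cons_of_ne_nil hne
      have h1 : p = Δ.edgePt e 0 := by
        rw [he] at hb
        rw [hp, edgePt_zero, hb.1]
      rw [h1]
      exact key e (by rw [he]; simp) 0
    · obtain ⟨d, hd, τ, rfl⟩ := Set.mem_iUnion₂.1 hp
      exact key d hd τ
  refine ⟨fun p => Υ p, ⟨?_, ?_, ?_, ?_, ?_⟩, ?_⟩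
  · rw [← continuousOn_univ]
    refine hΥc.comp (f := fun q : Δ.boundarySet × unitInterval => ((q.1 : Δ.Space), q.2))
      (by fun_prop) ?_
    rintro ⟨⟨p, hp⟩, t⟩ -
    obtain ⟨d, hd, τ, h1, -⟩ := hsub p hp
    exact ⟨Or.inr (Set.mem_iUnion₂.2 ⟨d, hd, τ, h1.symm⟩), trivial⟩
  · rintro ⟨p, hp⟩
    obtain ⟨d, hd, τ, h1, h2⟩ := hsub p hp
    simp only [h2]
    exact (hΘ d hd).2.2.2.1 τ
  · rintro ⟨p, hp⟩
    obtain ⟨d, hd, τ, h1, h2⟩ := hsub p hp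
    simp only [h2, (hΘ d hd).2.2.2.2.1 τ, ← h1]
  · rintro ⟨p, hp⟩ hpb t
    simp only at hpb
    subst hpb
    simp only [hΥv, c, hbase, Nat.cast_zero]
    exact hΦ.base _
  · rintro ⟨p, hp⟩ ⟨v, hv⟩ t
    simp only at hv
    subst hv
    simp only [hΥv, c]
    exact hΦ.oneSkeleton _ (hidx1 v) _
  · rintro ⟨p, hp⟩ s t hst
    obtain ⟨d, hd, τ, h1, h2⟩ := hsub p hp
    simp only [h2]
    exact (hΘ d hd).2.2.2.2.2 τ s t hst.le

/-- The combing path to a vertex lies in the 1-skeleton, so it can be compared with its own end. -/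
theorem IsTameCombing.dominates {f : QuarterNat → QuarterNat} (h : P.IsTameCombing f) :
    P.cayleyComplex.Dominates P.origin f := by
  obtain ⟨hf, Υ, hΥ, ht⟩ := h
  refine dominates_of_vertices hf fun v => ?_
  have hv := vert_mem_oneSkeleton v
  refine dist_le_of_tame (γ := Υ ⟨_, hv⟩) P.connectedFrom_origin ?_ (hΥ.1.finish _)
    (hΥ.1.vertex ⟨_, hv⟩ ⟨v, rfl⟩) (ht _)
  exact hΥ.1.continuous.comp (continuous_const.prodMk continuous_id)

end SymmPresentation

/-! ### Tame fillings from tame combings -/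

namespace SymmPresentation

open CombComplex VanKampenDiagram

variable {G : Type*} [Group G] (P : SymmPresentation G)

/-- The van Kampen diagram with a single vertex. -/
def trivialDiagram : VanKampenDiagram P [] where
  V := Unit
  D := Empty
  rev := id
  rev_rev _ := rfl
  rev_ne d := d.elim
  init _ := ()
  F := Empty
  bdry f := f.elim
  bdry_ne_nil f := f.elim
  bdry_closed f := f.elim
  finite_V := inferInstance
  finite_D := inferInstance
  finite_F := inferInstance
  base := ()
  label d := d.elim
  label_rev d := d.elim
  boundary := []
  boundary_walk := rfl
  boundary_label := rfl
  bdry_label f := f.elim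
  connected _ := ⟨[], rfl⟩
  faceWalk _ := []
  faceWalk_none := rfl
  faceWalk_some f := f.elim
  left_face := ⟨fun c => c.2.elim0, fun d => d.elim⟩
  vertex_link d := d.elim
  euler := by simp

theorem exists_combing_nil {f : QuarterNat → QuarterNat} :
    ∃ (Δ : VanKampenDiagram P []) (ψ : Δ.boundarySet → unitInterval → Δ.Space)
      (π : Δ.Space → P.cayleyComplex.Space),
      Δ.IsOneCombing Δ.boundarySet Δ.base ψ ∧ Δ.IsProjection π ∧
      P.cayleyComplex.IsTame P.origin f (fun p t => π (ψ p t)) := by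
  obtain ⟨π, h1, h2, h3⟩ := exists_lift (K := P.trivialDiagram.toCombComplex)
    (fun _ => P.cayleyComplex.vert P.origin) (fun d => Empty.elim d) (fun f => Empty.elim f)
    (fun d => Empty.elim d) (fun d => Empty.elim d) (fun f => Empty.elim f)
  refine ⟨P.trivialDiagram, fun _ _ => P.trivialDiagram.vert P.trivialDiagram.base, π,
    ⟨continuous_const, fun _ => rfl, ?_, fun _ _ _ => rfl, fun _ _ _ => vert_mem_oneSkeleton _⟩,
    ⟨fun _ => 1, rfl, h1, fun d => Empty.elim d, fun f => Empty.elim f⟩, fun p s t _ => ?_⟩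
  · rintro ⟨p, hp | hp⟩
    · exact hp.symm
    · obtain ⟨d, -⟩ := Set.mem_iUnion.1 hp
      exact Empty.elim d
  · have h : P.cayleyComplex.coarseDistRat P.origin (P.cayleyComplex.vert P.origin) = 0 := by
      rw [coarseDistRat_vert, CombComplex.dist_self, Nat.cast_zero]
    change P.cayleyComplex.coarseDistRat P.origin (π _) ≤ (f _).1
    rw [h1, h]
    obtain ⟨k, hk⟩ := (f (P.cayleyComplex.coarseDist P.origin
      (π (P.trivialDiagram.vert P.trivialDiagram.base)))).2
    rw [hk]
    positivity

variable {P}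

/-- Every path in the glued diagram projects to a path of the combing, so tameness is inherited with
widening 2; making the paths well defined on the boundary costs 1 more. The empty word is filled by
a single vertex. -/
theorem IsTameCombing.isExtrinsicTameFilling {f : QuarterNat → QuarterNat}
    (h : P.IsTameCombing f) : P.IsExtrinsicTameFilling (QuarterNat.widen 3 f) := by
  have hdom := h.dominates
  obtain ⟨hf, Υ, hΥ, ht⟩ := h
  refine ⟨QuarterNat.widen_monotone hf 3, fun w hw1 => ?_⟩
  by_cases hw : w = []
  · subst hw
    exact P.exists_combing_nil
  obtain ⟨word, H, hs⟩ := hΥ.exists_stripFamily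
  obtain ⟨Δ, π, Φ, hπ, hΦ, hq⟩ := hs.exists_boundaryFamily hw hw1
  obtain ⟨ψ, h1, h2⟩ := hΦ.exists_combing hw hπ hf hdom fun x => by
    obtain ⟨q, hq⟩ := hq x
    simp only [hq]
    exact hdom.tamePath hf (ht q)
  exact ⟨Δ, ψ, π, h1, hπ, h2⟩

end SymmPresentation
end

/-! ### The equivalence -/

theorem mainTheorem1 {G : Type*} [Group G] (P : SymmPresentation G)
    (f : QuarterNat → QuarterNat) (hf : Monotone f) :
    (∃ g, LipschitzEquivalent f g ∧ P.IsExtrinsicTameFilling g) ↔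
      (∃ g, LipschitzEquivalent f g ∧ P.IsTameCombing g) := by
  constructor
  · rintro ⟨g, h, hg⟩
    exact ⟨_, h.widen hf hg.1 3, hg.isTameCombing⟩
  · rintro ⟨g, h, hg⟩
    exact ⟨_, h.widen hf hg.1 3, hg.isExtrinsicTameFilling⟩
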